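/- Let $\mathcal K$ be the class of equations $K_f$: $u_{tx}=f(t,x,u)$, where $f$ is a real smooth function on an open set of $(t,x,u)$-space with $f_{uu}\neq0$ (i.e. $f_{uu}$ does not vanish identically on any nonempty open subset of the domain, so that $f$ is nowhere locally affine in $u$). All transformations are local, i.e. smooth diffeomorphisms between open sets. A point (contact) admissible transformation of $\mathcal K$ is a triple $(f,\Phi,\tilde f)$ where $K_f,K_{\tilde f}\in\mathcal K$ and $\Phi$ is a point transformation of $(t,x,u)$-space, defined on the domain of $f$ with the domain of $\tilde f$ as its image (respectively, a contact transformation between open sets of $(t,x,u,u_t,u_x)$-space that project onto these domains), whose prolongation to second-order jets maps the equation $K_f$ to the equation $K_{\tilde f}$; these triples form the point (contact) equivalence groupoid of $\mathcal K$. The (usual) point equivalence pseudogroup $G^\sim$ of $\mathcal K$ consists of the transformations of the space of $(t,x,u,f)$, with $(t,x,u)$-components depending only on $(t,x,u)$, that map every equation of the class, over any part of the $(t,x,u)$-domain of the transformation, to an equation of the class. 1. The class $\mathcal K$ is normalized in the usual sense with respect to both point and contact transformations: its point equivalence groupoid coincides with the action groupoid of $G^\sim$, and its contact equivalence groupoid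 coincides with the action groupoid of the first prolongation of $G^\sim$. In the contact case this means: a triple $(f,\Phi,\tilde f)$ as above is contact admissible if and only if, near every first-order jet in its domain, $\Phi$ is the first prolongation of the $(t,x,u)$-part of an element of $G^\sim$ that maps $f$ to $\tilde f$ there. 2. $G^\sim$ is the pseudogroup generated by the transformations $$\tilde t=T(t),\quad \tilde x=X(x),\quad \tilde u=Cu+U^0(t,x),\quad \tilde f=\frac{Cf+U^0_{tx}}{T_tX_x}$$ and the discrete transformation $\mathscr I^0$: $\tilde t=x$, $\tilde x=t$, $\tilde u=u$, $\tilde f=f$. Here $T$, $X$ and $U^0$ are arbitrary smooth functions of their arguments (with $T$ and $X$ defined on open intervals and $U^0$ on their product) with $T_tX_x\neq0$, and $C$ is an arbitrary nonzero constant. Moreover, on every open box $I\times J\times K$ (a product of open intervals) contained in the $(t,x,u)$-domain of an element of $G^\sim$, this element is either of the displayed form or the composition of $\mathscr I^0$ with a transformation of the displayed form, with single $T$, $X$, $U^0$ and $C$. -/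

import Mathlib

open Set Filter Topology
open scoped ContDiff

noncomputable section

namespace KleinGordon

/-- The space with coordinates `(t, x, u)`. -/
abbrev Base := ℝ × ℝ × ℝ

/-- The first-order jet space with coordinates `((t, x, u), (u_t, u_x))`. -/
abbrev Jet := Base × (ℝ × ℝ)

/-- The space with coordinates `((t, x, u), f)`. -/
abbrev BaseF := Base × ℝ

/-! ### The class of equations -/

/-- The second derivative `f_uu`. -/
def secondU (f : Base → ℝ) (z : Base) : ℝ :=
  iteratedDeriv 2 (fun s : ℝ => f (z.1, z.2.1, s)) z.2.2

/-- An equation `u_tx = f(t,x,u)` of the class, given by the function `f`, smooth on an open domain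
`dom` of the space of `(t,x,u)`, with `f_uu ≠ 0`, that is, `f` is affine in `u` on no part of its
domain (`f_uu` vanishes identically on no nonempty open subset). The values of `f` outside
`dom` play no role. -/
structure Equation where
  dom : Set Base
  isOpen_dom : IsOpen dom
  f : Base → ℝ
  smooth : ContDiffOn ℝ ∞ f dom
  nonaffine : ∀ V ⊆ dom, IsOpen V → V.Nonempty → ∃ z ∈ V, secondU f z ≠ 0

/-! ### Total derivatives, prolongations, and the action on equations -/

/-- The total derivative `D_t F` of a function `F` of `(t,x,u,u_t,u_x)` at the first-order jet `w`,
where `a = u_tt`, `b = u_tx`. -/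
def totalT (F : Jet → ℝ) (w : Jet) (a b : ℝ) : ℝ :=
  fderiv ℝ F w ((1, 0, w.2.1), (a, b))

/-- The total derivative `D_x F` of a function `F` of `(t,x,u,u_t,u_x)` at the first-order jet `w`,
where `b = u_tx`, `c = u_xx`. -/
def totalX (F : Jet → ℝ) (w : Jet) (b c : ℝ) : ℝ :=
  fderiv ℝ F w ((0, 1, w.2.2), (b, c))

/-- The components `T, X, U, U^t, U^x` of a map between first-order jet spaces. -/
def cT (Φ : Jet → Jet) (w : Jet) : ℝ := (Φ w).1.1
def cX (Φ : Jet → Jet) (w : Jet) : ℝ := (Φ w).1.2.1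
def cU (Φ : Jet → Jet) (w : Jet) : ℝ := (Φ w).1.2.2
def cUt (Φ : Jet → Jet) (w : Jet) : ℝ := (Φ w).2.1
def cUx (Φ : Jet → Jet) (w : Jet) : ℝ := (Φ w).2.2

/-- The contact condition for `Φ` on the set `W`:
`U^t D_t T + U^x D_t X = D_t U` and `U^t D_x T + U^x D_x X = D_x U` identically in the
second-order derivatives of `u`. -/
def ContactCondition (Φ : Jet → Jet) (W : Set Jet) : Prop :=
  ∀ w ∈ W, ∀ a b c : ℝ,
    cUt Φ w * totalT (cT Φ) w a b + cUx Φ w * totalT (cX Φ) w a b = totalT (cU Φ) w a b ∧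
    cUt Φ w * totalX (cT Φ) w b c + cUx Φ w * totalX (cX Φ) w b c = totalX (cU Φ) w b c

/-- The determinant `D_t F D_x G - D_x F D_t G` at the second-order jet `(w, a, b, c)`. -/
def totalDet (F G : Jet → ℝ) (w : Jet) (a b c : ℝ) : ℝ :=
  totalT F w a b * totalX G w b c - totalX F w b c * totalT G w a b

/-- The map `Φ` of first-order jets, prolonged to second-order jets, maps the equation `u_tx = f`
to the equation `ũ_t̃x̃ = f̃` over the set `W`. Where `Δ := D_t T D_x X - D_x T D_t X` does not
vanish, i.e. where the prolongation is defined, the value of `ũ_t̃x̃` is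
`(D_t U^x D_x X - D_x U^x D_t X) / Δ = (D_t T D_x U^t - D_x T D_t U^t) / Δ`. -/
def MapsEquation (Φ : Jet → Jet) (W : Set Jet) (f f' : Base → ℝ) : Prop :=
  ∀ w ∈ W, ∀ a b c : ℝ, totalDet (cT Φ) (cX Φ) w a b c ≠ 0 →
    (b = f w.1 ↔
      totalDet (cUx Φ) (cX Φ) w a b c = f' (Φ w).1 * totalDet (cT Φ) (cX Φ) w a b c ∧
      totalDet (cT Φ) (cUt Φ) w a b c = f' (Φ w).1 * totalDet (cT Φ) (cX Φ) w a b c)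

/-- The total derivatives of a function of `(t,x,u)` only. -/
def baseTotalT (F : Base → ℝ) (w : Jet) : ℝ := fderiv ℝ F w.1 (1, 0, w.2.1)
def baseTotalX (F : Base → ℝ) (w : Jet) : ℝ := fderiv ℝ F w.1 (0, 1, w.2.2)

/-- The first prolongation of a map `φ = (T, X, U)` of the space of `(t,x,u)`: the components
`U^t`, `U^x` solve `U^t D_t T + U^x D_t X = D_t U`, `U^t D_x T + U^x D_x X = D_x U`. It is
meaningful at the jets `w` where `D_t T D_x X - D_x T D_t X ≠ 0`. -/
def prolong (φ : Base → Base) (w : Jet) : Jet :=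
  let T : Base → ℝ := fun z => (φ z).1
  let X : Base → ℝ := fun z => (φ z).2.1
  let U : Base → ℝ := fun z => (φ z).2.2
  let Δ := baseTotalT T w * baseTotalX X w - baseTotalX T w * baseTotalT X w
  (φ w.1,
    ((baseTotalT U w * baseTotalX X w - baseTotalX U w * baseTotalT X w) / Δ,
     (baseTotalT T w * baseTotalX U w - baseTotalX T w * baseTotalT U w) / Δ))

/-- A local homeomorphism is a (local) diffeomorphism of class `C^∞` from its source onto its
target. -/
def IsDiffeo {E : Type*} [NormedAddCommGroup E] [NormedSpace ℝ E]
    (Φ : OpenPartialHomeomorph E E) : Prop :=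
  ContDiffOn ℝ ∞ Φ Φ.source ∧ ContDiffOn ℝ ∞ Φ.symm Φ.target

/-! ### Equivalence groupoids -/

/-- The point equivalence groupoid of the class: the triples `(K_f, φ, K_f̃)` where `φ` is a point
transformation from the domain of `K_f` onto the domain of `K_f̃` that maps `K_f` to `K_f̃`. -/
def pointGroupoid : Set (Equation × OpenPartialHomeomorph Base Base × Equation) :=
  {A | IsDiffeo A.2.1 ∧ A.2.1.source = A.1.dom ∧ A.2.1.target = A.2.2.dom ∧
    MapsEquation (prolong A.2.1) {w | w.1 ∈ A.1.dom} A.1.f A.2.2.f}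

/-- The contact equivalence groupoid of the class: the triples `(K_f, Φ, K_f̃)` where `Φ` is a
contact transformation between open sets of first-order jets, which lie over the domains of
`K_f` and `K_f̃`, that maps `K_f` to `K_f̃`. -/
def contactGroupoid : Set (Equation × OpenPartialHomeomorph Jet Jet × Equation) :=
  {A | IsDiffeo A.2.1 ∧ ContactCondition A.2.1 A.2.1.source ∧
    Prod.fst '' A.2.1.source = A.1.dom ∧ Prod.fst '' A.2.1.target = A.2.2.dom ∧
    MapsEquation A.2.1 A.2.1.source A.1.f A.2.2.f}

/-! ### The equivalence (pseudo)group -/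

/-- The transformation `𝒯` of the space of `(t,x,u,f)` is fibred over the transformation `φ` of the
space of `(t,x,u)`: the `(t,x,u)`-components of `𝒯` are those of `φ` and do not involve `f`,
and no restriction is imposed on the values of `f`. -/
structure ProjectsTo (𝒯 : OpenPartialHomeomorph BaseF BaseF)
    (φ : OpenPartialHomeomorph Base Base) : Prop where
  source_eq : 𝒯.source = φ.source ×ˢ univ
  target_eq : 𝒯.target = φ.target ×ˢ univ
  fst_eq : ∀ w ∈ 𝒯.source, (𝒯 w).1 = φ w.1

/-- `𝒯`, which is fibred over `φ`, transforms the arbitrary element `f` on `Ω` to `f'`: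
the graph of `f` over `Ω` is mapped to the graph of `f'`. -/
def TransformsElement (𝒯 : OpenPartialHomeomorph BaseF BaseF)
    (φ : OpenPartialHomeomorph Base Base) (Ω : Set Base) (f f' : Base → ℝ) : Prop :=
  ∀ z ∈ Ω, 𝒯 (z, f z) = (φ z, f' (φ z))

/-- The usual point equivalence (pseudo)group of the class: the transformations of the space of
`(t,x,u,f)`, fibred over the space of `(t,x,u)`, such that each equation `K_f` of
the class, on any part of the base domain, is mapped by the `(t,x,u)`-components to
an equation `K_f̃` of the class, where `f̃` is the image of `f`. -/
def equivalenceGroup : Set (OpenPartialHomeomorph BaseF BaseF) :=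
  {𝒯 | IsDiffeo 𝒯 ∧ ∃ φ : OpenPartialHomeomorph Base Base, ProjectsTo 𝒯 φ ∧
    ∀ E : Equation, E.dom ⊆ φ.source →
      ∃ E' : Equation, (E, φ.restr E.dom, E') ∈ pointGroupoid ∧
        TransformsElement 𝒯 φ E.dom E.f E'.f}

/-- The action groupoid of a family `G` of transformations of the space of `(t,x,u,f)`: the triples
`(K_f, φ, K_f̃)`, where `φ` is the `(t,x,u)`-part of some `𝒯 ∈ G` defined over the domain
of `K_f`, and `f̃` is the image of `f` under `𝒯`. -/
def actionGroupoid (G : Set (OpenPartialHomeomorph BaseF BaseF)) :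
    Set (Equation × OpenPartialHomeomorph Base Base × Equation) :=
  {A | A.2.1.source = A.1.dom ∧ A.2.1.target = A.2.2.dom ∧
    ∃ 𝒯 ∈ G, ProjectsTo 𝒯 A.2.1 ∧ TransformsElement 𝒯 A.2.1 A.1.dom A.1.f A.2.2.f}

/-- The action groupoid of the first prolongation of `G`. As a contact transformation may be
given on any open set of first-order jets, the transformations are those that
near every jet of their source are the first prolongation of the `(t,x,u)`-part of
some `𝒯 ∈ G`, where `f̃` is the image of `f` under `𝒯`. -/
def prolongedActionGroupoid (G : Set (OpenPartialHomeomorph BaseF BaseF)) :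
    Set (Equation × OpenPartialHomeomorph Jet Jet × Equation) :=
  {A | Prod.fst '' A.2.1.source = A.1.dom ∧ Prod.fst '' A.2.1.target = A.2.2.dom ∧
    ∀ w ∈ A.2.1.source, ∃ 𝒯 ∈ G, ∃ φ : OpenPartialHomeomorph Base Base, ProjectsTo 𝒯 φ ∧
      ∃ V : Set Base, IsOpen V ∧ w.1 ∈ V ∧ V ⊆ φ.source ∩ A.1.dom ∧
        TransformsElement 𝒯 φ V A.1.f A.2.2.f ∧
        ∀ᶠ w' in 𝓝 w, A.2.1 w' = prolong φ w'}

/-! ### Generation -/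

/-- A family of fibred transformations of the space of `(t,x,u,f)` is a pseudogroup: it contains the
identity, is closed under composition and inversion, and contains each fibred transformation
that near every point of its base domain coincides with a member of the family
(in particular, it is closed under restriction of the base domain and gluing). -/
structure IsPseudogroup (P : Set (OpenPartialHomeomorph BaseF BaseF)) : Prop where
  fibred : ∀ 𝒯 ∈ P, ∃ φ, ProjectsTo 𝒯 φ
  refl_mem : OpenPartialHomeomorph.refl BaseF ∈ P
  trans_mem : ∀ 𝒯 ∈ P, ∀ 𝒮 ∈ P, 𝒯.trans 𝒮 ∈ P
  symm_mem : ∀ 𝒯 ∈ P, 𝒯.symm ∈ P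
  local_mem : ∀ 𝒯 φ, ProjectsTo 𝒯 φ →
    (∀ z ∈ φ.source, ∃ 𝒮 ∈ P, ∃ V : Set Base, IsOpen V ∧ z ∈ V ∧
      V ×ˢ (univ : Set ℝ) ⊆ 𝒯.source ∩ 𝒮.source ∧ EqOn 𝒯 𝒮 (V ×ˢ (univ : Set ℝ))) →
    𝒯 ∈ P

/-- The pseudogroup generated by a family `S`: the intersection of all pseudogroups that
contain `S`. -/
def generatedPseudogroup (S : Set (OpenPartialHomeomorph BaseF BaseF)) :
    Set (OpenPartialHomeomorph BaseF BaseF) :=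
  ⋂₀ {P | IsPseudogroup P ∧ S ⊆ P}

/-- The mixed derivative `V_tx` of a function of `(t,x)`. -/
def mixed (V : ℝ × ℝ → ℝ) (t x : ℝ) : ℝ :=
  deriv (fun x' : ℝ => deriv (fun t' : ℝ => V (t', x')) t) x

/-- Admissible parameters: `T` and `X` are smooth functions with nonvanishing derivatives on the open
intervals `I` and `J`, `U₀` is a smooth function on `I × J`, and `C` is a nonzero constant. -/
structure IsParameter (I J : Set ℝ) (T X : ℝ → ℝ) (U₀ : ℝ × ℝ → ℝ) (C : ℝ) : Prop where
  isOpen_left : IsOpen I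
  isOpen_right : IsOpen J
  interval_left : I.OrdConnected
  interval_right : J.OrdConnected
  smooth_T : ContDiffOn ℝ ∞ T I
  smooth_X : ContDiffOn ℝ ∞ X J
  smooth_U : ContDiffOn ℝ ∞ U₀ (I ×ˢ J)
  deriv_T : ∀ t ∈ I, deriv T t ≠ 0
  deriv_X : ∀ x ∈ J, deriv X x ≠ 0
  const_ne : C ≠ 0

/-- The map `t̃ = T(t)`, `x̃ = X(x)`, `ũ = C u + U₀(t,x)`, `f̃ = (C f + U₀_tx) / (T_t X_x)`. -/
def formMap (T X : ℝ → ℝ) (U₀ : ℝ × ℝ → ℝ) (C : ℝ) (w : BaseF) : BaseF :=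
  ((T w.1.1, X w.1.2.1, C * w.1.2.2 + U₀ (w.1.1, w.1.2.1)),
    (C * w.2 + mixed U₀ w.1.1 w.1.2.1) / (deriv T w.1.1 * deriv X w.1.2.1))

/-- The map `t̃ = x`, `x̃ = t`, `ũ = u`, `f̃ = f`. -/
def swapMap (w : BaseF) : BaseF := ((w.1.2.1, w.1.1, w.1.2.2), w.2)

/-- The transformations given by `formMap`, on all `(t,x,u,f)` with `t ∈ I`, `x ∈ J`. -/
def formTransformations : Set (OpenPartialHomeomorph BaseF BaseF) :=
  {𝒯 | ∃ (I J : Set ℝ) (T X : ℝ → ℝ) (U₀ : ℝ × ℝ → ℝ) (C : ℝ), IsParameter I J T X U₀ C ∧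
    𝒯.source = {w | w.1.1 ∈ I ∧ w.1.2.1 ∈ J} ∧ EqOn 𝒯 (formMap T X U₀ C) 𝒯.source}

/-- The discrete transformation given by `swapMap`, on the whole space. -/
def swapTransformation : Set (OpenPartialHomeomorph BaseF BaseF) :=
  {𝒯 | 𝒯.source = univ ∧ ∀ w, 𝒯 w = swapMap w}

end KleinGordon

end

/-!
The equation `u_tx = f` has two *characteristic plane fields* on the space of first-order jets: in
the contact planes `du = u_t dt + u_x dx`, the plane `dx = 0`, `du_x = f dt` and the plane `dt = 0`,
`du_t = f dx`. Everything follows from what a contact transformation can do to them.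

*Contact transformations preserve or interchange the characteristics.* A contact transformation is
conformally symplectic on the contact planes (`ContactCondition.conformal`). If it maps `K_f` to
`K_f'`, the image of the 2-plane `u_tx = f(t,x,u)`, `u_tt = a`, `u_xx = c` satisfies the image
equation for all `a` and `c`; comparing coefficients of `a`, `c`, `ac` in this condition gives, with
the symplectic relations, that the transformation maps characteristic planes to characteristic
planes (`Conformal.characteristic_cases`). Which of the two fields goes to which is locally
constant, and the swap `t ↔ x` reduces the second case to the first.

*The characteristics of an equation of the class have few integrals.* Since `dX` vanishes on the
planes `dx = 0`, it vanishes on their derived flag. Bracketing `∂_{u_t}` with `D_t + f ∂_{u_x}`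
gives `∂_u`, and bracketing with `∂_u` gives `f_u ∂_{u_x}`; as `f_u ≠ 0` on a dense set, this leaves
`X = X(x)`, and likewise `T = T(t)` (`fderiv_eq_zero_of_characteristic`). The contact condition now
makes `U` a function of `(t,x,u)` with `U^t = (U_t + u_t U_u)/T_t` and `U^x = (U_x + u_x U_u)/X_x`.
On `K_f` the new mixed derivative is `(U_tx + U_xu u_t + U_tu u_x + U_uu u_t u_x + U_u f)/(T_t
X_x)`, and it has to be a function of `(t,x,u)`; so the coefficients of `u_t`, `u_x` and `u_t u_x`
vanish and `U = C u + U₀(t,x)` (`PreservesChar.exists_nearForm`, `exists_baseForm`). The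
prolongation of a point transformation is a contact transformation, defined at some jet over each
point (`exists_prolongDet_ne_zero`), so the same result covers point transformations.

*From the local form to the groupoids and the pseudogroup.* For a transformation `φ` of the base
which is locally of the displayed form, possibly swapped, the induced transformation of `f` can be
written in terms of `φ` alone (`liftMap`), and it is functorial in `φ`. This describes the point
groupoid (`mem_pointGroupoid_iff`) and the equivalence pseudogroup (`mem_equivalenceGroup_iff`) by
the same local condition on `φ`, whence normalization; closure under composition, inversion and
gluing; and generation, as every element is locally a displayed transformation or such a
transformation followed by the swap.

On a box, connectedness excludes that both types occur, and the linear differential conditions `T_x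
= T_u = 0`, `X_t = X_u = 0`, `d(U_u) = 0`, which characterize the displayed form (`FormDeriv`),
integrate to single functions `T`, `X`, `U₀` and a single constant `C` (`exists_parameters`).
-/

namespace KleinGordon

/-! ### Directional derivatives -/

section Calculus

variable {E : Type*} [NormedAddCommGroup E] [NormedSpace ℝ E]

theorem _root_.ContDiffAt.fderiv_apply_const {F : E → ℝ} {x : E} (h : ContDiffAt ℝ ∞ F x) (v : E) :
    ContDiffAt ℝ ∞ (fun y => fderiv ℝ F y v) x :=
  (h.fderiv_right (m := ∞) (by norm_cast)).clm_apply contDiffAt_const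

theorem fderiv_fderiv_apply_comm {F : E → ℝ} {x : E} (h : ContDiffAt ℝ ∞ F x) (v v' : E) :
    fderiv ℝ (fun y => fderiv ℝ F y v) x v' = fderiv ℝ (fun y => fderiv ℝ F y v') x v := by
  have hd : DifferentiableAt ℝ (fderiv ℝ F) x :=
    (h.fderiv_right (m := ∞) (by norm_cast)).differentiableAt (by simp)
  have key : ∀ v v' : E,
      fderiv ℝ (fun y => fderiv ℝ F y v) x v' = fderiv ℝ (fderiv ℝ F) x v' v := by
    intro v v'
    rw [(hd.hasFDerivAt.clm_apply (hasFDerivAt_const v x)).fderiv]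
    simp
  have hs : IsSymmSndFDerivAt ℝ F x := h.isSymmSndFDerivAt (by
    simpa using (mod_cast le_top : ((2 : ℕ∞) : WithTop ℕ∞) ≤ ∞))
  rw [key, key, hs v' v]

/-- A function on a convex set whose derivative vanishes in the direction `b - a` takes the same
value at `a` and at `b`. -/
theorem eq_of_fderiv_apply_sub_eq_zero {F : E → ℝ} {s : Set E} (hs : Convex ℝ s)
    (hd : ∀ x ∈ s, DifferentiableAt ℝ F x) {a b : E} (ha : a ∈ s) (hb : b ∈ s)
    (h0 : ∀ x ∈ s, fderiv ℝ F x (b - a) = 0) : F a = F b := by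
  have hline : ∀ r : ℝ, HasDerivAt (fun r : ℝ => a + r • (b - a)) (b - a) r := fun r => by
    simpa using ((hasDerivAt_id r).smul_const (b - a)).const_add a
  have hmem : ∀ r ∈ Icc (0 : ℝ) 1, a + r • (b - a) ∈ s := fun r hr => by
    have := hs.add_smul_sub_mem ha hb hr
    simpa using this
  have hder : ∀ r ∈ Icc (0 : ℝ) 1, HasDerivAt (fun r : ℝ => F (a + r • (b - a))) 0 r := by
    intro r hr
    have := (hd _ (hmem r hr)).hasFDerivAt.comp_hasDerivAt r (hline r)
    rwa [h0 _ (hmem r hr)] at this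
  have hc := constant_of_has_deriv_right_zero
    (f := fun r : ℝ => F (a + r • (b - a))) (a := 0) (b := 1)
    (fun r hr => (hder r hr).continuousAt.continuousWithinAt)
    (fun r hr => (hder r (Ico_subset_Icc_self hr)).hasDerivWithinAt) 1 (by simp)
  simpa using hc.symm

theorem fderiv_fderiv_apply_eq_zero {F : E → ℝ} {W : Set E} (hW : IsOpen W)
    (hF : ∀ x ∈ W, ContDiffAt ℝ ∞ F x) {v : E} (h0 : ∀ x ∈ W, fderiv ℝ F x v = 0)
    {x : E} (hx : x ∈ W) (v' : E) : fderiv ℝ (fun y => fderiv ℝ F y v') x v = 0 := by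
  rw [fderiv_fderiv_apply_comm (hF x hx) v' v]
  have : (fun y => fderiv ℝ F y v) =ᶠ[𝓝 x] fun _ => 0 := by
    filter_upwards [hW.mem_nhds hx] with y hy using h0 y hy
  rw [this.fderiv_eq]
  simp

end Calculus

/-! ### Characteristic planes of a conformally symplectic map -/

/-- If a function `h` that is affine in each of two variables does not vanish identically, then a
function `g` of the same kind that vanishes wherever `h` does not is zero. -/
theorem biaffine_eq_zero {h₀ h₁ h₂ h₃ g₀ g₁ g₂ g₃ a₀ c₀ : ℝ}
    (hne : h₀ + h₁ * a₀ + h₂ * c₀ + h₃ * (a₀ * c₀) ≠ 0)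
    (hg : ∀ a c : ℝ, h₀ + h₁ * a + h₂ * c + h₃ * (a * c) ≠ 0 →
      g₀ + g₁ * a + g₂ * c + g₃ * (a * c) = 0) :
    g₀ = 0 ∧ g₁ = 0 ∧ g₂ = 0 ∧ g₃ = 0 := by
  -- `h` does not vanish at the corners of a small square at `(a₀, c₀)`
  have ev : ∀ i j : ℝ, ∀ᶠ s in 𝓝[≠] (0 : ℝ),
      h₀ + h₁ * (a₀ + i * s) + h₂ * (c₀ + j * s) + h₃ * ((a₀ + i * s) * (c₀ + j * s)) ≠ 0 := by
    intro i j
    refine (ContinuousAt.eventually_ne (by fun_prop) ?_).filter_mono nhdsWithin_le_nhds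
    simpa using hne
  obtain ⟨s, h1, h2, h3, h4, hs⟩ := ((ev 0 0).and ((ev 1 0).and ((ev 0 1).and
    ((ev 1 1).and self_mem_nhdsWithin)))).exists
  have hs : s ≠ 0 := hs
  have e1 := hg _ _ h1
  have e2 := hg _ _ h2
  have e3 := hg _ _ h3
  have e4 := hg _ _ h4
  have k3 : g₃ = 0 := by
    have : s * (s * g₃) = 0 := by linear_combination e1 - e2 - e3 + e4
    simpa [hs] using this
  subst k3
  have k1 : g₁ = 0 := by
    have : s * g₁ = 0 := by linear_combination e2 - e1
    simpa [hs] using this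
  have k2 : g₂ = 0 := by
    have : s * g₂ = 0 := by linear_combination e3 - e1
    simpa [hs] using this
  subst k1 k2
  exact ⟨by linear_combination e1, rfl, rfl, rfl⟩

/-- The components of the differentials of `T`, `X`, `U^t`, `U^x` in the basis
`D_t + f ∂_{u_x}, D_x + f ∂_{u_t}, ∂_{u_t}, ∂_{u_x}` of the contact plane at a jet, for a map that
is conformally symplectic on this plane, with the factor `l`. -/
structure Conformal (t x p q : Fin 4 → ℝ) (l : ℝ) : Prop where
  h12 : t 0 * p 1 - t 1 * p 0 + (x 0 * q 1 - x 1 * q 0) = 0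
  h13 : t 0 * p 2 - t 2 * p 0 + (x 0 * q 2 - x 2 * q 0) = l
  h14 : t 0 * p 3 - t 3 * p 0 + (x 0 * q 3 - x 3 * q 0) = 0
  h23 : t 1 * p 2 - t 2 * p 1 + (x 1 * q 2 - x 2 * q 1) = 0
  h24 : t 1 * p 3 - t 3 * p 1 + (x 1 * q 3 - x 3 * q 1) = l
  h34 : t 2 * p 3 - t 3 * p 2 + (x 2 * q 3 - x 3 * q 2) = 0

namespace Conformal

variable {t x p q : Fin 4 → ℝ} {l : ℝ}

/-- The Pfaffian of the symplectic form, which is `l²` up to sign, as the determinant of the map. -/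
theorem sq_eq (h : Conformal t x p q l) : l ^ 2 =
    (t 0 * x 1 - t 1 * x 0) * (p 2 * q 3 - p 3 * q 2)
    - (t 0 * x 2 - t 2 * x 0) * (p 1 * q 3 - p 3 * q 1)
    + (t 0 * x 3 - t 3 * x 0) * (p 1 * q 2 - p 2 * q 1)
    + (t 1 * x 2 - t 2 * x 1) * (p 0 * q 3 - p 3 * q 0)
    - (t 1 * x 3 - t 3 * x 1) * (p 0 * q 2 - p 2 * q 0)
    + (t 2 * x 3 - t 3 * x 2) * (p 0 * q 1 - p 1 * q 0) := by
  linear_combination (-l) * h.h13 - (t 0 * p 2 - t 2 * p 0 + (x 0 * q 2 - x 2 * q 0)) * h.h24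
    + (t 2 * p 3 - t 3 * p 2 + (x 2 * q 3 - x 3 * q 2)) * h.h12
    + (t 1 * p 2 - t 2 * p 1 + (x 1 * q 2 - x 2 * q 1)) * h.h14

end Conformal

/-- If two linear forms on a four-dimensional space satisfy four of the six relations of
proportionality, then a pair of coordinates vanishes on both, or they are proportional. -/
theorem pluecker_cases {r x : Fin 4 → ℝ}
    (h12 : r 0 * x 1 - r 1 * x 0 = 0) (h14 : r 0 * x 3 - r 3 * x 0 = 0)
    (h23 : r 2 * x 1 - r 1 * x 2 = 0) (h34 : r 2 * x 3 - r 3 * x 2 = 0) :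
    (r 1 = 0 ∧ r 3 = 0 ∧ x 1 = 0 ∧ x 3 = 0) ∨ (r 0 = 0 ∧ r 2 = 0 ∧ x 0 = 0 ∧ x 2 = 0) ∨
      (r 0 * x 2 - r 2 * x 0 = 0 ∧ r 1 * x 3 - r 3 * x 1 = 0) := by
  by_cases h13 : r 0 * x 2 - r 2 * x 0 = 0
  · by_cases h24 : r 1 * x 3 - r 3 * x 1 = 0
    · exact Or.inr (Or.inr ⟨h13, h24⟩)
    · refine Or.inr (Or.inl ⟨?_, ?_, ?_, ?_⟩) <;> refine (mul_eq_zero.1 ?_).resolve_left h24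
      · linear_combination (-r 3) * h12 + r 1 * h14
      · linear_combination (-r 3) * h23 + r 1 * h34
      · linear_combination (-x 3) * h12 + x 1 * h14
      · linear_combination (-x 3) * h23 + x 1 * h34
  · refine Or.inl ⟨?_, ?_, ?_, ?_⟩ <;> refine (mul_eq_zero.1 ?_).resolve_left h13
    · linear_combination r 2 * h12 - r 0 * h23
    · linear_combination r 2 * h14 - r 0 * h34
    · linear_combination x 2 * h12 - x 0 * h23
    · linear_combination x 2 * h14 - x 0 * h34

/-- The value of `D_t F D_x G - D_x F D_t G` on the equation `u_tx = f`, where `a = u_tt` and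
`c = u_xx`, in terms of the components of `dF` and `dG` in the basis of `Conformal`. -/
def det₂ (r x : Fin 4 → ℝ) (a c : ℝ) : ℝ :=
  (r 0 + a * r 2) * (x 1 + c * x 3) - (r 1 + c * r 3) * (x 0 + a * x 2)

theorem det₂_expand (r x : Fin 4 → ℝ) (a c : ℝ) : det₂ r x a c =
    (r 0 * x 1 - r 1 * x 0) + (r 2 * x 1 - r 1 * x 2) * a + (r 0 * x 3 - r 3 * x 0) * c
      + (r 2 * x 3 - r 3 * x 2) * (a * c) := by
  unfold det₂; ring

namespace Conformal

variable {t x p q : Fin 4 → ℝ} {l : ℝ}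

/-- The total Jacobian determinant of a contact transformation does not vanish identically on an
equation `u_tx = f`. -/
theorem exists_det₂_ne_zero (h : Conformal t x p q l) (hl : l ≠ 0) :
    ∃ a c, det₂ t x a c ≠ 0 := by
  by_contra! H
  have e0 := H 0 0
  have e1 := H 1 0
  have e2 := H 0 1
  have e3 := H 1 1
  simp only [det₂_expand] at e0 e1 e2 e3
  have h12 : t 0 * x 1 - t 1 * x 0 = 0 := by linear_combination e0
  have h23 : t 2 * x 1 - t 1 * x 2 = 0 := by linear_combination e1 - e0
  have h14 : t 0 * x 3 - t 3 * x 0 = 0 := by linear_combination e2 - e0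
  have h34 : t 2 * x 3 - t 3 * x 2 = 0 := by linear_combination e3 - e2 - e1 + e0
  refine hl ?_
  rcases pluecker_cases h12 h14 h23 h34 with ⟨k1, k2, k3, k4⟩ | ⟨k1, k2, k3, k4⟩ | ⟨h13, h24⟩
  · rw [← h.h24, k1, k2, k3, k4]; ring
  · rw [← h.h13, k1, k2, k3, k4]; ring
  · have := h.sq_eq
    have h0 : l ^ 2 = 0 := by
      rw [this]
      linear_combination (p 2 * q 3 - p 3 * q 2) * h12 - (p 1 * q 3 - p 3 * q 1) * h13
        + (p 1 * q 2 - p 2 * q 1) * h14 - (p 0 * q 3 - p 3 * q 0) * h23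
        - (p 0 * q 2 - p 2 * q 0) * h24 + (p 0 * q 1 - p 1 * q 0) * h34
    exact pow_eq_zero_iff (two_ne_zero) |>.1 h0

/-- A conformally symplectic map that maps the plane element of `u_tx = f` to that of an equation
of the same form preserves the two characteristic planes or interchanges them. -/
theorem characteristic_cases (h : Conformal t x p q l) (hl : l ≠ 0) (g : ℝ)
    (H : ∀ a c, det₂ t x a c ≠ 0 →
      det₂ q x a c = g * det₂ t x a c ∧ det₂ t p a c = g * det₂ t x a c) :
    (t 1 = 0 ∧ t 3 = 0 ∧ x 0 = 0 ∧ x 2 = 0) ∨ (t 0 = 0 ∧ t 2 = 0 ∧ x 1 = 0 ∧ x 3 = 0) := by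
  obtain ⟨a₀, c₀, hne⟩ := h.exists_det₂_ne_zero hl
  have hne' := hne
  rw [det₂_expand] at hne'
  -- the forms `dU^x - g dT` and `dX` are annihilated by a common characteristic plane
  have hX : (x 1 = 0 ∧ x 3 = 0) ∨ (x 0 = 0 ∧ x 2 = 0) := by
    obtain ⟨k0, k1, k2, k3⟩ := biaffine_eq_zero
      (g₀ := (q 0 - g * t 0) * x 1 - (q 1 - g * t 1) * x 0)
      (g₁ := (q 2 - g * t 2) * x 1 - (q 1 - g * t 1) * x 2)
      (g₂ := (q 0 - g * t 0) * x 3 - (q 3 - g * t 3) * x 0)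
      (g₃ := (q 2 - g * t 2) * x 3 - (q 3 - g * t 3) * x 2) hne' (fun a c hac => by
        rw [← det₂_expand] at hac
        have := (H a c hac).1
        rw [det₂_expand, det₂_expand] at this
        linear_combination this)
    rcases pluecker_cases (r := fun i => q i - g * t i) (x := x) k0 k2 k1 k3 with
      ⟨-, -, k4, k5⟩ | ⟨-, -, k4, k5⟩ | ⟨k4, k5⟩
    · exact Or.inl ⟨k4, k5⟩
    · exact Or.inr ⟨k4, k5⟩
    · exfalso
      refine hl (pow_eq_zero_iff (two_ne_zero) |>.1 ?_)
      rw [h.sq_eq]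
      linear_combination (t 2 * p 3 - t 3 * p 2) * k0 - (t 1 * p 3 - t 3 * p 1) * k4
        + (t 1 * p 2 - t 2 * p 1) * k2 - (t 0 * p 3 - t 3 * p 0) * k1
        - (t 0 * p 2 - t 2 * p 0) * k5 + (t 0 * p 1 - t 1 * p 0) * k3
  have hT : (t 1 = 0 ∧ t 3 = 0) ∨ (t 0 = 0 ∧ t 2 = 0) := by
    obtain ⟨k0, k1, k2, k3⟩ := biaffine_eq_zero
      (g₀ := t 0 * (p 1 - g * x 1) - t 1 * (p 0 - g * x 0))
      (g₁ := t 2 * (p 1 - g * x 1) - t 1 * (p 2 - g * x 2))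
      (g₂ := t 0 * (p 3 - g * x 3) - t 3 * (p 0 - g * x 0))
      (g₃ := t 2 * (p 3 - g * x 3) - t 3 * (p 2 - g * x 2)) hne' (fun a c hac => by
        rw [← det₂_expand] at hac
        have := (H a c hac).2
        rw [det₂_expand, det₂_expand] at this
        linear_combination this)
    rcases pluecker_cases (r := t) (x := fun i => p i - g * x i) k0 k2 k1 k3 with
      ⟨k4, k5, -, -⟩ | ⟨k4, k5, -, -⟩ | ⟨k4, k5⟩
    · exact Or.inl ⟨k4, k5⟩
    · exact Or.inr ⟨k4, k5⟩
    · exfalso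
      refine hl (pow_eq_zero_iff (two_ne_zero) |>.1 ?_)
      rw [h.sq_eq]
      linear_combination (-(x 2 * q 3 - x 3 * q 2)) * k0 + (x 1 * q 3 - x 3 * q 1) * k4
        - (x 1 * q 2 - x 2 * q 1) * k2 + (x 0 * q 3 - x 3 * q 0) * k1
        + (x 0 * q 2 - x 2 * q 0) * k5 - (x 0 * q 1 - x 1 * q 0) * k3
  rcases hT with ⟨t1, t3⟩ | ⟨t0, t2⟩ <;> rcases hX with ⟨x1, x3⟩ | ⟨x0, x2⟩
  · exact absurd (by simp [det₂, *]) hne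
  · exact Or.inl ⟨t1, t3, x0, x2⟩
  · exact Or.inr ⟨t0, t2, x1, x3⟩
  · exact absurd (by simp [det₂, *]) hne

end Conformal

/-! ### Transformations of the base -/

/-- The `(t,x,u)`-part of `formMap`. -/
def formBase (T X : ℝ → ℝ) (U₀ : ℝ × ℝ → ℝ) (C : ℝ) (z : Base) : Base :=
  (T z.1, X z.2.1, C * z.2.2 + U₀ (z.1, z.2.1))

/-- The `(t,x,u)`-part of `swapMap`. -/
def swapBase (z : Base) : Base := (z.2.1, z.1, z.2.2)

@[simp] theorem swapBase_swapBase (z : Base) : swapBase (swapBase z) = z := rfl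

@[simp] theorem swapMap_swapMap (w : BaseF) : swapMap (swapMap w) = w := rfl

theorem contDiff_swapBase : ContDiff ℝ ∞ swapBase := by
  unfold swapBase; fun_prop

theorem continuous_swapBase : Continuous swapBase := contDiff_swapBase.continuous

namespace IsParameter

variable {I J : Set ℝ} {T X : ℝ → ℝ} {U₀ : ℝ × ℝ → ℝ} {C t x : ℝ}

theorem contDiffAt_T (h : IsParameter I J T X U₀ C) (ht : t ∈ I) : ContDiffAt ℝ ∞ T t :=
  h.smooth_T.contDiffAt (h.isOpen_left.mem_nhds ht)

theorem contDiffAt_X (h : IsParameter I J T X U₀ C) (hx : x ∈ J) : ContDiffAt ℝ ∞ X x :=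
  h.smooth_X.contDiffAt (h.isOpen_right.mem_nhds hx)

theorem contDiffAt_U (h : IsParameter I J T X U₀ C) (ht : t ∈ I) (hx : x ∈ J) :
    ContDiffAt ℝ ∞ U₀ (t, x) :=
  h.smooth_U.contDiffAt ((h.isOpen_left.prod h.isOpen_right).mem_nhds ⟨ht, hx⟩)

theorem mono (h : IsParameter I J T X U₀ C) {I' J' : Set ℝ} (hI : I' ⊆ I) (hJ : J' ⊆ J)
    (oI : IsOpen I') (oJ : IsOpen J') (cI : I'.OrdConnected) (cJ : J'.OrdConnected) :
    IsParameter I' J' T X U₀ C where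
  isOpen_left := oI
  isOpen_right := oJ
  interval_left := cI
  interval_right := cJ
  smooth_T := h.smooth_T.mono hI
  smooth_X := h.smooth_X.mono hJ
  smooth_U := h.smooth_U.mono (prod_mono hI hJ)
  deriv_T t ht := h.deriv_T t (hI ht)
  deriv_X x hx := h.deriv_X x (hJ hx)
  const_ne := h.const_ne

theorem swap (h : IsParameter I J T X U₀ C) :
    IsParameter J I X T (fun p => U₀ (p.2, p.1)) C where
  isOpen_left := h.isOpen_right
  isOpen_right := h.isOpen_left
  interval_left := h.interval_right
  interval_right := h.interval_left
  smooth_T := h.smooth_X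
  smooth_X := h.smooth_T
  smooth_U := h.smooth_U.comp (by fun_prop) fun p hp => ⟨hp.2, hp.1⟩
  deriv_T := h.deriv_X
  deriv_X := h.deriv_T
  const_ne := h.const_ne

theorem contDiffAt_formBase (h : IsParameter I J T X U₀ C) {z : Base} (ht : z.1 ∈ I)
    (hx : z.2.1 ∈ J) : ContDiffAt ℝ ∞ (formBase T X U₀ C) z := by
  refine ContDiffAt.prodMk ?_ (ContDiffAt.prodMk ?_ (ContDiffAt.add ?_ ?_))
  · exact (h.contDiffAt_T ht).comp z contDiffAt_fst
  · exact (h.contDiffAt_X hx).comp (f := fun z : Base => z.2.1) z (by fun_prop)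
  · fun_prop
  · exact (h.contDiffAt_U ht hx).comp (f := fun z : Base => (z.1, z.2.1)) z (by fun_prop)

end IsParameter

/-- Near `z`, the map `φ` is of the form `t̃ = T(t)`, `x̃ = X(x)`, `ũ = C u + U₀(t,x)`. -/
def NearForm (φ : Base → Base) (z : Base) : Prop :=
  ∃ (I J : Set ℝ) (T X : ℝ → ℝ) (U₀ : ℝ × ℝ → ℝ) (C : ℝ), IsParameter I J T X U₀ C ∧
    z.1 ∈ I ∧ z.2.1 ∈ J ∧ φ =ᶠ[𝓝 z] formBase T X U₀ C

/-- Near `z`, the map `φ` is of the form of `NearForm` up to the permutation of `t` and `x`. -/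
def BaseForm (φ : Base → Base) (z : Base) : Prop :=
  NearForm φ z ∨ NearForm (swapBase ∘ φ) z

/-! ### Mixed derivatives -/

theorem hasDerivAt_comp_fst {V : ℝ × ℝ → ℝ} {t x : ℝ} (h : DifferentiableAt ℝ V (t, x)) :
    HasDerivAt (fun s => V (s, x)) (fderiv ℝ V (t, x) (1, 0)) t :=
  h.hasFDerivAt.comp_hasDerivAt (f := fun s : ℝ => (s, x)) t
    ((hasDerivAt_id t).prodMk (hasDerivAt_const t x))

theorem hasDerivAt_comp_snd {V : ℝ × ℝ → ℝ} {t x : ℝ} (h : DifferentiableAt ℝ V (t, x)) :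
    HasDerivAt (fun s => V (t, s)) (fderiv ℝ V (t, x) (0, 1)) x :=
  h.hasFDerivAt.comp_hasDerivAt (f := fun s : ℝ => (t, s)) x
    ((hasDerivAt_const x t).prodMk (hasDerivAt_id x))

/-- The mixed derivative at a point in whose neighbourhood the function is smooth, in terms of
Fréchet derivatives. -/
theorem mixed_eq_fderiv {V : ℝ × ℝ → ℝ} {t x : ℝ} (h : ∀ᶠ p in 𝓝 (t, x), ContDiffAt ℝ ∞ V p) :
    mixed V t x = fderiv ℝ (fun p => fderiv ℝ V p (1, 0)) (t, x) (0, 1) := by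
  have h1 : (fun x' => deriv (fun t' => V (t', x')) t) =ᶠ[𝓝 x]
      fun x' => fderiv ℝ V (t, x') (1, 0) := by
    have : Tendsto (fun x' : ℝ => (t, x')) (𝓝 x) (𝓝 (t, x)) :=
      (Continuous.prodMk_right t).tendsto x
    filter_upwards [this.eventually h] with x' hx'
    exact (hasDerivAt_comp_fst (hx'.differentiableAt (by simp))).deriv
  unfold mixed
  rw [h1.deriv_eq]
  exact (hasDerivAt_comp_snd
    ((h.self_of_nhds.fderiv_apply_const (1, 0)).differentiableAt (by simp))).deriv

theorem mixed_swap {V : ℝ × ℝ → ℝ} {t x : ℝ} (h : ∀ᶠ p in 𝓝 (t, x), ContDiffAt ℝ ∞ V p) :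
    mixed (fun p => V (p.2, p.1)) x t = mixed V t x := by
  rw [mixed_eq_fderiv h, fderiv_fderiv_apply_comm h.self_of_nhds]
  have h1 : (fun t' => deriv (fun x' => V (t', x')) x) =ᶠ[𝓝 t]
      fun t' => fderiv ℝ V (t', x) (0, 1) := by
    have : Tendsto (fun t' : ℝ => (t', x)) (𝓝 t) (𝓝 (t, x)) :=
      (Continuous.prodMk_left x).tendsto t
    filter_upwards [this.eventually h] with t' ht'
    exact (hasDerivAt_comp_snd (ht'.differentiableAt (by simp))).deriv
  unfold mixed
  rw [h1.deriv_eq]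
  exact (hasDerivAt_comp_fst
    ((h.self_of_nhds.fderiv_apply_const (0, 1)).differentiableAt (by simp))).deriv

namespace IsParameter

variable {I J : Set ℝ} {T X : ℝ → ℝ} {U₀ : ℝ × ℝ → ℝ} {C t x : ℝ}

theorem eventually_contDiffAt_U (h : IsParameter I J T X U₀ C) (ht : t ∈ I) (hx : x ∈ J) :
    ∀ᶠ p in 𝓝 (t, x), ContDiffAt ℝ ∞ U₀ p := by
  filter_upwards [(h.isOpen_left.prod h.isOpen_right).mem_nhds ⟨ht, hx⟩] with p hp
  exact h.contDiffAt_U hp.1 hp.2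

/-- The chain rule for the mixed derivative of the function `U₀` of a composition. -/
theorem mixed_comp (h : IsParameter I J T X U₀ C) (ht : t ∈ I) (hx : x ∈ J)
    {I' J' : Set ℝ} {T' X' : ℝ → ℝ} {U' : ℝ × ℝ → ℝ} {C' : ℝ} (h' : IsParameter I' J' T' X' U' C')
    (ht' : T t ∈ I') (hx' : X x ∈ J') :
    mixed (fun p => C' * U₀ p + U' (T p.1, X p.2)) t x =
      C' * mixed U₀ t x + mixed U' (T t) (X x) * (deriv T t * deriv X x) := by
  have dT : HasDerivAt T (deriv T t) t :=
    ((h.contDiffAt_T ht).differentiableAt (by simp)).hasDerivAt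
  have dX : HasDerivAt X (deriv X x) x :=
    ((h.contDiffAt_X hx).differentiableAt (by simp)).hasDerivAt
  have h1 : (fun y => deriv (fun s => C' * U₀ (s, y) + U' (T s, X y)) t) =ᶠ[𝓝 x]
      fun y => C' * fderiv ℝ U₀ (t, y) (1, 0) + fderiv ℝ U' (T t, X y) (1, 0) * deriv T t := by
    filter_upwards [h.isOpen_right.mem_nhds hx, dX.continuousAt.preimage_mem_nhds
      (h'.isOpen_right.mem_nhds hx')] with y hy hy'
    have e1 := hasDerivAt_comp_fst ((h.contDiffAt_U ht hy).differentiableAt (by simp))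
    have e2 := hasDerivAt_comp_fst ((h'.contDiffAt_U ht' hy').differentiableAt (by simp))
    exact ((e1.const_mul C').add (e2.comp t dT)).deriv
  have e1 := hasDerivAt_comp_snd
    (((h.contDiffAt_U ht hx).fderiv_apply_const (1, 0)).differentiableAt (by simp))
  have e2 := hasDerivAt_comp_snd
    (((h'.contDiffAt_U ht' hx').fderiv_apply_const (1, 0)).differentiableAt (by simp))
  rw [mixed_eq_fderiv (h.eventually_contDiffAt_U ht hx),
    mixed_eq_fderiv (h'.eventually_contDiffAt_U ht' hx')]
  unfold mixed
  rw [h1.deriv_eq]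
  refine ((e1.const_mul C').add ((e2.comp x dX).mul_const (deriv T t))).deriv.trans ?_
  ring

/-- The parameters of a composition. -/
theorem comp (h : IsParameter I J T X U₀ C) (ht : t ∈ I) (hx : x ∈ J)
    {I' J' : Set ℝ} {T' X' : ℝ → ℝ} {U' : ℝ × ℝ → ℝ} {C' : ℝ} (h' : IsParameter I' J' T' X' U' C')
    (ht' : T t ∈ I') (hx' : X x ∈ J') :
    ∃ I'' J'', IsParameter I'' J'' (T' ∘ T) (X' ∘ X) (fun p => C' * U₀ p + U' (T p.1, X p.2))
      (C' * C) ∧ t ∈ I'' ∧ x ∈ J'' := by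
  have key : ∀ {I I' : Set ℝ} {T : ℝ → ℝ} {t : ℝ}, IsOpen I → IsOpen I' → ContDiffOn ℝ ∞ T I →
      t ∈ I → T t ∈ I' → ∃ I'' ⊆ I, IsOpen I'' ∧ I''.OrdConnected ∧ MapsTo T I'' I' ∧ t ∈ I'' := by
    intro I I' T t hI hI' hT ht ht'
    have : I ∩ T ⁻¹' I' ∈ 𝓝 t := inter_mem (hI.mem_nhds ht)
      ((hT.continuousOn.continuousAt (hI.mem_nhds ht)).preimage_mem_nhds (hI'.mem_nhds ht'))
    obtain ⟨ε, hε, hb⟩ := Metric.mem_nhds_iff.1 this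
    refine ⟨Metric.ball t ε, fun s hs => (hb hs).1, Metric.isOpen_ball, ?_,
      fun s hs => (hb hs).2, Metric.mem_ball_self hε⟩
    rw [Real.ball_eq_Ioo]; exact ordConnected_Ioo
  obtain ⟨I₁, sI, oI, cI, mI, tI⟩ := key h.isOpen_left h'.isOpen_left h.smooth_T ht ht'
  obtain ⟨J₁, sJ, oJ, cJ, mJ, xJ⟩ := key h.isOpen_right h'.isOpen_right h.smooth_X hx hx'
  have h₁ := h.mono sI sJ oI oJ cI cJ
  refine ⟨I₁, J₁, ⟨oI, oJ, cI, cJ, h'.smooth_T.comp h₁.smooth_T mI,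
    h'.smooth_X.comp h₁.smooth_X mJ, ?_, ?_, ?_, mul_ne_zero h'.const_ne h.const_ne⟩, tI, xJ⟩
  · refine (contDiffOn_const.mul h₁.smooth_U).add (h'.smooth_U.comp ?_ ?_)
    · exact (h₁.smooth_T.comp contDiffOn_fst fun p hp => hp.1).prodMk
        (h₁.smooth_X.comp contDiffOn_snd fun p hp => hp.2)
    · exact fun p hp => ⟨mI hp.1, mJ hp.2⟩
  · intro s hs
    rw [deriv_comp s ((h'.contDiffAt_T (mI hs)).differentiableAt (by simp))
      ((h₁.contDiffAt_T hs).differentiableAt (by simp))]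
    exact mul_ne_zero (h'.deriv_T _ (mI hs)) (h₁.deriv_T s hs)
  · intro s hs
    rw [deriv_comp s ((h'.contDiffAt_X (mJ hs)).differentiableAt (by simp))
      ((h₁.contDiffAt_X hs).differentiableAt (by simp))]
    exact mul_ne_zero (h'.deriv_X _ (mJ hs)) (h₁.deriv_X s hs)

end IsParameter

/-! ### Derivatives of transformations of the displayed form -/

theorem fderiv_base_apply (L : Base →L[ℝ] ℝ) (v : Base) :
    L v = v.1 * L (1, 0, 0) + v.2.1 * L (0, 1, 0) + v.2.2 * L (0, 0, 1) := by
  rw [← smul_eq_mul, ← smul_eq_mul, ← smul_eq_mul, ← map_smul, ← map_smul, ← map_smul,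
    ← map_add, ← map_add]
  simp

theorem fderiv_comp_t {T : ℝ → ℝ} {z : Base} (hT : DifferentiableAt ℝ T z.1) (v : Base) :
    fderiv ℝ (fun y : Base => T y.1) z v = v.1 * deriv T z.1 := by
  have := hT.hasDerivAt.comp_hasFDerivAt z (hasFDerivAt_fst (p := z) (𝕜 := ℝ))
  rw [show (fun y : Base => T y.1) = T ∘ Prod.fst from rfl, this.fderiv]
  simp [mul_comm]

theorem fderiv_comp_x {X : ℝ → ℝ} {z : Base} (hX : DifferentiableAt ℝ X z.2.1) (v : Base) :
    fderiv ℝ (fun y : Base => X y.2.1) z v = v.2.1 * deriv X z.2.1 := by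
  have := hX.hasDerivAt.comp_hasFDerivAt z
    ((hasFDerivAt_fst (p := z.2) (𝕜 := ℝ)).comp z (hasFDerivAt_snd (p := z) (𝕜 := ℝ)))
  rw [show (fun y : Base => X y.2.1) = X ∘ (Prod.fst ∘ Prod.snd) from rfl, this.fderiv]
  simp [mul_comm]

/-- The differential conditions that characterize `NearForm` for smooth maps. -/
structure FormDeriv (φ : Base → Base) (z : Base) : Prop where
  T_x : fderiv ℝ (fun y => (φ y).1) z (0, 1, 0) = 0
  T_u : fderiv ℝ (fun y => (φ y).1) z (0, 0, 1) = 0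
  T_t : fderiv ℝ (fun y => (φ y).1) z (1, 0, 0) ≠ 0
  X_t : fderiv ℝ (fun y => (φ y).2.1) z (1, 0, 0) = 0
  X_u : fderiv ℝ (fun y => (φ y).2.1) z (0, 0, 1) = 0
  X_x : fderiv ℝ (fun y => (φ y).2.1) z (0, 1, 0) ≠ 0
  U_u : fderiv ℝ (fun y => (φ y).2.2) z (0, 0, 1) ≠ 0
  U_uv : ∀ v, fderiv ℝ (fun y => fderiv ℝ (fun y => (φ y).2.2) y (0, 0, 1)) z v = 0

namespace IsParameter

variable {I J : Set ℝ} {T X : ℝ → ℝ} {U₀ : ℝ × ℝ → ℝ} {C : ℝ} {z : Base}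

theorem fderiv_T (h : IsParameter I J T X U₀ C) (ht : z.1 ∈ I) (v : Base) :
    fderiv ℝ (fun y : Base => T y.1) z v = v.1 * deriv T z.1 :=
  fderiv_comp_t ((h.contDiffAt_T ht).differentiableAt (by simp)) v

theorem fderiv_X (h : IsParameter I J T X U₀ C) (hx : z.2.1 ∈ J) (v : Base) :
    fderiv ℝ (fun y : Base => X y.2.1) z v = v.2.1 * deriv X z.2.1 :=
  fderiv_comp_x ((h.contDiffAt_X hx).differentiableAt (by simp)) v

theorem fderiv_U (h : IsParameter I J T X U₀ C) (ht : z.1 ∈ I) (hx : z.2.1 ∈ J) (v : Base) :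
    fderiv ℝ (fun y : Base => C * y.2.2 + U₀ (y.1, y.2.1)) z v =
      C * v.2.2 + fderiv ℝ U₀ (z.1, z.2.1) (v.1, v.2.1) := by
  have h1 := ((h.contDiffAt_U ht hx).differentiableAt (by simp)).hasFDerivAt
  have h2 : HasFDerivAt (fun y : Base => (y.1, y.2.1))
      ((ContinuousLinearMap.fst ℝ ℝ (ℝ × ℝ)).prod
        ((ContinuousLinearMap.fst ℝ ℝ ℝ).comp (ContinuousLinearMap.snd ℝ ℝ (ℝ × ℝ)))) z :=
    ((ContinuousLinearMap.fst ℝ ℝ (ℝ × ℝ)).prod ((ContinuousLinearMap.fst ℝ ℝ ℝ).comp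
      (ContinuousLinearMap.snd ℝ ℝ (ℝ × ℝ)))).hasFDerivAt
  have h3 : HasFDerivAt (fun y : Base => y.2.2)
      ((ContinuousLinearMap.snd ℝ ℝ ℝ).comp (ContinuousLinearMap.snd ℝ ℝ (ℝ × ℝ))) z :=
    ((ContinuousLinearMap.snd ℝ ℝ ℝ).comp (ContinuousLinearMap.snd ℝ ℝ (ℝ × ℝ))).hasFDerivAt
  have := (h3.const_mul C).add (HasFDerivAt.comp z h1 h2)
  rw [HasFDerivAt.fderiv (f := fun y : Base => C * y.2.2 + U₀ (y.1, y.2.1)) this]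
  simp

theorem formDeriv (h : IsParameter I J T X U₀ C) (ht : z.1 ∈ I) (hx : z.2.1 ∈ J) :
    FormDeriv (formBase T X U₀ C) z where
  T_x := (h.fderiv_T ht _).trans (by simp)
  T_u := (h.fderiv_T ht _).trans (by simp)
  T_t := (h.fderiv_T ht _).trans_ne (by simpa using h.deriv_T _ ht)
  X_t := (h.fderiv_X hx _).trans (by simp)
  X_u := (h.fderiv_X hx _).trans (by simp)
  X_x := (h.fderiv_X hx _).trans_ne (by simpa using h.deriv_X _ hx)
  U_u := (h.fderiv_U ht hx _).trans_ne (by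
    simpa [show ((0, 0) : ℝ × ℝ) = 0 from rfl] using h.const_ne)
  U_uv v := by
    have : (fun y => fderiv ℝ (fun y => (formBase T X U₀ C y).2.2) y (0, 0, 1)) =ᶠ[𝓝 z]
        fun _ => C := by
      have hm : {y : Base | y.1 ∈ I ∧ y.2.1 ∈ J} ∈ 𝓝 z :=
        ((h.isOpen_left.preimage continuous_fst).inter
          (h.isOpen_right.preimage (by fun_prop : Continuous fun y : Base => y.2.1))).mem_nhds
          ⟨ht, hx⟩
      filter_upwards [hm] with y hy
      exact (h.fderiv_U hy.1 hy.2 _).trans (by simp [show ((0, 0) : ℝ × ℝ) = 0 from rfl])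
    rw [this.fderiv_eq]
    simp

end IsParameter

theorem FormDeriv.congr {φ ψ : Base → Base} {z : Base} (h : FormDeriv ψ z) (e : φ =ᶠ[𝓝 z] ψ) :
    FormDeriv φ z := by
  have e1 : (fun y => (φ y).1) =ᶠ[𝓝 z] fun y => (ψ y).1 := e.fun_comp Prod.fst
  have e2 : (fun y => (φ y).2.1) =ᶠ[𝓝 z] fun y => (ψ y).2.1 := e.fun_comp fun y => y.2.1
  have e3 : (fun y => (φ y).2.2) =ᶠ[𝓝 z] fun y => (ψ y).2.2 := e.fun_comp fun y => y.2.2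
  have e4 : (fun y => fderiv ℝ (fun y => (φ y).2.2) y (0, 0, 1)) =ᶠ[𝓝 z]
      fun y => fderiv ℝ (fun y => (ψ y).2.2) y (0, 0, 1) :=
    e3.fderiv.fun_comp fun L => L (0, 0, 1)
  constructor
  · rw [e1.fderiv_eq]; exact h.T_x
  · rw [e1.fderiv_eq]; exact h.T_u
  · rw [e1.fderiv_eq]; exact h.T_t
  · rw [e2.fderiv_eq]; exact h.X_t
  · rw [e2.fderiv_eq]; exact h.X_u
  · rw [e2.fderiv_eq]; exact h.X_x
  · rw [e3.fderiv_eq]; exact h.U_u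
  · rw [e4.fderiv_eq]; exact h.U_uv

theorem NearForm.formDeriv {φ : Base → Base} {z : Base} (h : NearForm φ z) : FormDeriv φ z := by
  obtain ⟨I, J, T, X, U₀, C, hp, ht, hx, e⟩ := h
  exact (hp.formDeriv ht hx).congr e

theorem NearForm.contDiffAt {φ : Base → Base} {z : Base} (h : NearForm φ z) :
    ContDiffAt ℝ ∞ φ z := by
  obtain ⟨I, J, T, X, U₀, C, hp, ht, hx, e⟩ := h
  exact (hp.contDiffAt_formBase ht hx).congr_of_eventuallyEq e

/-- A smooth function on a box that depends on `t` only, as a function of one variable. -/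
theorem exists_eq_comp_t {g : Base → ℝ} {I J K : Set ℝ} (cI : I.OrdConnected) (cJ : J.OrdConnected)
    (cK : K.OrdConnected) (hg : ∀ z ∈ I ×ˢ J ×ˢ K, ContDiffAt ℝ ∞ g z)
    (hx : ∀ z ∈ I ×ˢ J ×ˢ K, fderiv ℝ g z (0, 1, 0) = 0)
    (hu : ∀ z ∈ I ×ˢ J ×ˢ K, fderiv ℝ g z (0, 0, 1) = 0) {z₀ : Base} (hz₀ : z₀ ∈ I ×ˢ J ×ˢ K) :
    ∃ T : ℝ → ℝ, (∀ t ∈ I, ContDiffAt ℝ ∞ T t) ∧ (∀ z ∈ I ×ˢ J ×ˢ K, g z = T z.1) ∧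
      ∀ t ∈ I, deriv T t = fderiv ℝ g (t, z₀.2) (1, 0, 0) := by
  have hconv : Convex ℝ (I ×ˢ J ×ˢ K) := cI.convex.prod (cJ.convex.prod cK.convex)
  refine ⟨fun t => g (t, z₀.2), fun t ht => ?_, fun z hz => ?_, fun t ht => ?_⟩
  · exact (hg (t, z₀.2) ⟨ht, hz₀.2⟩).comp (f := fun t => (t, z₀.2)) t (by fun_prop)
  · refine eq_of_fderiv_apply_sub_eq_zero (F := g) hconv
      (fun y hy => (hg y hy).differentiableAt (by simp)) hz ⟨hz.1, hz₀.2⟩ fun y hy => ?_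
    rw [fderiv_base_apply, hx y hy, hu y hy]; simp
  · exact (((hg (t, z₀.2) ⟨ht, hz₀.2⟩).differentiableAt
      (by simp)).hasFDerivAt.comp_hasDerivAt (f := fun t => (t, z₀.2)) t
      ((hasDerivAt_id t).prodMk (hasDerivAt_const t z₀.2))).deriv

/-- A smooth function on a box that depends on `x` only, as a function of one variable. -/
theorem exists_eq_comp_x {g : Base → ℝ} {I J K : Set ℝ} (cI : I.OrdConnected) (cJ : J.OrdConnected)
    (cK : K.OrdConnected) (hg : ∀ z ∈ I ×ˢ J ×ˢ K, ContDiffAt ℝ ∞ g z)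
    (ht : ∀ z ∈ I ×ˢ J ×ˢ K, fderiv ℝ g z (1, 0, 0) = 0)
    (hu : ∀ z ∈ I ×ˢ J ×ˢ K, fderiv ℝ g z (0, 0, 1) = 0) {z₀ : Base} (hz₀ : z₀ ∈ I ×ˢ J ×ˢ K) :
    ∃ X : ℝ → ℝ, (∀ x ∈ J, ContDiffAt ℝ ∞ X x) ∧ (∀ z ∈ I ×ˢ J ×ˢ K, g z = X z.2.1) ∧
      ∀ x ∈ J, deriv X x = fderiv ℝ g (z₀.1, x, z₀.2.2) (0, 1, 0) := by
  have hconv : Convex ℝ (I ×ˢ J ×ˢ K) := cI.convex.prod (cJ.convex.prod cK.convex)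
  refine ⟨fun x => g (z₀.1, x, z₀.2.2), fun x hx => ?_, fun z hz => ?_, fun x hx => ?_⟩
  · exact (hg (z₀.1, x, z₀.2.2) ⟨hz₀.1, hx, hz₀.2.2⟩).comp
      (f := fun x => (z₀.1, x, z₀.2.2)) x (by fun_prop)
  · refine eq_of_fderiv_apply_sub_eq_zero (F := g) hconv
      (fun y hy => (hg y hy).differentiableAt (by simp)) hz ⟨hz₀.1, hz.2.1, hz₀.2.2⟩
      fun y hy => ?_
    rw [fderiv_base_apply, ht y hy, hu y hy]; simp
  · exact (((hg (z₀.1, x, z₀.2.2) ⟨hz₀.1, hx, hz₀.2.2⟩).differentiableAt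
      (by simp)).hasFDerivAt.comp_hasDerivAt (f := fun x => (z₀.1, x, z₀.2.2)) x
      ((hasDerivAt_const x z₀.1).prodMk ((hasDerivAt_id x).prodMk
        (hasDerivAt_const x z₀.2.2)))).deriv

section Components

variable {φ : Base → Base} {z : Base}

theorem _root_.ContDiffAt.comp_T (h : ContDiffAt ℝ ∞ φ z) : ContDiffAt ℝ ∞ (fun y => (φ y).1) z :=
  contDiffAt_fst.comp z h

theorem _root_.ContDiffAt.comp_X (h : ContDiffAt ℝ ∞ φ z) :
    ContDiffAt ℝ ∞ (fun y => (φ y).2.1) z :=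
  contDiffAt_fst.comp z (contDiffAt_snd.comp z h)

theorem _root_.ContDiffAt.comp_U (h : ContDiffAt ℝ ∞ φ z) :
    ContDiffAt ℝ ∞ (fun y => (φ y).2.2) z :=
  contDiffAt_snd.comp z (contDiffAt_snd.comp z h)

end Components

/-- A smooth map of a box subject to the conditions of `FormDeriv` is of the displayed form on the
whole box. -/
theorem exists_parameters {φ : Base → Base} {I J K : Set ℝ} (oI : IsOpen I) (oJ : IsOpen J)
    (cI : I.OrdConnected) (cJ : J.OrdConnected) (cK : K.OrdConnected)
    (hφ : ∀ z ∈ I ×ˢ J ×ˢ K, ContDiffAt ℝ ∞ φ z) (h : ∀ z ∈ I ×ˢ J ×ˢ K, FormDeriv φ z)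
    {z₀ : Base} (hz₀ : z₀ ∈ I ×ˢ J ×ˢ K) :
    ∃ (T X : ℝ → ℝ) (U₀ : ℝ × ℝ → ℝ) (C : ℝ), IsParameter I J T X U₀ C ∧
      EqOn φ (formBase T X U₀ C) (I ×ˢ J ×ˢ K) := by
  have hconv : Convex ℝ (I ×ˢ J ×ˢ K) := cI.convex.prod (cJ.convex.prod cK.convex)
  obtain ⟨T, sT, eT, dT⟩ := exists_eq_comp_t cI cJ cK (fun z hz => (hφ z hz).comp_T)
    (fun z hz => (h z hz).T_x) (fun z hz => (h z hz).T_u) hz₀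
  obtain ⟨X, sX, eX, dX⟩ := exists_eq_comp_x cI cJ cK (fun z hz => (hφ z hz).comp_X)
    (fun z hz => (h z hz).X_t) (fun z hz => (h z hz).X_u) hz₀
  have dU := fun z hz => (hφ z hz).comp_U
  obtain ⟨t₀, x₀, u₀⟩ := z₀
  obtain ⟨ht₀, hx₀, hu₀⟩ := hz₀
  set C := fderiv ℝ (fun y => (φ y).2.2) (t₀, x₀, u₀) (0, 0, 1) with hC
  have eC : ∀ z ∈ I ×ˢ J ×ˢ K, fderiv ℝ (fun y => (φ y).2.2) z (0, 0, 1) = C := by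
    intro z hz
    exact eq_of_fderiv_apply_sub_eq_zero
      (F := fun y => fderiv ℝ (fun y => (φ y).2.2) y (0, 0, 1)) hconv
      (fun y hy => ((dU y hy).fderiv_apply_const _).differentiableAt (by simp)) hz
      ⟨ht₀, hx₀, hu₀⟩ fun y hy => (h y hy).U_uv _
  have eU : ∀ z ∈ I ×ˢ J ×ˢ K,
      (φ z).2.2 - C * z.2.2 = (φ (z.1, z.2.1, u₀)).2.2 - C * u₀ := by
    intro z hz
    have hd : ∀ y ∈ I ×ˢ J ×ˢ K, HasFDerivAt (fun y => (φ y).2.2 - C * y.2.2)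
        (fderiv ℝ (fun y => (φ y).2.2) y -
          C • (ContinuousLinearMap.snd ℝ ℝ ℝ).comp (ContinuousLinearMap.snd ℝ ℝ (ℝ × ℝ))) y :=
      fun y hy => ((dU y hy).differentiableAt (by simp)).hasFDerivAt.sub
        ((((ContinuousLinearMap.snd ℝ ℝ ℝ).comp
          (ContinuousLinearMap.snd ℝ ℝ (ℝ × ℝ))).hasFDerivAt).const_mul C)
    refine eq_of_fderiv_apply_sub_eq_zero (F := fun y => (φ y).2.2 - C * y.2.2) hconv
      (fun y hy => (hd y hy).differentiableAt) (b := (z.1, z.2.1, u₀)) hz ⟨hz.1, hz.2.1, hu₀⟩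
      fun y hy => ?_
    rw [(hd y hy).fderiv, sub_apply, fderiv_base_apply, eC y hy]
    simp [mul_comm]
  refine ⟨T, X, fun p => (φ (p.1, p.2, u₀)).2.2 - C * u₀, C, ?_, ?_⟩
  · refine ⟨oI, oJ, cI, cJ, fun t ht => (sT t ht).contDiffWithinAt,
      fun x hx => (sX x hx).contDiffWithinAt, fun p hp => ?_, fun t ht => ?_, fun x hx => ?_,
      (h (t₀, x₀, u₀) ⟨ht₀, hx₀, hu₀⟩).U_u⟩
    · exact (((dU (p.1, p.2, u₀) ⟨hp.1, hp.2, hu₀⟩).comp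
        (f := fun p : ℝ × ℝ => (p.1, p.2, u₀)) p (by fun_prop)).sub
        contDiffAt_const).contDiffWithinAt
    · rw [dT t ht]
      exact (h (t, x₀, u₀) ⟨ht, hx₀, hu₀⟩).T_t
    · rw [dX x hx]
      exact (h (t₀, x, u₀) ⟨ht₀, hx, hu₀⟩).X_x
  · intro z hz
    refine Prod.ext (eT z hz) (Prod.ext (eX z hz) ?_)
    show (φ z).2.2 = C * z.2.2 + ((φ (z.1, z.2.1, u₀)).2.2 - C * u₀)
    rw [← eU z hz]; ring

/-! ### The induced transformation of the arbitrary element -/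

/-- The derivative `U_u` of the `u`-component of `φ`. -/
noncomputable def derivU (φ : Base → Base) (z : Base) : ℝ := fderiv ℝ (fun y => (φ y).2.2) z (0, 0, 1)

/-- The mixed derivative `U_tx` of the `u`-component of `φ`. -/
noncomputable def derivTX (φ : Base → Base) (z : Base) : ℝ :=
  fderiv ℝ (fun y => fderiv ℝ (fun y => (φ y).2.2) y (1, 0, 0)) z (0, 1, 0)

/-- The factor `T_t X_x + T_x X_t`. One of the summands vanishes for a map of the form considered,
depending on whether `t` and `x` are permuted. -/
noncomputable def factorTX (φ : Base → Base) (z : Base) : ℝ :=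
  fderiv ℝ (fun y => (φ y).1) z (1, 0, 0) * fderiv ℝ (fun y => (φ y).2.1) z (0, 1, 0) +
    fderiv ℝ (fun y => (φ y).1) z (0, 1, 0) * fderiv ℝ (fun y => (φ y).2.1) z (1, 0, 0)

/-- The extension of a map `φ` of the base to the arbitrary element,
`f̃ = (U_u f + U_tx) / (T_t X_x + T_x X_t)`. In contrast to `formMap`, it is given in terms of `φ`
rather than of parameters, which are only determined locally. -/
noncomputable def liftMap (φ : Base → Base) (w : BaseF) : BaseF :=
  (φ w.1, (derivU φ w.1 * w.2 + derivTX φ w.1) / factorTX φ w.1)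

theorem liftMap_congr {φ ψ : Base → Base} {z : Base} (e : φ =ᶠ[𝓝 z] ψ) (y : ℝ) :
    liftMap φ (z, y) = liftMap ψ (z, y) := by
  have e1 : (fun y => (φ y).1) =ᶠ[𝓝 z] fun y => (ψ y).1 := e.fun_comp Prod.fst
  have e2 : (fun y => (φ y).2.1) =ᶠ[𝓝 z] fun y => (ψ y).2.1 := e.fun_comp fun y => y.2.1
  have e3 : (fun y => (φ y).2.2) =ᶠ[𝓝 z] fun y => (ψ y).2.2 := e.fun_comp fun y => y.2.2
  have e4 : (fun y => fderiv ℝ (fun y => (φ y).2.2) y (1, 0, 0)) =ᶠ[𝓝 z]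
      fun y => fderiv ℝ (fun y => (ψ y).2.2) y (1, 0, 0) :=
    e3.fderiv.fun_comp fun L => L (1, 0, 0)
  simp only [liftMap, derivU, derivTX, factorTX, e1.fderiv_eq, e2.fderiv_eq, e3.fderiv_eq,
    e4.fderiv_eq, e.self_of_nhds]

theorem liftMap_swapBase_comp (φ : Base → Base) (w : BaseF) :
    liftMap (swapBase ∘ φ) w = swapMap (liftMap φ w) := by
  refine Prod.ext rfl ?_
  show (derivU (swapBase ∘ φ) w.1 * w.2 + derivTX (swapBase ∘ φ) w.1) /
    factorTX (swapBase ∘ φ) w.1 = (derivU φ w.1 * w.2 + derivTX φ w.1) / factorTX φ w.1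
  have : factorTX (swapBase ∘ φ) w.1 = factorTX φ w.1 := by
    show fderiv ℝ (fun y => (φ y).2.1) w.1 (1, 0, 0) * fderiv ℝ (fun y => (φ y).1) w.1 (0, 1, 0) +
      fderiv ℝ (fun y => (φ y).2.1) w.1 (0, 1, 0) * fderiv ℝ (fun y => (φ y).1) w.1 (1, 0, 0) = _
    unfold factorTX; ring
  rw [this]
  rfl

theorem IsParameter.mem_nhds {I J : Set ℝ} {T X : ℝ → ℝ} {U₀ : ℝ × ℝ → ℝ} {C : ℝ} {z : Base}
    (h : IsParameter I J T X U₀ C) (ht : z.1 ∈ I) (hx : z.2.1 ∈ J) :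
    {y : Base | y.1 ∈ I ∧ y.2.1 ∈ J} ∈ 𝓝 z :=
  ((h.isOpen_left.preimage continuous_fst).inter
    (h.isOpen_right.preimage (by fun_prop : Continuous fun y : Base => y.2.1))).mem_nhds ⟨ht, hx⟩

theorem IsParameter.factorTX_formBase {I J : Set ℝ} {T X : ℝ → ℝ} {U₀ : ℝ × ℝ → ℝ} {C : ℝ}
    {z : Base} (h : IsParameter I J T X U₀ C) (ht : z.1 ∈ I) (hx : z.2.1 ∈ J) :
    factorTX (formBase T X U₀ C) z = deriv T z.1 * deriv X z.2.1 := by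
  show fderiv ℝ (fun y : Base => T y.1) z (1, 0, 0) * fderiv ℝ (fun y : Base => X y.2.1) z (0, 1, 0)
    + fderiv ℝ (fun y : Base => T y.1) z (0, 1, 0) * fderiv ℝ (fun y : Base => X y.2.1) z (1, 0, 0)
    = _
  rw [h.fderiv_T ht, h.fderiv_T ht, h.fderiv_X hx, h.fderiv_X hx]
  simp

theorem IsParameter.liftMap_formBase {I J : Set ℝ} {T X : ℝ → ℝ} {U₀ : ℝ × ℝ → ℝ} {C : ℝ} {z : Base}
    (h : IsParameter I J T X U₀ C) (ht : z.1 ∈ I) (hx : z.2.1 ∈ J) (y : ℝ) :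
    liftMap (formBase T X U₀ C) (z, y) = formMap T X U₀ C (z, y) := by
  have h1 : derivU (formBase T X U₀ C) z = C :=
    (h.fderiv_U ht hx _).trans (by simp [show ((0, 0) : ℝ × ℝ) = 0 from rfl])
  have h3 : derivTX (formBase T X U₀ C) z = mixed U₀ z.1 z.2.1 := by
    rw [mixed_eq_fderiv (h.eventually_contDiffAt_U ht hx)]
    have e : (fun y => fderiv ℝ (fun y => (formBase T X U₀ C y).2.2) y (1, 0, 0)) =ᶠ[𝓝 z]
        fun y => fderiv ℝ U₀ (y.1, y.2.1) (1, 0) := by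
      filter_upwards [h.mem_nhds ht hx] with y hy
      exact (h.fderiv_U hy.1 hy.2 _).trans (by simp)
    have h4 := (((h.contDiffAt_U ht hx).fderiv_apply_const (1, 0)).differentiableAt
      (by simp)).hasFDerivAt
    have h5 : HasFDerivAt (fun y : Base => (y.1, y.2.1))
        ((ContinuousLinearMap.fst ℝ ℝ (ℝ × ℝ)).prod
          ((ContinuousLinearMap.fst ℝ ℝ ℝ).comp (ContinuousLinearMap.snd ℝ ℝ (ℝ × ℝ)))) z :=
      ((ContinuousLinearMap.fst ℝ ℝ (ℝ × ℝ)).prod ((ContinuousLinearMap.fst ℝ ℝ ℝ).comp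
        (ContinuousLinearMap.snd ℝ ℝ (ℝ × ℝ)))).hasFDerivAt
    unfold derivTX
    have h6 := HasFDerivAt.comp (f := fun y : Base => (y.1, y.2.1)) z h4 h5
    rw [e.fderiv_eq, HasFDerivAt.fderiv (f := fun y : Base => fderiv ℝ U₀ (y.1, y.2.1) (1, 0)) h6]
    simp
  simp only [liftMap, h1, h.factorTX_formBase ht hx, h3]
  rfl

/-! ### Composition and inversion -/

/-- `NearForm` is closed under composition, and `liftMap` is functorial. -/
theorem NearForm.comp {φ ψ : Base → Base} {z : Base} (hφ : NearForm φ z) (hψ : NearForm ψ (φ z)) :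
    NearForm (ψ ∘ φ) z ∧ ∀ y, liftMap (ψ ∘ φ) (z, y) = liftMap ψ (liftMap φ (z, y)) := by
  have hcont := hφ.contDiffAt.continuousAt
  obtain ⟨I, J, T, X, U₀, C, hp, ht, hx, e⟩ := hφ
  obtain ⟨I', J', T', X', U', C', hp', ht', hx', e'⟩ := hψ
  rw [e.self_of_nhds] at ht' hx'
  obtain ⟨I₁, J₁, hq, ht₁, hx₁⟩ := hp.comp ht hx hp' ht' hx'
  have e'' : ψ ∘ φ =ᶠ[𝓝 z] formBase (T' ∘ T) (X' ∘ X) (fun p => C' * U₀ p + U' (T p.1, X p.2))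
      (C' * C) := by
    filter_upwards [e, hcont.eventually e'] with y hy hy'
    rw [Function.comp_apply, hy', hy]
    refine Prod.ext rfl (Prod.ext rfl ?_)
    simp only [formBase]
    ring
  refine ⟨⟨I₁, J₁, _, _, _, _, hq, ht₁, hx₁, e''⟩, fun y => ?_⟩
  have hlφ : liftMap φ (z, y) = formMap T X U₀ C (z, y) := by
    rw [liftMap_congr e, hp.liftMap_formBase ht hx]
  have hψ' : liftMap ψ (liftMap φ (z, y)) = formMap T' X' U' C' (formMap T X U₀ C (z, y)) := by
    rw [hlφ, show formMap T X U₀ C (z, y) = (φ z, (formMap T X U₀ C (z, y)).2) from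
      Prod.ext e.self_of_nhds.symm rfl, liftMap_congr e', hp'.liftMap_formBase]
    · rw [e.self_of_nhds]; exact ht'
    · rw [e.self_of_nhds]; exact hx'
  rw [hψ', liftMap_congr e'', hq.liftMap_formBase ht₁ hx₁]
  have d1 := hp.deriv_T _ ht
  have d2 := hp.deriv_X _ hx
  have d3 := hp'.deriv_T _ ht'
  have d4 := hp'.deriv_X _ hx'
  refine Prod.ext (Prod.ext rfl (Prod.ext rfl ?_)) ?_
  · simp only [formMap]; ring
  · simp only [formMap]
    rw [hp.mixed_comp ht hx hp' ht' hx',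
      deriv_comp z.1 ((hp'.contDiffAt_T ht').differentiableAt (by simp))
        ((hp.contDiffAt_T ht).differentiableAt (by simp)),
      deriv_comp z.2.1 ((hp'.contDiffAt_X hx').differentiableAt (by simp))
        ((hp.contDiffAt_X hx).differentiableAt (by simp))]
    simp only [formBase] at d3 d4
    field_simp
    ring

/-- Conjugation by the permutation of `t` and `x`. -/
theorem NearForm.conj {φ : Base → Base} {z : Base} (h : NearForm φ (swapBase z)) :
    NearForm (swapBase ∘ φ ∘ swapBase) z ∧
      ∀ y, liftMap (swapBase ∘ φ ∘ swapBase) (z, y) = swapMap (liftMap φ (swapBase z, y)) := by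
  obtain ⟨I, J, T, X, U₀, C, hp, ht, hx, e⟩ := h
  have e' : swapBase ∘ φ ∘ swapBase =ᶠ[𝓝 z] formBase X T (fun p => U₀ (p.2, p.1)) C := by
    filter_upwards [continuous_swapBase.continuousAt.eventually e] with y hy
    simp only [Function.comp_apply, hy]
    rfl
  refine ⟨⟨J, I, X, T, _, C, hp.swap, hx, ht, e'⟩, fun y => ?_⟩
  rw [liftMap_congr e', hp.swap.liftMap_formBase hx ht, liftMap_congr e,
    hp.liftMap_formBase ht hx]
  refine Prod.ext rfl ?_
  have hm : mixed (fun p => U₀ (p.2, p.1)) z.1 z.2.1 = mixed U₀ z.2.1 z.1 :=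
    mixed_swap (hp.eventually_contDiffAt_U ht hx)
  simp only [formMap, swapMap, swapBase]
  rw [hm, mul_comm (deriv X _)]

theorem BaseForm.comp {φ ψ : Base → Base} {z : Base} (hφ : BaseForm φ z) (hψ : BaseForm ψ (φ z)) :
    BaseForm (ψ ∘ φ) z ∧ ∀ y, liftMap (ψ ∘ φ) (z, y) = liftMap ψ (liftMap φ (z, y)) := by
  rcases hφ with hφ | hφ <;> rcases hψ with hψ | hψ
  · exact ⟨Or.inl (hφ.comp hψ).1, (hφ.comp hψ).2⟩
  · obtain ⟨h1, h2⟩ := hφ.comp hψ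
    refine ⟨Or.inr h1, fun y => ?_⟩
    have := h2 y
    rw [Function.comp_assoc, liftMap_swapBase_comp, liftMap_swapBase_comp] at this
    simpa using congrArg swapMap this
  · have hc := NearForm.conj (φ := ψ) (z := (swapBase ∘ φ) z) hψ
    obtain ⟨h1, h2⟩ := hφ.comp hc.1
    refine ⟨Or.inr h1, fun y => ?_⟩
    have h3 : liftMap (swapBase ∘ ψ ∘ φ) (z, y) = _ := h2 y
    rw [liftMap_swapBase_comp, liftMap_swapBase_comp φ,
      show swapMap (liftMap φ (z, y)) = ((swapBase ∘ φ) z, (liftMap φ (z, y)).2) from rfl,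
      hc.2] at h3
    exact swapMap_swapMap (liftMap (ψ ∘ φ) (z, y)) ▸ swapMap_swapMap (liftMap ψ _) ▸
      congrArg swapMap h3
  · have hc := NearForm.conj (φ := swapBase ∘ ψ) (z := (swapBase ∘ φ) z) hψ
    obtain ⟨h1, h2⟩ := hφ.comp hc.1
    refine ⟨Or.inl h1, fun y => ?_⟩
    have h3 : liftMap (ψ ∘ φ) (z, y) = _ := h2 y
    rw [liftMap_swapBase_comp φ,
      show swapMap (liftMap φ (z, y)) = ((swapBase ∘ φ) z, (liftMap φ (z, y)).2) from rfl,
      hc.2, liftMap_swapBase_comp] at h3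
    exact h3

/-- A smooth function of one variable with nonvanishing derivative is locally a homeomorphism
between intervals. -/
theorem exists_interval_homeo {I : Set ℝ} (oI : IsOpen I) {T : ℝ → ℝ} (hT : ContDiffOn ℝ ∞ T I)
    (h0 : ∀ t ∈ I, deriv T t ≠ 0) {t₀ : ℝ} (ht₀ : t₀ ∈ I) :
    ∃ e : OpenPartialHomeomorph ℝ ℝ, (∀ t, e t = T t) ∧ t₀ ∈ e.source ∧ e.source ⊆ I ∧
      e.source.OrdConnected ∧ e.target.OrdConnected ∧ ContDiffOn ℝ ∞ e.symm e.target ∧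
      ∀ s ∈ e.target, deriv e.symm s ≠ 0 := by
  have hs : HasStrictDerivAt T (deriv T t₀) t₀ :=
    (hT.contDiffAt (oI.mem_nhds ht₀)).hasStrictDerivAt (by simp)
  have hs' := hs.hasStrictFDerivAt_equiv (h0 t₀ ht₀)
  set e₀ := hs'.toOpenPartialHomeomorph T with he₀
  have he₀c : (e₀ : ℝ → ℝ) = T := rfl
  have hmem : I ∩ e₀.source ∈ 𝓝 t₀ := inter_mem (oI.mem_nhds ht₀)
    (e₀.open_source.mem_nhds hs'.mem_toOpenPartialHomeomorph_source)
  obtain ⟨ε, hε, hb⟩ := Metric.mem_nhds_iff.1 hmem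
  set e := e₀.restrOpen (Metric.ball t₀ ε) Metric.isOpen_ball with he
  have hsrc : e.source = Metric.ball t₀ ε := by
    rw [he, OpenPartialHomeomorph.restrOpen_source]
    exact inter_eq_self_of_subset_right fun s hs => (hb hs).2
  have hsub : e.source ⊆ I := fun s hs => (hb (hsrc ▸ hs)).1
  have hec : ∀ t, e t = T t := fun t => rfl
  have hord : e.source.OrdConnected := by
    rw [hsrc, Real.ball_eq_Ioo]; exact ordConnected_Ioo
  have hder : ∀ s ∈ e.source, HasDerivAt T (deriv T s) s := fun s hs =>
    ((hT.contDiffAt (oI.mem_nhds (hsub hs))).differentiableAt (by simp)).hasDerivAt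
  refine ⟨e, hec, ?_, hsub, hord, ?_, ?_, ?_⟩
  · rw [hsrc]; exact Metric.mem_ball_self hε
  · rw [← e.image_source_eq_target]
    exact (hord.isPreconnected.image _ e.continuousOn).ordConnected
  · intro s hs
    have hm := e.map_target hs
    exact (e.contDiffAt_symm_deriv (h0 _ (hsub hm)) hs (hder _ hm)
      (hT.contDiffAt (oI.mem_nhds (hsub hm)))).contDiffWithinAt
  · intro s hs
    have hm := e.map_target hs
    have := e.hasDerivAt_symm hs (h0 _ (hsub hm)) (hder _ hm)
    rw [this.deriv]
    exact inv_ne_zero (h0 _ (hsub hm))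

/-- A local left inverse of a map of the displayed form is of the displayed form. -/
theorem NearForm.leftInverse {φ ψ : Base → Base} {z : Base} (h : NearForm φ z)
    (hψ : ∀ᶠ y in 𝓝 z, ψ (φ y) = y) : NearForm ψ (φ z) := by
  obtain ⟨I, J, T, X, U₀, C, hp, ht, hx, e⟩ := h
  obtain ⟨σ, hσ, tσ, sσ, -, oσ, cσ, dσ⟩ :=
    exists_interval_homeo hp.isOpen_left hp.smooth_T hp.deriv_T ht
  obtain ⟨ρ, hρ, xρ, sρ, -, oρ, cρ, dρ⟩ :=
    exists_interval_homeo hp.isOpen_right hp.smooth_X hp.deriv_X hx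
  have hz : φ z = formBase T X U₀ C z := e.self_of_nhds
  have hC := hp.const_ne
  have mt : (φ z).1 ∈ σ.target := by
    rw [hz, formBase, ← hσ]; exact σ.map_source tσ
  have mx : (φ z).2.1 ∈ ρ.target := by
    rw [hz, formBase, ← hρ]; exact ρ.map_source xρ
  have hq : IsParameter σ.target ρ.target σ.symm ρ.symm
      (fun p => -C⁻¹ * U₀ (σ.symm p.1, ρ.symm p.2)) C⁻¹ := by
    refine ⟨σ.open_target, ρ.open_target, oσ, oρ, cσ, cρ, ?_, dσ, dρ, inv_ne_zero hC⟩
    refine contDiffOn_const.mul (hp.smooth_U.comp ((cσ.comp contDiffOn_fst fun p hp => hp.1).prodMk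
      (cρ.comp contDiffOn_snd fun p hp => hp.2)) fun p hp => ?_)
    exact ⟨sσ (σ.map_target hp.1), sρ (ρ.map_target hp.2)⟩
  refine ⟨_, _, _, _, _, _, hq, mt, mx, ?_⟩
  set g := formBase σ.symm ρ.symm (fun p => -C⁻¹ * U₀ (σ.symm p.1, ρ.symm p.2)) C⁻¹ with hg
  have hgz : g (φ z) = z := by
    rw [hz]
    refine Prod.ext ?_ (Prod.ext ?_ ?_)
    · show σ.symm (T z.1) = z.1
      rw [← hσ, σ.left_inv tσ]
    · show ρ.symm (X z.2.1) = z.2.1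
      rw [← hρ, ρ.left_inv xρ]
    · show C⁻¹ * (C * z.2.2 + U₀ (z.1, z.2.1)) + -C⁻¹ * U₀ (σ.symm (T z.1), ρ.symm (X z.2.1)) = z.2.2
      rw [← hσ, σ.left_inv tσ, ← hρ, ρ.left_inv xρ]
      field_simp
      ring
  have hgc : Tendsto g (𝓝 (φ z)) (𝓝 z) := by
    have := (hq.contDiffAt_formBase mt mx).continuousAt.tendsto
    rwa [← hg, hgz] at this
  filter_upwards [hgc.eventually e, hgc.eventually hψ, hq.mem_nhds mt mx] with y h1 h2 h3
  rw [← h2, h1]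
  congr 1
  refine Prod.ext ?_ (Prod.ext ?_ ?_)
  · show y.1 = T (σ.symm y.1)
    rw [← hσ, σ.right_inv h3.1]
  · show y.2.1 = X (ρ.symm y.2.1)
    rw [← hρ, ρ.right_inv h3.2]
  · show y.2.2 = C * (C⁻¹ * y.2.2 + -C⁻¹ * U₀ (σ.symm y.1, ρ.symm y.2.1)) +
      U₀ (σ.symm y.1, ρ.symm y.2.1)
    field_simp
    ring

theorem BaseForm.leftInverse {φ ψ : Base → Base} {z : Base} (h : BaseForm φ z)
    (hψ : ∀ᶠ y in 𝓝 z, ψ (φ y) = y) : BaseForm ψ (φ z) := by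
  rcases h with h | h
  · exact Or.inl (h.leftInverse hψ)
  · have h1 : NearForm (ψ ∘ swapBase) (swapBase (φ z)) :=
      h.leftInverse (ψ := ψ ∘ swapBase) hψ
    exact Or.inr h1.conj.1

theorem BaseForm.symm {φ : OpenPartialHomeomorph Base Base} {z : Base} (hz : z ∈ φ.source)
    (h : BaseForm φ z) : BaseForm φ.symm (φ z) :=
  h.leftInverse (φ.eventually_left_inverse hz)

theorem BaseForm.contDiffAt {φ : Base → Base} {z : Base} (h : BaseForm φ z) :
    ContDiffAt ℝ ∞ φ z := by
  rcases h with h | h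
  · exact h.contDiffAt
  · exact contDiff_swapBase.contDiffAt.comp z h.contDiffAt

theorem BaseForm.isDiffeo {φ : OpenPartialHomeomorph Base Base}
    (h : ∀ z ∈ φ.source, BaseForm φ z) : IsDiffeo φ := by
  refine ⟨fun z hz => (h z hz).contDiffAt.contDiffWithinAt, fun z hz => ?_⟩
  have := (h _ (φ.map_target hz)).symm (φ.map_target hz)
  rw [φ.right_inv hz] at this
  exact this.contDiffAt.contDiffWithinAt

theorem BaseForm.congr {φ ψ : Base → Base} {z : Base} (h : BaseForm ψ z) (e : φ =ᶠ[𝓝 z] ψ) :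
    BaseForm φ z := by
  rcases h with h | h
  · obtain ⟨I, J, T, X, U₀, C, hp, ht, hx, e'⟩ := h
    exact Or.inl ⟨I, J, T, X, U₀, C, hp, ht, hx, e.trans e'⟩
  · obtain ⟨I, J, T, X, U₀, C, hp, ht, hx, e'⟩ := h
    exact Or.inr ⟨I, J, T, X, U₀, C, hp, ht, hx, (e.fun_comp swapBase).trans e'⟩

theorem NearForm.id (z : Base) : NearForm id z := by
  refine ⟨univ, univ, fun t => t, fun x => x, fun _ => 0, 1,
    ⟨isOpen_univ, isOpen_univ, ordConnected_univ, ordConnected_univ, by fun_prop, by fun_prop,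
      by fun_prop, by simp, by simp, one_ne_zero⟩, trivial, trivial, .of_forall fun y => ?_⟩
  simp [formBase]

theorem liftMap_id (w : BaseF) : liftMap id w = w := by
  have hp : IsParameter univ univ (fun t => t) (fun x => x) (fun _ => 0) 1 :=
    ⟨isOpen_univ, isOpen_univ, ordConnected_univ, ordConnected_univ, by fun_prop, by fun_prop,
      by fun_prop, by simp, by simp, one_ne_zero⟩
  have : (id : Base → Base) = formBase (fun t => t) (fun x => x) (fun _ => 0) 1 := by
    ext y <;> simp [formBase]
  rw [this, show w = (w.1, w.2) from rfl, hp.liftMap_formBase trivial trivial]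
  simp [formMap, mixed]

theorem BaseForm.derivU_ne_zero {φ : Base → Base} {z : Base} (h : BaseForm φ z) :
    derivU φ z ≠ 0 := by
  rcases h with h | h <;> exact h.formDeriv.U_u

theorem BaseForm.factorTX_ne_zero {φ : Base → Base} {z : Base} (h : BaseForm φ z) :
    factorTX φ z ≠ 0 := by
  rcases h with h | h <;> have h' := h.formDeriv <;> unfold factorTX
  · rw [h'.T_x, zero_mul, add_zero]
    exact mul_ne_zero h'.T_t h'.X_x
  · have h1 : fderiv ℝ (fun y => (φ y).2.1) z (0, 1, 0) = 0 := h'.T_x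
    rw [h1, mul_zero, zero_add]
    exact mul_ne_zero h'.X_x h'.T_t

section Smoothness

variable {φ : Base → Base} {z : Base}

theorem contDiffAt_derivU (h : ContDiffAt ℝ ∞ φ z) : ContDiffAt ℝ ∞ (derivU φ) z :=
  h.comp_U.fderiv_apply_const _

theorem contDiffAt_derivTX (h : ContDiffAt ℝ ∞ φ z) : ContDiffAt ℝ ∞ (derivTX φ) z :=
  (h.comp_U.fderiv_apply_const _).fderiv_apply_const _

theorem contDiffAt_factorTX (h : ContDiffAt ℝ ∞ φ z) : ContDiffAt ℝ ∞ (factorTX φ) z :=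
  ((h.comp_T.fderiv_apply_const _).mul (h.comp_X.fderiv_apply_const _)).add
    ((h.comp_T.fderiv_apply_const _).mul (h.comp_X.fderiv_apply_const _))

theorem BaseForm.contDiffAt_liftMap (h : BaseForm φ z) (y : ℝ) :
    ContDiffAt ℝ ∞ (liftMap φ) (z, y) := by
  have hs := h.contDiffAt
  have hf : ContDiffAt ℝ ∞ (Prod.fst : BaseF → Base) (z, y) := contDiffAt_fst
  have h1 : ContDiffAt ℝ ∞ (fun w : BaseF => derivU φ w.1) (z, y) :=
    ContDiffAt.comp (g := derivU φ) (z, y) (contDiffAt_derivU hs) hf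
  have h2 : ContDiffAt ℝ ∞ (fun w : BaseF => derivTX φ w.1) (z, y) :=
    ContDiffAt.comp (g := derivTX φ) (z, y) (contDiffAt_derivTX hs) hf
  have h3 : ContDiffAt ℝ ∞ (fun w : BaseF => factorTX φ w.1) (z, y) :=
    ContDiffAt.comp (g := factorTX φ) (z, y) (contDiffAt_factorTX hs) hf
  exact (hs.comp (z, y) hf).prodMk (((h1.mul contDiffAt_snd).add h2).div h3 h.factorTX_ne_zero)

end Smoothness

/-- The extension by `liftMap`, as a transformation of the space of `(t,x,u,f)`. -/
noncomputable def liftHomeo (φ : OpenPartialHomeomorph Base Base) (h : ∀ z ∈ φ.source, BaseForm φ z) :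
    OpenPartialHomeomorph BaseF BaseF where
  toFun := liftMap φ
  invFun w := (φ.symm w.1, (w.2 * factorTX φ (φ.symm w.1) - derivTX φ (φ.symm w.1)) /
    derivU φ (φ.symm w.1))
  source := φ.source ×ˢ univ
  target := φ.target ×ˢ univ
  map_source' w hw := ⟨φ.map_source hw.1, trivial⟩
  map_target' w hw := ⟨φ.map_target hw.1, trivial⟩
  left_inv' w hw := by
    have h1 := (h _ hw.1).derivU_ne_zero
    have h2 := (h _ hw.1).factorTX_ne_zero
    refine Prod.ext (φ.left_inv hw.1) ?_
    simp only [liftMap, φ.left_inv hw.1]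
    field_simp
    ring
  right_inv' w hw := by
    have hm := φ.map_target hw.1
    have h1 := (h _ hm).derivU_ne_zero
    have h2 := (h _ hm).factorTX_ne_zero
    refine Prod.ext (φ.right_inv hw.1) ?_
    simp only [liftMap]
    field_simp
    ring
  open_source := φ.open_source.prod isOpen_univ
  open_target := φ.open_target.prod isOpen_univ
  continuousOn_toFun w hw := ((h _ hw.1).contDiffAt_liftMap w.2).continuousAt.continuousWithinAt
  continuousOn_invFun w hw := by
    have hm := φ.map_target hw.1
    have hs := (h _ hm).contDiffAt
    have c1 : ContinuousAt (fun w : BaseF => φ.symm w.1) w :=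
      (φ.symm.continuousAt hw.1).comp continuousAt_fst
    have c2 : ContinuousAt (fun w : BaseF => factorTX φ (φ.symm w.1)) w :=
      ContinuousAt.comp (f := fun w : BaseF => φ.symm w.1)
        (contDiffAt_factorTX hs).continuousAt c1
    have c3 : ContinuousAt (fun w : BaseF => derivTX φ (φ.symm w.1)) w :=
      ContinuousAt.comp (f := fun w : BaseF => φ.symm w.1)
        (contDiffAt_derivTX hs).continuousAt c1
    have c4 : ContinuousAt (fun w : BaseF => derivU φ (φ.symm w.1)) w :=
      ContinuousAt.comp (f := fun w : BaseF => φ.symm w.1)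
        (contDiffAt_derivU hs).continuousAt c1
    exact (c1.prodMk (((continuousAt_snd.mul c2).sub c3).div c4
      (h _ hm).derivU_ne_zero)).continuousWithinAt

theorem liftHomeo_projectsTo (φ : OpenPartialHomeomorph Base Base)
    (h : ∀ z ∈ φ.source, BaseForm φ z) : ProjectsTo (liftHomeo φ h) φ :=
  ⟨rfl, rfl, fun _ _ => rfl⟩

/-- Locally, a map of the displayed form is the restriction of a transformation of the base that is
defined for all `u`. -/
theorem IsParameter.exists_homeo {I J : Set ℝ} {T X : ℝ → ℝ} {U₀ : ℝ × ℝ → ℝ} {C : ℝ}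
    (hp : IsParameter I J T X U₀ C) {t x : ℝ} (ht : t ∈ I) (hx : x ∈ J) :
    ∃ (I' J' : Set ℝ) (φ : OpenPartialHomeomorph Base Base), IsParameter I' J' T X U₀ C ∧
      t ∈ I' ∧ x ∈ J' ∧ I' ⊆ I ∧ J' ⊆ J ∧ φ.source = {z | z.1 ∈ I' ∧ z.2.1 ∈ J'} ∧
      ∀ z, φ z = formBase T X U₀ C z := by
  obtain ⟨σ, hσ, tσ, sσ, iσ, -, cσ, -⟩ :=
    exists_interval_homeo hp.isOpen_left hp.smooth_T hp.deriv_T ht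
  obtain ⟨ρ, hρ, xρ, sρ, iρ, -, cρ, -⟩ :=
    exists_interval_homeo hp.isOpen_right hp.smooth_X hp.deriv_X hx
  have hC := hp.const_ne
  have hq := hp.mono sσ sρ σ.open_source ρ.open_source iσ iρ
  refine ⟨σ.source, ρ.source,
    { toFun := formBase T X U₀ C
      invFun := fun z => (σ.symm z.1, ρ.symm z.2.1,
        (z.2.2 - U₀ (σ.symm z.1, ρ.symm z.2.1)) / C)
      source := {z | z.1 ∈ σ.source ∧ z.2.1 ∈ ρ.source}
      target := {z | z.1 ∈ σ.target ∧ z.2.1 ∈ ρ.target}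
      map_source' := ?_
      map_target' := ?_
      left_inv' := ?_
      right_inv' := ?_
      open_source := ?_
      open_target := ?_
      continuousOn_toFun := ?_
      continuousOn_invFun := ?_ }, hq, tσ, xρ, sσ, sρ, rfl, fun _ => rfl⟩
  · intro z hz
    simp only [formBase, ← hσ, ← hρ]
    exact ⟨σ.map_source hz.1, ρ.map_source hz.2⟩
  · exact fun z hz => ⟨σ.map_target hz.1, ρ.map_target hz.2⟩
  · intro z hz
    simp only [formBase, ← hσ, ← hρ, σ.left_inv hz.1, ρ.left_inv hz.2]
    refine Prod.ext rfl (Prod.ext rfl ?_)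
    simp only
    field_simp
    ring
  · intro z hz
    simp only [formBase, ← hσ, ← hρ, σ.right_inv hz.1, ρ.right_inv hz.2]
    refine Prod.ext rfl (Prod.ext rfl ?_)
    simp only
    field_simp
    ring
  · exact fun z hz => (hq.contDiffAt_formBase hz.1 hz.2).continuousAt.continuousWithinAt
  · intro z hz
    have c1 : ContinuousAt (fun z : Base => σ.symm z.1) z :=
      ContinuousAt.comp (f := fun z : Base => z.1) (σ.symm.continuousAt hz.1) (by fun_prop)
    have c2 : ContinuousAt (fun z : Base => ρ.symm z.2.1) z :=
      ContinuousAt.comp (f := fun z : Base => z.2.1) (ρ.symm.continuousAt hz.2) (by fun_prop)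
    have c3 : ContinuousAt (fun z : Base => U₀ (σ.symm z.1, ρ.symm z.2.1)) z :=
      ContinuousAt.comp (f := fun z : Base => (σ.symm z.1, ρ.symm z.2.1))
        (hq.contDiffAt_U (σ.map_target hz.1) (ρ.map_target hz.2)).continuousAt (c1.prodMk c2)
    exact (c1.prodMk (c2.prodMk (((by fun_prop : ContinuousAt (fun z : Base => z.2.2) z).sub
      c3).div_const C))).continuousWithinAt
  · exact (σ.open_source.preimage continuous_fst).inter
      (ρ.open_source.preimage (by fun_prop : Continuous fun y : Base => y.2.1))
  · exact (σ.open_target.preimage continuous_fst).inter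
      (ρ.open_target.preimage (by fun_prop : Continuous fun y : Base => y.2.1))

/-! ### First prolongations -/

/-- The permutation of `t` and `x` in the space of first-order jets. -/
def swapJet (w : Jet) : Jet := (swapBase w.1, (w.2.2, w.2.1))

theorem contDiff_swapJet : ContDiff ℝ ∞ swapJet := by
  unfold swapJet swapBase; fun_prop

theorem contactCondition_congr {Φ Ψ : Jet → Jet} {w : Jet} (e : Φ =ᶠ[𝓝 w] Ψ)
    (h : ContactCondition Ψ {w}) : ContactCondition Φ {w} := by
  rintro w rfl a b c
  have eT : cT Φ =ᶠ[𝓝 w] cT Ψ := e.fun_comp fun y => y.1.1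
  have eX : cX Φ =ᶠ[𝓝 w] cX Ψ := e.fun_comp fun y => y.1.2.1
  have eU : cU Φ =ᶠ[𝓝 w] cU Ψ := e.fun_comp fun y => y.1.2.2
  have eP : cUt Φ =ᶠ[𝓝 w] cUt Ψ := e.fun_comp fun y => y.2.1
  have eQ : cUx Φ =ᶠ[𝓝 w] cUx Ψ := e.fun_comp fun y => y.2.2
  have := h w rfl a b c
  simpa only [totalT, totalX, eT.fderiv_eq, eX.fderiv_eq, eU.fderiv_eq, eP.self_of_nhds,
    eQ.self_of_nhds] using this

theorem mapsEquation_congr {Φ Ψ : Jet → Jet} {w : Jet} {f f' : Base → ℝ} (e : Φ =ᶠ[𝓝 w] Ψ) :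
    MapsEquation Φ {w} f f' ↔ MapsEquation Ψ {w} f f' := by
  have eT : cT Φ =ᶠ[𝓝 w] cT Ψ := e.fun_comp fun y => y.1.1
  have eX : cX Φ =ᶠ[𝓝 w] cX Ψ := e.fun_comp fun y => y.1.2.1
  have eP : cUt Φ =ᶠ[𝓝 w] cUt Ψ := e.fun_comp fun y => y.2.1
  have eQ : cUx Φ =ᶠ[𝓝 w] cUx Ψ := e.fun_comp fun y => y.2.2
  simp only [MapsEquation, mem_singleton_iff, forall_eq, totalDet, totalT, totalX, eT.fderiv_eq,
    eX.fderiv_eq, eP.fderiv_eq, eQ.fderiv_eq, e.self_of_nhds]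

theorem ContactCondition.swap {Φ : Jet → Jet} {W : Set Jet} (h : ContactCondition Φ W) :
    ContactCondition (swapJet ∘ Φ) W := fun w hw a b c =>
  ⟨(add_comm _ _).trans (h w hw a b c).1, (add_comm _ _).trans (h w hw a b c).2⟩

theorem totalDet_swap (F G : Jet → ℝ) (w : Jet) (a b c : ℝ) :
    totalDet F G w a b c = -totalDet G F w a b c := by
  unfold totalDet; ring

theorem mapsEquation_swap {Φ : Jet → Jet} {W : Set Jet} {f f' : Base → ℝ} :
    MapsEquation (swapJet ∘ Φ) W f f' ↔ MapsEquation Φ W f (f' ∘ swapBase) := by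
  refine forall₂_congr fun w _ => forall₃_congr fun a b c => ?_
  show (totalDet (cX Φ) (cT Φ) w a b c ≠ 0 → (b = f w.1 ↔
    totalDet (cUt Φ) (cT Φ) w a b c =
      f' (swapBase (Φ w).1) * totalDet (cX Φ) (cT Φ) w a b c ∧
    totalDet (cX Φ) (cUx Φ) w a b c =
      f' (swapBase (Φ w).1) * totalDet (cX Φ) (cT Φ) w a b c)) ↔ _
  rw [totalDet_swap (cX Φ) (cT Φ), totalDet_swap (cUt Φ) (cT Φ), totalDet_swap (cX Φ) (cUx Φ),
    and_comm, mul_neg, neg_inj, neg_inj, neg_ne_zero]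
  rfl

theorem prolong_swapBase_comp (φ : Base → Base) : prolong (swapBase ∘ φ) = swapJet ∘ prolong φ := by
  funext w
  refine Prod.ext rfl (Prod.ext ?_ ?_)
  · simp only [prolong, swapJet, swapBase, Function.comp_apply]
    rw [← neg_div_neg_eq]
    congr 1 <;> ring
  · simp only [prolong, swapJet, swapBase, Function.comp_apply]
    rw [← neg_div_neg_eq]
    congr 1 <;> ring

theorem prolong_congr {φ ψ : Base → Base} {w : Jet} (e : φ =ᶠ[𝓝 w.1] ψ) :
    prolong φ =ᶠ[𝓝 w] prolong ψ := by
  filter_upwards [continuous_fst.continuousAt.eventually e.eventuallyEq_nhds] with w' e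
  have e1 : (fun y => (φ y).1) =ᶠ[𝓝 w'.1] fun y => (ψ y).1 := e.fun_comp Prod.fst
  have e2 : (fun y => (φ y).2.1) =ᶠ[𝓝 w'.1] fun y => (ψ y).2.1 := e.fun_comp fun y => y.2.1
  have e3 : (fun y => (φ y).2.2) =ᶠ[𝓝 w'.1] fun y => (ψ y).2.2 := e.fun_comp fun y => y.2.2
  simp only [prolong, baseTotalT, baseTotalX, e1.fderiv_eq, e2.fderiv_eq, e3.fderiv_eq,
    e.self_of_nhds]

/-- The first prolongation of `t̃ = T(t)`, `x̃ = X(x)`, `ũ = υ(t,x,u)`. -/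
noncomputable def pointJet (T X : ℝ → ℝ) (υ : Base → ℝ) (w : Jet) : Jet :=
  ((T w.1.1, X w.1.2.1, υ w.1),
    ((fderiv ℝ υ w.1 (1, 0, 0) + w.2.1 * fderiv ℝ υ w.1 (0, 0, 1)) / deriv T w.1.1,
     (fderiv ℝ υ w.1 (0, 1, 0) + w.2.2 * fderiv ℝ υ w.1 (0, 0, 1)) / deriv X w.1.2.1))

theorem _root_.ContDiffAt.deriv_smooth {T : ℝ → ℝ} {t : ℝ} (h : ContDiffAt ℝ ∞ T t) :
    ContDiffAt ℝ ∞ (deriv T) t := by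
  have : deriv T = fun s => fderiv ℝ T s 1 := by
    funext s; simp
  rw [this]
  exact h.fderiv_apply_const 1

theorem fderiv_comp_fst {g : Base → ℝ} {w : Jet} (hg : DifferentiableAt ℝ g w.1) (v : Jet) :
    fderiv ℝ (fun y : Jet => g y.1) w v = fderiv ℝ g w.1 v.1 := by
  have := HasFDerivAt.comp (f := fun y : Jet => y.1) w hg.hasFDerivAt hasFDerivAt_fst
  rw [HasFDerivAt.fderiv (f := fun y : Jet => g y.1) this]
  rfl

/-- The derivative of a quotient in a direction in which the denominator is constant. -/
theorem fderiv_div_apply_of_eq_zero {E : Type*} [NormedAddCommGroup E] [NormedSpace ℝ E]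
    {n d : E → ℝ} {w v : E} (hn : DifferentiableAt ℝ n w) (hd : DifferentiableAt ℝ d w)
    (h0 : d w ≠ 0) (hv : fderiv ℝ d w v = 0) :
    fderiv ℝ (fun y => n y / d y) w v = fderiv ℝ n w v / d w := by
  have h1 : DifferentiableAt ℝ (fun y => n y / d y) w := by
    simp only [div_eq_mul_inv]
    exact hn.fun_mul (hd.fun_inv h0)
  have h2 : n =ᶠ[𝓝 w] fun y => n y / d y * d y := by
    filter_upwards [hd.continuousAt.eventually_ne h0] with y hy
    field_simp
  rw [h2.fderiv_eq, fderiv_fun_mul h1 hd]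
  simp [hv, h0]

section PointJet

variable {T X : ℝ → ℝ} {υ : Base → ℝ} {w : Jet}

theorem prolong_eq_pointJet {φ : Base → Base} (e : φ =ᶠ[𝓝 w.1] fun z => (T z.1, X z.2.1, υ z))
    (hT : DifferentiableAt ℝ T w.1.1) (hX : DifferentiableAt ℝ X w.1.2.1)
    (hT0 : deriv T w.1.1 ≠ 0) (hX0 : deriv X w.1.2.1 ≠ 0) : prolong φ w = pointJet T X υ w := by
  have h := (prolong_congr e).self_of_nhds
  rw [h]
  refine Prod.ext rfl (Prod.ext ?_ ?_)
  · simp only [prolong, pointJet, baseTotalT, baseTotalX, fderiv_comp_t hT, fderiv_comp_x hX]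
    rw [fderiv_base_apply (fderiv ℝ υ w.1) (1, 0, w.2.1)]
    field_simp
    ring
  · simp only [prolong, pointJet, baseTotalT, baseTotalX, fderiv_comp_t hT, fderiv_comp_x hX]
    rw [fderiv_base_apply (fderiv ℝ υ w.1) (0, 1, w.2.2)]
    field_simp
    ring

theorem contDiffAt_pointJet (hT : ContDiffAt ℝ ∞ T w.1.1) (hX : ContDiffAt ℝ ∞ X w.1.2.1)
    (hυ : ContDiffAt ℝ ∞ υ w.1) (hT0 : deriv T w.1.1 ≠ 0) (hX0 : deriv X w.1.2.1 ≠ 0) :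
    ContDiffAt ℝ ∞ (pointJet T X υ) w := by
  have ct : ContDiffAt ℝ ∞ (fun w : Jet => w.1.1) w := by fun_prop
  have cx : ContDiffAt ℝ ∞ (fun w : Jet => w.1.2.1) w := by fun_prop
  have cz : ContDiffAt ℝ ∞ (fun w : Jet => w.1) w := by fun_prop
  have cυ : ∀ v, ContDiffAt ℝ ∞ (fun w : Jet => fderiv ℝ υ w.1 v) w := fun v =>
    ContDiffAt.comp (f := fun w : Jet => w.1) w (hυ.fderiv_apply_const v) cz
  refine ContDiffAt.prodMk (ContDiffAt.prodMk ?_ (ContDiffAt.prodMk ?_ ?_))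
    (ContDiffAt.prodMk (ContDiffAt.div ?_ ?_ hT0) (ContDiffAt.div ?_ ?_ hX0))
  · exact ContDiffAt.comp (f := fun w : Jet => w.1.1) w hT ct
  · exact ContDiffAt.comp (f := fun w : Jet => w.1.2.1) w hX cx
  · exact ContDiffAt.comp (f := fun w : Jet => w.1) w hυ cz
  · exact (cυ _).add (ContDiffAt.mul (by fun_prop) (cυ _))
  · exact ContDiffAt.comp (f := fun w : Jet => w.1.1) w hT.deriv_smooth ct
  · exact (cυ _).add (ContDiffAt.mul (by fun_prop) (cυ _))
  · exact ContDiffAt.comp (f := fun w : Jet => w.1.2.1) w hX.deriv_smooth cx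

theorem totalDet_pointJet_base (hT : DifferentiableAt ℝ T w.1.1)
    (hX : DifferentiableAt ℝ X w.1.2.1) (a b c : ℝ) :
    totalDet (cT (pointJet T X υ)) (cX (pointJet T X υ)) w a b c =
      deriv T w.1.1 * deriv X w.1.2.1 := by
  have e1 : ∀ v, fderiv ℝ (cT (pointJet T X υ)) w v = v.1.1 * deriv T w.1.1 := fun v =>
    (fderiv_comp_fst (g := fun y : Base => T y.1) (hT.comp w.1 differentiableAt_fst) v).trans
      (fderiv_comp_t hT v.1)
  have e2 : ∀ v, fderiv ℝ (cX (pointJet T X υ)) w v = v.1.2.1 * deriv X w.1.2.1 := fun v =>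
    (fderiv_comp_fst (g := fun y : Base => X y.2.1)
      (DifferentiableAt.comp (f := fun y : Base => y.2.1) w.1 hX (by fun_prop)) v).trans
      (fderiv_comp_x hX v.1)
  simp [totalDet, totalT, totalX, e1, e2]

/-- The numerator of `ũ_t̃x̃ = (...) / (T_t X_x)` for `t̃ = T(t)`, `x̃ = X(x)`, `ũ = υ(t,x,u)`, where
`b = u_tx`. -/
noncomputable def mixedTotal (υ : Base → ℝ) (w : Jet) (b : ℝ) : ℝ :=
  fderiv ℝ (fun y => fderiv ℝ υ y (1, 0, 0)) w.1 (0, 1, 0)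
    + w.2.2 * fderiv ℝ (fun y => fderiv ℝ υ y (0, 0, 1)) w.1 (1, 0, 0)
    + w.2.1 * fderiv ℝ (fun y => fderiv ℝ υ y (0, 0, 1)) w.1 (0, 1, 0)
    + w.2.1 * w.2.2 * fderiv ℝ (fun y => fderiv ℝ υ y (0, 0, 1)) w.1 (0, 0, 1)
    + b * fderiv ℝ υ w.1 (0, 0, 1)

theorem contactCondition_pointJet (hT : DifferentiableAt ℝ T w.1.1)
    (hX : DifferentiableAt ℝ X w.1.2.1) (hυ : DifferentiableAt ℝ υ w.1)
    (hT0 : deriv T w.1.1 ≠ 0) (hX0 : deriv X w.1.2.1 ≠ 0) :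
    ContactCondition (pointJet T X υ) {w} := by
  rintro w rfl a b c
  have e1 : ∀ v, fderiv ℝ (cT (pointJet T X υ)) w v = v.1.1 * deriv T w.1.1 := fun v =>
    (fderiv_comp_fst (g := fun y : Base => T y.1) (hT.comp w.1 differentiableAt_fst) v).trans
      (fderiv_comp_t hT v.1)
  have e2 : ∀ v, fderiv ℝ (cX (pointJet T X υ)) w v = v.1.2.1 * deriv X w.1.2.1 := fun v =>
    (fderiv_comp_fst (g := fun y : Base => X y.2.1)
      (DifferentiableAt.comp (f := fun y : Base => y.2.1) w.1 hX (by fun_prop)) v).trans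
      (fderiv_comp_x hX v.1)
  have e3 : ∀ v, fderiv ℝ (cU (pointJet T X υ)) w v = fderiv ℝ υ w.1 v.1 := fun v =>
    fderiv_comp_fst hυ v
  simp only [totalT, totalX, e1, e2, e3, cUt, cUx, pointJet]
  rw [fderiv_base_apply (fderiv ℝ υ w.1) (1, 0, w.2.1),
    fderiv_base_apply (fderiv ℝ υ w.1) (0, 1, w.2.2)]
  constructor <;> field_simp <;> ring

theorem totalDet_pointJet (hT : ContDiffAt ℝ ∞ T w.1.1) (hX : ContDiffAt ℝ ∞ X w.1.2.1)
    (hυ : ContDiffAt ℝ ∞ υ w.1) (hT0 : deriv T w.1.1 ≠ 0) (hX0 : deriv X w.1.2.1 ≠ 0)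
    (a b c : ℝ) :
    totalDet (cUx (pointJet T X υ)) (cX (pointJet T X υ)) w a b c = mixedTotal υ w b ∧
      totalDet (cT (pointJet T X υ)) (cUt (pointJet T X υ)) w a b c = mixedTotal υ w b := by
  have dT := hT.differentiableAt (by simp)
  have dX := hX.differentiableAt (by simp)
  have e1 : ∀ v, fderiv ℝ (cT (pointJet T X υ)) w v = v.1.1 * deriv T w.1.1 := fun v =>
    (fderiv_comp_fst (g := fun y : Base => T y.1) (dT.comp w.1 differentiableAt_fst) v).trans
      (fderiv_comp_t dT v.1)
  have e2 : ∀ v, fderiv ℝ (cX (pointJet T X υ)) w v = v.1.2.1 * deriv X w.1.2.1 := fun v =>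
    (fderiv_comp_fst (g := fun y : Base => X y.2.1)
      (DifferentiableAt.comp (f := fun y : Base => y.2.1) w.1 dX (by fun_prop)) v).trans
      (fderiv_comp_x dX v.1)
  have dυ : ∀ v, DifferentiableAt ℝ (fun y => fderiv ℝ υ y v) w.1 := fun v =>
    (hυ.fderiv_apply_const v).differentiableAt (by simp)
  have dυ' : ∀ v, DifferentiableAt ℝ (fun y : Jet => fderiv ℝ υ y.1 v) w := fun v =>
    DifferentiableAt.comp (f := fun y : Jet => y.1) w (dυ v) differentiableAt_fst
  -- the derivatives of the numerators of the components `U^t` and `U^x`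
  have hn : ∀ (e : Base) (π : Jet →L[ℝ] ℝ) (v : Jet),
      fderiv ℝ (fun y : Jet => fderiv ℝ υ y.1 e + π y * fderiv ℝ υ y.1 (0, 0, 1)) w v =
      fderiv ℝ (fun y => fderiv ℝ υ y e) w.1 v.1 + (π v * fderiv ℝ υ w.1 (0, 0, 1)
        + π w * fderiv ℝ (fun y => fderiv ℝ υ y (0, 0, 1)) w.1 v.1) := by
    intro e π v
    rw [fderiv_fun_add (dυ' e) (π.differentiableAt.fun_mul (dυ' _)),
      fderiv_fun_mul π.differentiableAt (dυ' _)]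
    simp only [add_apply, smul_apply, smul_eq_mul,
      fderiv_comp_fst (dυ _), ContinuousLinearMap.fderiv]
    ring
  have e3 : totalX (cUt (pointJet T X υ)) w b c = mixedTotal υ w b / deriv T w.1.1 := by
    have hd : DifferentiableAt ℝ (fun y : Base => deriv T y.1) w.1 :=
      DifferentiableAt.comp (f := fun y : Base => y.1) w.1
        (hT.deriv_smooth.differentiableAt (by simp)) differentiableAt_fst
    have := fderiv_div_apply_of_eq_zero (w := w) (v := ((0, 1, w.2.2), (b, c)))
      (n := fun y : Jet => fderiv ℝ υ y.1 (1, 0, 0) + y.2.1 * fderiv ℝ υ y.1 (0, 0, 1))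
      (d := fun y : Jet => deriv T y.1.1)
      ((dυ' _).add (DifferentiableAt.mul (by fun_prop) (dυ' _)))
      (DifferentiableAt.comp (f := fun y : Jet => y.1) w hd differentiableAt_fst) hT0 (by
        rw [fderiv_comp_fst (g := fun y : Base => deriv T y.1) hd,
          fderiv_comp_t (hT.deriv_smooth.differentiableAt (by simp))]
        simp)
    refine this.trans ?_
    have h2 := hn (1, 0, 0) ((ContinuousLinearMap.fst ℝ ℝ ℝ).comp
      (ContinuousLinearMap.snd ℝ Base (ℝ × ℝ))) ((0, 1, w.2.2), (b, c))
    simp only [ContinuousLinearMap.comp_apply, ContinuousLinearMap.coe_fst',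
      ContinuousLinearMap.coe_snd'] at h2
    rw [h2, fderiv_base_apply (fderiv ℝ (fun y => fderiv ℝ υ y (1, 0, 0)) w.1),
      fderiv_base_apply (fderiv ℝ (fun y => fderiv ℝ υ y (0, 0, 1)) w.1) (0, 1, w.2.2),
      fderiv_fderiv_apply_comm hυ (1, 0, 0) (0, 0, 1), mixedTotal]
    congr 1
    ring
  have e4 : totalT (cUx (pointJet T X υ)) w a b = mixedTotal υ w b / deriv X w.1.2.1 := by
    have hd : DifferentiableAt ℝ (fun y : Base => deriv X y.2.1) w.1 :=
      DifferentiableAt.comp (f := fun y : Base => y.2.1) w.1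
        (hX.deriv_smooth.differentiableAt (by simp)) (by fun_prop)
    have := fderiv_div_apply_of_eq_zero (w := w) (v := ((1, 0, w.2.1), (a, b)))
      (n := fun y : Jet => fderiv ℝ υ y.1 (0, 1, 0) + y.2.2 * fderiv ℝ υ y.1 (0, 0, 1))
      (d := fun y : Jet => deriv X y.1.2.1)
      ((dυ' _).add (DifferentiableAt.mul (by fun_prop) (dυ' _)))
      (DifferentiableAt.comp (f := fun y : Jet => y.1) w hd differentiableAt_fst) hX0 (by
        rw [fderiv_comp_fst (g := fun y : Base => deriv X y.2.1) hd,
          fderiv_comp_x (hX.deriv_smooth.differentiableAt (by simp))]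
        simp)
    refine this.trans ?_
    have h2 := hn (0, 1, 0) ((ContinuousLinearMap.snd ℝ ℝ ℝ).comp
      (ContinuousLinearMap.snd ℝ Base (ℝ × ℝ))) ((1, 0, w.2.1), (a, b))
    simp only [ContinuousLinearMap.comp_apply, ContinuousLinearMap.coe_snd'] at h2
    rw [h2, fderiv_base_apply (fderiv ℝ (fun y => fderiv ℝ υ y (0, 1, 0)) w.1),
      fderiv_base_apply (fderiv ℝ (fun y => fderiv ℝ υ y (0, 0, 1)) w.1) (1, 0, w.2.1),
      fderiv_fderiv_apply_comm hυ (0, 1, 0) (0, 0, 1),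
      fderiv_fderiv_apply_comm hυ (0, 1, 0) (1, 0, 0), mixedTotal]
    congr 1
    ring
  unfold totalDet
  rw [e3, e4]
  simp only [totalT, totalX, e1, e2]
  constructor <;> field_simp <;> ring

theorem mapsEquation_pointJet (hT : ContDiffAt ℝ ∞ T w.1.1) (hX : ContDiffAt ℝ ∞ X w.1.2.1)
    (hυ : ContDiffAt ℝ ∞ υ w.1) (hT0 : deriv T w.1.1 ≠ 0) (hX0 : deriv X w.1.2.1 ≠ 0)
    {f f' : Base → ℝ} : MapsEquation (pointJet T X υ) {w} f f' ↔ ∀ b, b = f w.1 ↔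
      mixedTotal υ w b = f' (T w.1.1, X w.1.2.1, υ w.1) * (deriv T w.1.1 * deriv X w.1.2.1) := by
  have h := totalDet_pointJet hT hX hυ hT0 hX0
  simp only [MapsEquation, mem_singleton_iff, forall_eq, (h _ _ _).1, (h _ _ _).2,
    totalDet_pointJet_base (hT.differentiableAt (by simp)) (hX.differentiableAt (by simp)),
    and_self, ne_eq, mul_eq_zero, hT0, hX0, or_self, not_false_eq_true, forall_const]
  rfl

end PointJet

/-! ### Prolongations of transformations of the displayed form -/

section

variable {I J : Set ℝ} {T X : ℝ → ℝ} {U₀ : ℝ × ℝ → ℝ} {C : ℝ} {w : Jet}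

theorem IsParameter.prolong_eventuallyEq (hp : IsParameter I J T X U₀ C) (ht : w.1.1 ∈ I)
    (hx : w.1.2.1 ∈ J) {φ : Base → Base} (e : φ =ᶠ[𝓝 w.1] formBase T X U₀ C) :
    prolong φ =ᶠ[𝓝 w] pointJet T X (fun z => C * z.2.2 + U₀ (z.1, z.2.1)) := by
  filter_upwards [continuous_fst.continuousAt.eventually e.eventuallyEq_nhds,
    continuous_fst.continuousAt.eventually (hp.mem_nhds ht hx)] with w' e' hw'
  exact prolong_eq_pointJet e' ((hp.contDiffAt_T hw'.1).differentiableAt (by simp))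
    ((hp.contDiffAt_X hw'.2).differentiableAt (by simp)) (hp.deriv_T _ hw'.1) (hp.deriv_X _ hw'.2)

theorem NearForm.contactCondition_prolong {φ : Base → Base} (h : NearForm φ w.1) :
    ContactCondition (prolong φ) {w} := by
  obtain ⟨I, J, T, X, U₀, C, hp, ht, hx, e⟩ := h
  exact contactCondition_congr (hp.prolong_eventuallyEq ht hx e) (contactCondition_pointJet
    ((hp.contDiffAt_T ht).differentiableAt (by simp))
    ((hp.contDiffAt_X hx).differentiableAt (by simp))
    ((hp.contDiffAt_formBase ht hx).comp_U.differentiableAt (by simp))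
    (hp.deriv_T _ ht) (hp.deriv_X _ hx))

theorem BaseForm.contactCondition_prolong {φ : Base → Base} (h : BaseForm φ w.1) :
    ContactCondition (prolong φ) {w} := by
  rcases h with h | h
  · exact h.contactCondition_prolong
  · have := h.contactCondition_prolong.swap
    rwa [prolong_swapBase_comp] at this

/-- The prolongation of a map of the displayed form maps `u_tx = f` to an equation of the class at a
jet if and only if the value of the right-hand side is that of the extension to `f`. -/
theorem NearForm.mapsEquation_prolong {φ : Base → Base} (h : NearForm φ w.1) {f f' : Base → ℝ} :
    MapsEquation (prolong φ) {w} f f' ↔ liftMap φ (w.1, f w.1) = (φ w.1, f' (φ w.1)) := by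
  obtain ⟨I, J, T, X, U₀, C, hp, ht, hx, e⟩ := h
  have sυ : ContDiffAt ℝ ∞ (fun z : Base => C * z.2.2 + U₀ (z.1, z.2.1)) w.1 :=
    (hp.contDiffAt_formBase ht hx).comp_U
  rw [mapsEquation_congr (hp.prolong_eventuallyEq ht hx e), mapsEquation_pointJet
    (hp.contDiffAt_T ht) (hp.contDiffAt_X hx) sυ
    (hp.deriv_T _ ht) (hp.deriv_X _ hx), liftMap_congr e, e.self_of_nhds,
    ← hp.factorTX_formBase ht hx]
  have hd := hp.formDeriv ht hx
  have h1 := hd.U_u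
  have h2 : factorTX (formBase T X U₀ C) w.1 ≠ 0 := by
    rw [hp.factorTX_formBase ht hx]
    exact mul_ne_zero (hp.deriv_T _ ht) (hp.deriv_X _ hx)
  have hm : ∀ b, mixedTotal (fun z => C * z.2.2 + U₀ (z.1, z.2.1)) w b =
      derivU (formBase T X U₀ C) w.1 * b + derivTX (formBase T X U₀ C) w.1 := by
    intro b
    have h3 : ∀ v, fderiv ℝ (fun y => fderiv ℝ (fun z : Base => C * z.2.2 + U₀ (z.1, z.2.1)) y
      (0, 0, 1)) w.1 v = 0 := hd.U_uv
    simp only [mixedTotal, h3]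
    simp only [derivU, derivTX, formBase]
    ring
  have h3 : derivU (formBase T X U₀ C) w.1 ≠ 0 := h1
  simp only [hm]
  show (∀ b, b = f w.1 ↔ _ = f' (formBase T X U₀ C w.1) * _) ↔ _
  simp only [liftMap, Prod.mk.injEq, true_and, div_eq_iff h2]
  refine ⟨fun H => (H _).1 rfl, fun H b => ?_⟩
  rw [← H, add_left_inj, mul_right_inj' h3]

theorem BaseForm.mapsEquation_prolong {φ : Base → Base} (h : BaseForm φ w.1) {f f' : Base → ℝ} :
    MapsEquation (prolong φ) {w} f f' ↔ liftMap φ (w.1, f w.1) = (φ w.1, f' (φ w.1)) := by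
  rcases h with h | h
  · exact h.mapsEquation_prolong
  · have h1 := h.mapsEquation_prolong (f := f) (f' := f' ∘ swapBase)
    rw [prolong_swapBase_comp, mapsEquation_swap, liftMap_swapBase_comp] at h1
    refine h1.trans ⟨fun H => ?_, fun H => ?_⟩
    · exact congrArg swapMap H
    · exact congrArg swapMap H

/-- The prolongation of a map of the displayed form is smooth, with a smooth local left inverse. -/
theorem NearForm.prolong_smooth {φ : Base → Base} (h : NearForm φ w.1) :
    ContDiffAt ℝ ∞ (prolong φ) w ∧ ∃ g : Jet → Jet, ContDiffAt ℝ ∞ g (prolong φ w) ∧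
      ∀ᶠ y in 𝓝 w, g (prolong φ y) = y := by
  obtain ⟨I, J, T, X, U₀, C, hp, ht, hx, e⟩ := h
  have e' := hp.prolong_eventuallyEq ht hx e
  set υ : Base → ℝ := fun z => C * z.2.2 + U₀ (z.1, z.2.1) with hυ
  have sυ : ContDiffAt ℝ ∞ υ w.1 := (hp.contDiffAt_formBase ht hx).comp_U
  have hsm : ContDiffAt ℝ ∞ (pointJet T X υ) w :=
    contDiffAt_pointJet (hp.contDiffAt_T ht) (hp.contDiffAt_X hx) sυ
      (hp.deriv_T _ ht) (hp.deriv_X _ hx)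
  refine ⟨hsm.congr_of_eventuallyEq e', ?_⟩
  obtain ⟨I', J', χ, hq, ht', hx', -, -, hχs, hχ⟩ := hp.exists_homeo ht hx
  have hw : w.1 ∈ χ.source := by rw [hχs]; exact ⟨ht', hx'⟩
  have hform : BaseForm χ w.1 :=
    Or.inl ⟨I', J', T, X, U₀, C, hq, ht', hx', .of_forall hχ⟩
  have hinv : ContDiffAt ℝ ∞ χ.symm (χ w.1) := (hform.symm hw).contDiffAt
  have hχw : (pointJet T X υ w).1 = χ w.1 := (hχ w.1).symm
  have cz : ContDiffAt ℝ ∞ (fun y : Jet => χ.symm y.1) (pointJet T X υ w) :=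
    ContDiffAt.comp (f := fun y : Jet => y.1) _ (by rw [hχw]; exact hinv) contDiffAt_fst
  have hz : χ.symm (pointJet T X υ w).1 = w.1 := by rw [hχw, χ.left_inv hw]
  have lift : ∀ {g : Base → ℝ}, ContDiffAt ℝ ∞ g w.1 →
      ContDiffAt ℝ ∞ (fun y : Jet => g (χ.symm y.1)) (pointJet T X υ w) := fun {g} hg =>
    ContDiffAt.comp (g := g) (f := fun y : Jet => χ.symm y.1) _ (by rw [hz]; exact hg) cz
  have hu : ∀ y : Base, y.1 ∈ I → y.2.1 ∈ J → fderiv ℝ υ y (0, 0, 1) ≠ 0 := fun y h1 h2 =>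
    (hp.formDeriv h1 h2).U_u
  refine ⟨fun y => (χ.symm y.1,
    ((y.2.1 * deriv T (χ.symm y.1).1 - fderiv ℝ υ (χ.symm y.1) (1, 0, 0)) /
        fderiv ℝ υ (χ.symm y.1) (0, 0, 1),
      (y.2.2 * deriv X (χ.symm y.1).2.1 - fderiv ℝ υ (χ.symm y.1) (0, 1, 0)) /
        fderiv ℝ υ (χ.symm y.1) (0, 0, 1))), ?_, ?_⟩
  · rw [e'.self_of_nhds]
    have s1 : ContDiffAt ℝ ∞ (fun z : Base => deriv T z.1) w.1 :=
      ContDiffAt.comp (f := fun z : Base => z.1) _ (hp.contDiffAt_T ht).deriv_smooth contDiffAt_fst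
    have s2 : ContDiffAt ℝ ∞ (fun z : Base => deriv X z.2.1) w.1 :=
      ContDiffAt.comp (f := fun z : Base => z.2.1) _ (hp.contDiffAt_X hx).deriv_smooth
        (by fun_prop)
    have hne : fderiv ℝ υ (χ.symm (pointJet T X υ w).1) (0, 0, 1) ≠ 0 := by
      rw [hz]; exact hu _ ht hx
    exact cz.prodMk (ContDiffAt.prodMk
      (ContDiffAt.div ((ContDiffAt.mul (by fun_prop) (lift s1)).sub
        (lift (sυ.fderiv_apply_const _))) (lift (sυ.fderiv_apply_const _)) hne)
      (ContDiffAt.div ((ContDiffAt.mul (by fun_prop) (lift s2)).sub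
        (lift (sυ.fderiv_apply_const _))) (lift (sυ.fderiv_apply_const _)) hne))
  · filter_upwards [e', continuous_fst.continuousAt.eventually (χ.eventually_left_inverse hw),
      continuous_fst.continuousAt.eventually (hp.mem_nhds ht hx)] with y h1 h2 h3
    have h4 : χ.symm (pointJet T X υ y).1 = y.1 := by
      rw [← h2, hχ]; rfl
    have d1 := hp.deriv_T _ h3.1
    have d2 := hp.deriv_X _ h3.2
    have d3 := hu _ h3.1 h3.2
    rw [h1]
    simp only [h4]
    refine Prod.ext rfl (Prod.ext ?_ ?_)
    · simp only [pointJet]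
      field_simp
      ring
    · simp only [pointJet]
      field_simp
      ring

theorem BaseForm.prolong_smooth {φ : Base → Base} (h : BaseForm φ w.1) :
    ContDiffAt ℝ ∞ (prolong φ) w ∧ ∃ g : Jet → Jet, ContDiffAt ℝ ∞ g (prolong φ w) ∧
      ∀ᶠ y in 𝓝 w, g (prolong φ y) = y := by
  rcases h with h | h
  · exact h.prolong_smooth
  · obtain ⟨h1, g, h2, h3⟩ := h.prolong_smooth
    rw [prolong_swapBase_comp] at h1 h2 h3
    exact ⟨contDiff_swapJet.contDiffAt.comp w h1, g ∘ swapJet,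
      h2.comp (prolong φ w) contDiff_swapJet.contDiffAt, h3⟩

end

/-- The inverse of a local homeomorphism is smooth if there is a smooth local left inverse. -/
theorem contDiffAt_symm_of_leftInverse {E : Type*} [NormedAddCommGroup E] [NormedSpace ℝ E]
    {Φ : OpenPartialHomeomorph E E} {w : E} (hw : w ∈ Φ.source) {g : E → E}
    (hg : ContDiffAt ℝ ∞ g (Φ w)) (h : ∀ᶠ y in 𝓝 w, g (Φ y) = y) :
    ContDiffAt ℝ ∞ Φ.symm (Φ w) := by
  refine hg.congr_of_eventuallyEq ?_
  have ht := Φ.symm.continuousAt (Φ.map_source hw)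
  have ht' : Tendsto Φ.symm (𝓝 (Φ w)) (𝓝 w) := by
    have := ht.tendsto
    rwa [Φ.left_inv hw] at this
  filter_upwards [ht'.eventually h, Φ.open_target.mem_nhds (Φ.map_source hw)] with y h1 h2
  rw [Φ.right_inv h2] at h1
  exact h1.symm

/-- A map of the displayed form coincides near a point with a transformation of the base that is of
this form everywhere. -/
theorem BaseForm.exists_homeo {φ : Base → Base} {z : Base} (h : BaseForm φ z) :
    ∃ χ : OpenPartialHomeomorph Base Base, z ∈ χ.source ∧ (∀ y ∈ χ.source, BaseForm χ y) ∧
      φ =ᶠ[𝓝 z] χ := by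
  have key : ∀ {φ : Base → Base}, NearForm φ z →
      ∃ χ : OpenPartialHomeomorph Base Base, z ∈ χ.source ∧ (∀ y ∈ χ.source, NearForm χ y) ∧
        φ =ᶠ[𝓝 z] χ := by
    rintro φ ⟨I, J, T, X, U₀, C, hp, ht, hx, e⟩
    obtain ⟨I', J', χ, hq, ht', hx', -, -, hχs, hχ⟩ := hp.exists_homeo ht hx
    refine ⟨χ, by rw [hχs]; exact ⟨ht', hx'⟩, fun y hy => ?_, ?_⟩
    · rw [hχs] at hy
      exact ⟨I', J', T, X, U₀, C, hq, hy.1, hy.2, .of_forall hχ⟩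
    · filter_upwards [e] with y hy
      rw [hy, hχ]
  rcases h with h | h
  · obtain ⟨χ, h1, h2, h3⟩ := key h
    exact ⟨χ, h1, fun y hy => Or.inl (h2 y hy), h3⟩
  · obtain ⟨χ, h1, h2, h3⟩ := key h
    let s : Base ≃ₜ Base := ⟨⟨swapBase, swapBase, swapBase_swapBase, swapBase_swapBase⟩,
      continuous_swapBase, continuous_swapBase⟩
    refine ⟨χ.transHomeomorph s, h1, fun y hy => Or.inr (h2 y hy), ?_⟩
    filter_upwards [h3] with y hy
    exact congrArg swapBase hy

/-! ### The contact form -/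

/-- The factor `U_u - U^t T_u - U^x X_u` by which a contact transformation multiplies the contact
form. -/
noncomputable def contactFactor (Φ : Jet → Jet) (w : Jet) : ℝ :=
  fderiv ℝ (cU Φ) w ((0, 0, 1), (0, 0)) - cUt Φ w * fderiv ℝ (cT Φ) w ((0, 0, 1), (0, 0))
    - cUx Φ w * fderiv ℝ (cX Φ) w ((0, 0, 1), (0, 0))

/-- The contact form `du - u_t dt - u_x dx` at the jet `w`, evaluated at `v`. -/
def contactForm (w v : Jet) : ℝ := v.1.2.2 - w.2.1 * v.1.1 - w.2.2 * v.1.2.1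

theorem fderiv_jet_apply (L : Jet →L[ℝ] ℝ) (v : Jet) :
    L v = v.1.1 * L ((1, 0, 0), (0, 0)) + v.1.2.1 * L ((0, 1, 0), (0, 0))
      + v.1.2.2 * L ((0, 0, 1), (0, 0)) + v.2.1 * L ((0, 0, 0), (1, 0))
      + v.2.2 * L ((0, 0, 0), (0, 1)) := by
  simp only [← smul_eq_mul, ← map_smul, ← map_add]
  simp [show ((0, 0, 0) : Base) = 0 from rfl]

section Contact

variable {Φ : Jet → Jet} {w : Jet}

theorem _root_.ContDiffAt.cT (h : ContDiffAt ℝ ∞ Φ w) : ContDiffAt ℝ ∞ (cT Φ) w :=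
  h.fst.fst

theorem _root_.ContDiffAt.cX (h : ContDiffAt ℝ ∞ Φ w) : ContDiffAt ℝ ∞ (cX Φ) w :=
  h.fst.snd.fst

theorem _root_.ContDiffAt.cU (h : ContDiffAt ℝ ∞ Φ w) : ContDiffAt ℝ ∞ (cU Φ) w :=
  h.fst.snd.snd

theorem _root_.ContDiffAt.cUt (h : ContDiffAt ℝ ∞ Φ w) : ContDiffAt ℝ ∞ (cUt Φ) w :=
  h.snd.fst

theorem _root_.ContDiffAt.cUx (h : ContDiffAt ℝ ∞ Φ w) : ContDiffAt ℝ ∞ (cUx Φ) w :=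
  h.snd.snd

/-- A map that satisfies the contact condition multiplies the contact form by `contactFactor`. -/
theorem ContactCondition.pullback (h : ContactCondition Φ {w}) (v : Jet) :
    fderiv ℝ (cU Φ) w v - cUt Φ w * fderiv ℝ (cT Φ) w v - cUx Φ w * fderiv ℝ (cX Φ) w v =
      contactFactor Φ w * contactForm w v := by
  set ζ : Jet →L[ℝ] ℝ := fderiv ℝ (cU Φ) w - cUt Φ w • fderiv ℝ (cT Φ) w
    - cUx Φ w • fderiv ℝ (cX Φ) w with hζ
  have hz : ∀ v, fderiv ℝ (cU Φ) w v - cUt Φ w * fderiv ℝ (cT Φ) w v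
      - cUx Φ w * fderiv ℝ (cX Φ) w v = ζ v := fun v => by simp [hζ]
  have h1 : ∀ a b, ζ ((1, 0, w.2.1), (a, b)) = 0 := by
    intro a b
    have := (h w rfl a b 0).1
    simp only [totalT] at this
    rw [← hz]; linear_combination -this
  have h2 : ∀ b c, ζ ((0, 1, w.2.2), (b, c)) = 0 := by
    intro b c
    have := (h w rfl 0 b c).2
    simp only [totalX] at this
    rw [← hz]; linear_combination -this
  rw [hz, contactFactor, hz, fderiv_jet_apply]
  have e0 := h1 0 0
  have e1 := h1 1 0
  have e2 := h1 0 1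
  have e3 := h2 0 0
  rw [fderiv_jet_apply] at e0 e1 e2 e3
  simp only at e0 e1 e2 e3
  simp only [contactForm]
  linear_combination v.1.1 * e0 + v.1.2.1 * e3 + v.2.1 * (e1 - e0) + v.2.2 * (e2 - e0)

theorem fderiv_contactForm (v v' : Jet) :
    DifferentiableAt ℝ (fun y => contactForm y v) w ∧
      fderiv ℝ (fun y => contactForm y v) w v' = -v'.2.1 * v.1.1 - v'.2.2 * v.1.2.1 := by
  have h1 : HasFDerivAt (fun y : Jet => y.2.1)
      ((ContinuousLinearMap.fst ℝ ℝ ℝ).comp (ContinuousLinearMap.snd ℝ Base (ℝ × ℝ))) w :=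
    ((ContinuousLinearMap.fst ℝ ℝ ℝ).comp (ContinuousLinearMap.snd ℝ Base (ℝ × ℝ))).hasFDerivAt
  have h2 : HasFDerivAt (fun y : Jet => y.2.2)
      ((ContinuousLinearMap.snd ℝ ℝ ℝ).comp (ContinuousLinearMap.snd ℝ Base (ℝ × ℝ))) w :=
    ((ContinuousLinearMap.snd ℝ ℝ ℝ).comp (ContinuousLinearMap.snd ℝ Base (ℝ × ℝ))).hasFDerivAt
  have h3 : HasFDerivAt (fun y => contactForm y v) _ w :=
    ((hasFDerivAt_const v.1.2.2 w).sub (h1.mul_const v.1.1)).sub (h2.mul_const v.1.2.1)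
  refine ⟨h3.differentiableAt, ?_⟩
  rw [h3.fderiv]
  simp
  ring

/-- A contact transformation is conformally symplectic on the contact planes. -/
theorem ContactCondition.conformal {W : Set Jet} (hW : IsOpen W)
    (hs : ∀ y ∈ W, ContDiffAt ℝ ∞ Φ y) (h : ContactCondition Φ W) (hw : w ∈ W) {v v' : Jet}
    (hv : contactForm w v = 0) (hv' : contactForm w v' = 0) :
    fderiv ℝ (cT Φ) w v * fderiv ℝ (cUt Φ) w v' - fderiv ℝ (cT Φ) w v' * fderiv ℝ (cUt Φ) w v
      + (fderiv ℝ (cX Φ) w v * fderiv ℝ (cUx Φ) w v'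
        - fderiv ℝ (cX Φ) w v' * fderiv ℝ (cUx Φ) w v) =
      contactFactor Φ w * (v.1.1 * v'.2.1 - v'.1.1 * v.2.1 + (v.1.2.1 * v'.2.2
        - v'.1.2.1 * v.2.2)) := by
  have hsw := hs w hw
  have d : ∀ {F : Jet → ℝ}, ContDiffAt ℝ ∞ F w → DifferentiableAt ℝ F w := fun hF =>
    hF.differentiableAt (by simp)
  have hfac : ContDiffAt ℝ ∞ (contactFactor Φ) w :=
    ((hsw.cU.fderiv_apply_const _).sub (hsw.cUt.mul (hsw.cT.fderiv_apply_const _))).sub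
      (hsw.cUx.mul (hsw.cX.fderiv_apply_const _))
  -- the derivative in the direction `e'` of the identity of `pullback` at the constant vector `e`
  have key : ∀ e e' : Jet, contactForm w e = 0 →
      fderiv ℝ (fun y => fderiv ℝ (cU Φ) y e) w e'
        - (cUt Φ w * fderiv ℝ (fun y => fderiv ℝ (cT Φ) y e) w e'
          + fderiv ℝ (cT Φ) w e * fderiv ℝ (cUt Φ) w e')
        - (cUx Φ w * fderiv ℝ (fun y => fderiv ℝ (cX Φ) y e) w e'
          + fderiv ℝ (cX Φ) w e * fderiv ℝ (cUx Φ) w e') =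
        contactFactor Φ w * (-e'.2.1 * e.1.1 - e'.2.2 * e.1.2.1) := by
    intro e e' he
    have heq : (fun y => fderiv ℝ (cU Φ) y e - cUt Φ y * fderiv ℝ (cT Φ) y e
        - cUx Φ y * fderiv ℝ (cX Φ) y e) =ᶠ[𝓝 w] fun y => contactFactor Φ y * contactForm y e := by
      filter_upwards [hW.mem_nhds hw] with y hy
      exact ContactCondition.pullback (fun _ hz => hz ▸ h y hy) e
    have e1 := ((d (hsw.cU.fderiv_apply_const e)).hasFDerivAt.sub
      ((d hsw.cUt).hasFDerivAt.mul (d (hsw.cT.fderiv_apply_const e)).hasFDerivAt)).sub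
      ((d hsw.cUx).hasFDerivAt.mul (d (hsw.cX.fderiv_apply_const e)).hasFDerivAt)
    have e2 := (d hfac).hasFDerivAt.mul (fderiv_contactForm (w := w) e e').1.hasFDerivAt
    have := DFunLike.congr_fun (e1.unique (e2.congr_of_eventuallyEq heq)) e'
    simp only [sub_apply, add_apply, smul_apply, smul_eq_mul, he, zero_mul, add_zero,
      (fderiv_contactForm (w := w) e e').2] at this
    exact this
  have k1 := key v v' hv
  have k2 := key v' v hv'
  rw [fderiv_fderiv_apply_comm hsw.cU, fderiv_fderiv_apply_comm hsw.cT,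
    fderiv_fderiv_apply_comm hsw.cX] at k1
  linear_combination k2 - k1

end Contact

/-! ### Characteristics -/

/-- The basis `D_t + r ∂_{u_x}, D_x + r ∂_{u_t}, ∂_{u_t}, ∂_{u_x}` of the contact plane at `w`. -/
def charBasis (w : Jet) (r : ℝ) : Fin 4 → Jet :=
  ![((1, 0, w.2.1), (0, r)), ((0, 1, w.2.2), (r, 0)), ((0, 0, 0), (1, 0)), ((0, 0, 0), (0, 1))]

theorem ContactCondition.conformal_charBasis {Φ : Jet → Jet} {w : Jet} {W : Set Jet}
    (hW : IsOpen W) (hs : ∀ y ∈ W, ContDiffAt ℝ ∞ Φ y) (h : ContactCondition Φ W) (hw : w ∈ W)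
    (r : ℝ) : Conformal (fun i => fderiv ℝ (cT Φ) w (charBasis w r i))
      (fun i => fderiv ℝ (cX Φ) w (charBasis w r i))
      (fun i => fderiv ℝ (cUt Φ) w (charBasis w r i))
      (fun i => fderiv ℝ (cUx Φ) w (charBasis w r i)) (contactFactor Φ w) := by
  have h0 : ∀ i, contactForm w (charBasis w r i) = 0 := by
    intro i; fin_cases i <;> simp [contactForm, charBasis]
  constructor <;> refine (h.conformal hW hs hw (h0 _) (h0 _)).trans ?_ <;> simp [charBasis]

theorem totalDet_eq_det₂ (F G : Jet → ℝ) (w : Jet) (a r c : ℝ) :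
    totalDet F G w a r c = det₂ (fun i => fderiv ℝ F w (charBasis w r i))
      (fun i => fderiv ℝ G w (charBasis w r i)) a c := by
  have h1 : ∀ F : Jet → ℝ, totalT F w a r =
      fderiv ℝ F w (charBasis w r 0) + a * fderiv ℝ F w (charBasis w r 2) := by
    intro F
    rw [← smul_eq_mul, ← map_smul, ← map_add]
    simp [charBasis, totalT]
  have h2 : ∀ F : Jet → ℝ, totalX F w r c =
      fderiv ℝ F w (charBasis w r 1) + c * fderiv ℝ F w (charBasis w r 3) := by
    intro F
    rw [← smul_eq_mul, ← map_smul, ← map_add]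
    simp [charBasis, totalX]
  simp only [totalDet, det₂, h1, h2]

/-- The differentials of `T` and `X` are annihilated by the characteristic planes `dx = 0` and
`dt = 0` of the equation `u_tx = f` at `w`, respectively. -/
def PreservesChar (Φ : Jet → Jet) (w : Jet) (r : ℝ) : Prop :=
  fderiv ℝ (cT Φ) w (charBasis w r 1) = 0 ∧ fderiv ℝ (cT Φ) w (charBasis w r 3) = 0 ∧
    fderiv ℝ (cX Φ) w (charBasis w r 0) = 0 ∧ fderiv ℝ (cX Φ) w (charBasis w r 2) = 0

section

variable {Φ : Jet → Jet} {w : Jet} {W : Set Jet} {f f' : Base → ℝ}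

theorem preservesChar_cases (hW : IsOpen W) (hs : ∀ y ∈ W, ContDiffAt ℝ ∞ Φ y)
    (h : ContactCondition Φ W) (hw : w ∈ W) (hl : contactFactor Φ w ≠ 0)
    (hm : MapsEquation Φ W f f') :
    PreservesChar Φ w (f w.1) ∨ PreservesChar (swapJet ∘ Φ) w (f w.1) := by
  have H := (h.conformal_charBasis hW hs hw (f w.1)).characteristic_cases hl (f' (Φ w).1)
    fun a c hac => by
      rw [← totalDet_eq_det₂] at hac
      have := (hm w hw a (f w.1) c hac).1 rfl
      simpa only [totalDet_eq_det₂] using this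
  rcases H with ⟨h1, h2, h3, h4⟩ | ⟨h1, h2, h3, h4⟩
  · exact Or.inl ⟨h1, h2, h3, h4⟩
  · exact Or.inr ⟨h3, h4, h1, h2⟩

theorem not_preservesChar_and (hW : IsOpen W) (hs : ∀ y ∈ W, ContDiffAt ℝ ∞ Φ y)
    (h : ContactCondition Φ W) (hw : w ∈ W) (hl : contactFactor Φ w ≠ 0) (r : ℝ)
    (h1 : PreservesChar Φ w r) (h2 : PreservesChar (swapJet ∘ Φ) w r) : False := by
  have hc := (h.conformal_charBasis hW hs hw r).h13
  obtain ⟨-, -, k3, k4⟩ := h1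
  have k1 : fderiv ℝ (cT Φ) w (charBasis w r 0) = 0 := h2.2.2.1
  have k2 : fderiv ℝ (cT Φ) w (charBasis w r 2) = 0 := h2.2.2.2
  rw [k1, k2, k3, k4] at hc
  exact hl (by linarith)

theorem continuousAt_charBasis {F : Jet → ℝ} (hF : ContDiffAt ℝ ∞ F w) (hf : ContinuousAt f w.1)
    (i : Fin 4) : ContinuousAt (fun y => fderiv ℝ F y (charBasis y (f y.1) i)) w := by
  have hf' : ContinuousAt (fun y : Jet => f y.1) w :=
    ContinuousAt.comp (f := fun y : Jet => y.1) hf continuousAt_fst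
  have hd : ContinuousAt (fderiv ℝ F) w :=
    (hF.fderiv_right (m := ∞) (by norm_cast)).continuousAt
  refine hd.clm_apply ?_
  have c1 : ContinuousAt (fun y : Jet => y.2.1) w := by fun_prop
  have c2 : ContinuousAt (fun y : Jet => y.2.2) w := by fun_prop
  fin_cases i
  · exact (continuousAt_const.prodMk (continuousAt_const.prodMk c1)).prodMk
      (continuousAt_const.prodMk hf')
  · exact (continuousAt_const.prodMk (continuousAt_const.prodMk c2)).prodMk
      (hf'.prodMk continuousAt_const)
  · exact continuousAt_const
  · exact continuousAt_const

theorem isClosed_preservesChar (hs : ContDiffAt ℝ ∞ Φ w) (hf : ContinuousAt f w.1)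
    (h : ¬ PreservesChar Φ w (f w.1)) : ∀ᶠ y in 𝓝 w, ¬ PreservesChar Φ y (f y.1) := by
  simp only [PreservesChar, not_and_or] at h ⊢
  rcases h with h | h | h | h
  · filter_upwards [(continuousAt_charBasis hs.cT hf 1).eventually_ne h] with y hy
    exact Or.inl hy
  · filter_upwards [(continuousAt_charBasis hs.cT hf 3).eventually_ne h] with y hy
    exact Or.inr (Or.inl hy)
  · filter_upwards [(continuousAt_charBasis hs.cX hf 0).eventually_ne h] with y hy
    exact Or.inr (Or.inr (Or.inl hy))
  · filter_upwards [(continuousAt_charBasis hs.cX hf 2).eventually_ne h] with y hy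
    exact Or.inr (Or.inr (Or.inr hy))

theorem preservesChar_eventually (hW : IsOpen W) (hs : ∀ y ∈ W, ContDiffAt ℝ ∞ Φ y)
    (h : ContactCondition Φ W) (hw : w ∈ W) (hl : ∀ y ∈ W, contactFactor Φ y ≠ 0)
    (hm : MapsEquation Φ W f f') (hf : ContinuousAt f w.1) :
    (∀ᶠ y in 𝓝 w, PreservesChar Φ y (f y.1)) ∨
      ∀ᶠ y in 𝓝 w, PreservesChar (swapJet ∘ Φ) y (f y.1) := by
  have hcases : ∀ᶠ y in 𝓝 w, PreservesChar Φ y (f y.1) ∨ PreservesChar (swapJet ∘ Φ) y (f y.1) := by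
    filter_upwards [hW.mem_nhds hw] with y hy
    exact preservesChar_cases hW hs h hy (hl y hy) hm
  have hs' : ContDiffAt ℝ ∞ (swapJet ∘ Φ) w := contDiff_swapJet.contDiffAt.comp w (hs w hw)
  rcases hcases.self_of_nhds with h1 | h1
  · have h2 : ¬ PreservesChar (swapJet ∘ Φ) w (f w.1) := fun h2 =>
      not_preservesChar_and hW hs h hw (hl w hw) _ h1 h2
    left
    filter_upwards [hcases, isClosed_preservesChar hs' hf h2] with y hy hy'
    exact hy.resolve_right hy'
  · have h2 : ¬ PreservesChar Φ w (f w.1) := fun h2 =>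
      not_preservesChar_and hW hs h hw (hl w hw) _ h2 h1
    right
    filter_upwards [hcases, isClosed_preservesChar (hs w hw) hf h2] with y hy hy'
    exact hy.resolve_left hy'

end

/-! ### Integrals of the characteristic distributions -/

/-- The derivative `f_u` vanishes on no nonempty open part of the domain. -/
theorem Equation.exists_fderiv_u_ne_zero (E : Equation) {V : Set Base} (hV : IsOpen V)
    (hsub : V ⊆ E.dom) (hne : V.Nonempty) : ∃ z ∈ V, fderiv ℝ E.f z (0, 0, 1) ≠ 0 := by
  by_contra! H
  obtain ⟨z, hz, hz'⟩ := E.nonaffine V hsub hV hne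
  refine hz' ?_
  have hcont : Continuous fun s : ℝ => (z.1, z.2.1, s) := by fun_prop
  have hev : ∀ᶠ s in 𝓝 z.2.2, (z.1, z.2.1, s) ∈ V :=
    hcont.continuousAt.preimage_mem_nhds (hV.mem_nhds hz)
  have : deriv (fun s => E.f (z.1, z.2.1, s)) =ᶠ[𝓝 z.2.2] fun _ => 0 := by
    filter_upwards [hev] with s hs
    have hd : DifferentiableAt ℝ E.f (z.1, z.2.1, s) :=
      (E.smooth.contDiffAt (E.isOpen_dom.mem_nhds (hsub hs))).differentiableAt (by simp)
    have h1 := hd.hasFDerivAt.comp_hasDerivAt (f := fun s : ℝ => (z.1, z.2.1, s)) s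
      ((hasDerivAt_const s z.1).prodMk ((hasDerivAt_const s z.2.1).prodMk (hasDerivAt_id s)))
    exact h1.deriv.trans (H _ hs)
  rw [secondU, iteratedDeriv_succ, iteratedDeriv_one, this.deriv_eq]
  simp

/-- The only functions annihilated by a characteristic plane field of an equation of the class are
those annihilated by its second derived flag. The plane field is spanned by `n` and by
`a + σ ∂_u + f m`, where `σ` is the linear function `u_t` or `u_x` with `σ n = 1`; bracketing with
`n` gives `∂_u`, then bracketing with `∂_u` gives `m`, since `f_u ≠ 0` on a dense set. -/
theorem fderiv_eq_zero_of_characteristic (E : Equation) {W : Set Jet} (hW : IsOpen W)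
    (hsub : ∀ w ∈ W, w.1 ∈ E.dom) {F : Jet → ℝ} (hF : ∀ w ∈ W, ContDiffAt ℝ ∞ F w)
    {a m n : Jet} {σ : Jet →L[ℝ] ℝ} (hn : n.1 = 0) (hσn : σ n = 1) (h1 : ∀ w ∈ W, fderiv ℝ F w n = 0)
    (h2 : ∀ w ∈ W, fderiv ℝ F w a + σ w * fderiv ℝ F w ((0, 0, 1), (0, 0))
      + E.f w.1 * fderiv ℝ F w m = 0) {w : Jet} (hw : w ∈ W) :
    fderiv ℝ F w ((0, 0, 1), (0, 0)) = 0 ∧ fderiv ℝ F w m = 0 ∧ fderiv ℝ F w a = 0 := by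
  have df : ∀ w ∈ W, DifferentiableAt ℝ E.f w.1 := fun w hw =>
    (E.smooth.contDiffAt (E.isOpen_dom.mem_nhds (hsub w hw))).differentiableAt (by simp)
  have df' : ∀ w ∈ W, DifferentiableAt ℝ (fun y : Jet => E.f y.1) w := fun w hw =>
    DifferentiableAt.comp (f := fun y : Jet => y.1) w (df w hw) differentiableAt_fst
  have dF : ∀ v, ∀ w ∈ W, DifferentiableAt ℝ (fun y => fderiv ℝ F y v) w := fun v w hw =>
    ((hF w hw).fderiv_apply_const v).differentiableAt (by simp)
  have hu : ∀ w ∈ W, fderiv ℝ F w ((0, 0, 1), (0, 0)) = 0 := by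
    intro w hw
    have hz : (fun y => fderiv ℝ F y a + σ y * fderiv ℝ F y ((0, 0, 1), (0, 0))
        + E.f y.1 * fderiv ℝ F y m) =ᶠ[𝓝 w] fun _ => 0 := by
      filter_upwards [hW.mem_nhds hw] with y hy using h2 y hy
    have hd := ((dF a w hw).hasFDerivAt.add
      (σ.hasFDerivAt.mul (dF ((0, 0, 1), (0, 0)) w hw).hasFDerivAt)).add
      ((df' w hw).hasFDerivAt.mul (dF m w hw).hasFDerivAt)
    have := DFunLike.congr_fun (hd.unique ((hasFDerivAt_const 0 w).congr_of_eventuallyEq hz)) n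
    simp only [add_apply, smul_apply, smul_eq_mul, fderiv_comp_fst (df w hw), hn, map_zero, hσn,
      fderiv_fderiv_apply_eq_zero hW hF h1 hw] at this
    simpa using this
  have hm0 : ∀ w ∈ W, fderiv ℝ E.f w.1 (0, 0, 1) * fderiv ℝ F w m = 0 := by
    intro w hw
    have hz : (fun y => fderiv ℝ F y a + E.f y.1 * fderiv ℝ F y m) =ᶠ[𝓝 w] fun _ => 0 := by
      filter_upwards [hW.mem_nhds hw] with y hy
      have := h2 y hy
      rwa [hu y hy, mul_zero, add_zero] at this
    have hd := (dF a w hw).hasFDerivAt.add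
      ((df' w hw).hasFDerivAt.mul (dF m w hw).hasFDerivAt)
    have := DFunLike.congr_fun (hd.unique ((hasFDerivAt_const 0 w).congr_of_eventuallyEq hz))
      ((0, 0, 1), (0, 0))
    simp only [add_apply, smul_apply, smul_eq_mul, fderiv_comp_fst (df w hw),
      fderiv_fderiv_apply_eq_zero hW hF hu hw] at this
    simpa [mul_comm] using this
  have hm : ∀ w ∈ W, fderiv ℝ F w m = 0 := by
    intro w hw
    by_contra hne
    have hO : {y | y ∈ W ∧ fderiv ℝ F y m ≠ 0} ∈ 𝓝 w :=
      inter_mem (hW.mem_nhds hw) ((dF m w hw).continuousAt.eventually_ne hne)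
    obtain ⟨O, hO1, hO2, hO3⟩ := mem_nhds_iff.1 hO
    obtain ⟨_, ⟨y, hy, rfl⟩, hy'⟩ := E.exists_fderiv_u_ne_zero (isOpenMap_fst O hO2)
      (by rintro _ ⟨y, hy, rfl⟩; exact hsub y (hO1 hy).1) ⟨w.1, w, hO3, rfl⟩
    exact (mul_ne_zero hy' (hO1 hy).2) (hm0 y (hO1 hy).1)
  refine ⟨hu w hw, hm w hw, ?_⟩
  have := h2 w hw
  rwa [hu w hw, hm w hw, mul_zero, mul_zero, add_zero, add_zero] at this

/-! ### Local form of contact transformations -/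

section

variable {Φ : Jet → Jet} {w₀ : Jet} {f' : Base → ℝ}

/-- The components `T` and `X` of a contact transformation that preserves the characteristic
planes depend on `t` and on `x` only, respectively. -/
theorem PreservesChar.fderiv_eq_zero (E : Equation) {W : Set Jet} (hW : IsOpen W)
    (hsub : ∀ w ∈ W, w.1 ∈ E.dom) (hs : ∀ w ∈ W, ContDiffAt ℝ ∞ Φ w)
    (hc : ∀ w ∈ W, PreservesChar Φ w (E.f w.1)) {w : Jet} (hw : w ∈ W) :
    (∀ v : Jet, fderiv ℝ (cT Φ) w v = v.1.1 * fderiv ℝ (cT Φ) w ((1, 0, 0), (0, 0))) ∧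
      ∀ v : Jet, fderiv ℝ (cX Φ) w v = v.1.2.1 * fderiv ℝ (cX Φ) w ((0, 1, 0), (0, 0)) := by
  obtain ⟨h1, h2, h3⟩ := fderiv_eq_zero_of_characteristic E hW hsub (F := cT Φ)
    (a := ((0, 1, 0), (0, 0))) (m := ((0, 0, 0), (1, 0))) (n := ((0, 0, 0), (0, 1)))
    (σ := (ContinuousLinearMap.snd ℝ ℝ ℝ).comp (ContinuousLinearMap.snd ℝ Base (ℝ × ℝ)))
    (fun w hw => (hs w hw).cT) rfl rfl (fun w hw => (hc w hw).2.1) (fun w hw => by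
      have := (hc w hw).1
      rw [fderiv_jet_apply] at this
      simp only [charBasis, Matrix.cons_val_one, Matrix.cons_val_zero] at this
      simpa using this) hw
  obtain ⟨k1, k2, k3⟩ := fderiv_eq_zero_of_characteristic E hW hsub (F := cX Φ)
    (a := ((1, 0, 0), (0, 0))) (m := ((0, 0, 0), (0, 1))) (n := ((0, 0, 0), (1, 0)))
    (σ := (ContinuousLinearMap.fst ℝ ℝ ℝ).comp (ContinuousLinearMap.snd ℝ Base (ℝ × ℝ)))
    (fun w hw => (hs w hw).cX) rfl rfl (fun w hw => (hc w hw).2.2.2) (fun w hw => by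
      have := (hc w hw).2.2.1
      rw [fderiv_jet_apply] at this
      simp only [charBasis, Matrix.cons_val_zero] at this
      simpa using this) hw
  have h4 : fderiv ℝ (cT Φ) w ((0, 0, 0), (0, 1)) = 0 := (hc w hw).2.1
  have k4 : fderiv ℝ (cX Φ) w ((0, 0, 0), (1, 0)) = 0 := (hc w hw).2.2.2
  exact ⟨fun v => by rw [fderiv_jet_apply, h1, h2, h3, h4]; ring,
    fun v => by rw [fderiv_jet_apply, k1, k2, k3, k4]; ring⟩

/-- A contact transformation between equations of the class that preserves the characteristic planes
is locally the first prolongation of a transformation of the displayed form. -/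
theorem PreservesChar.exists_nearForm (E : Equation) {W : Set Jet} (hW : IsOpen W)
    (hsub : ∀ w ∈ W, w.1 ∈ E.dom) (hs : ∀ w ∈ W, ContDiffAt ℝ ∞ Φ w)
    (hcc : ContactCondition Φ W) (hl : ∀ w ∈ W, contactFactor Φ w ≠ 0)
    (hm : MapsEquation Φ W E.f f') (hw₀ : w₀ ∈ W)
    (hc : ∀ᶠ w in 𝓝 w₀, PreservesChar Φ w (E.f w.1)) :
    ∃ φ : Base → Base, NearForm φ w₀.1 ∧ Φ =ᶠ[𝓝 w₀] prolong φ := by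
  obtain ⟨r, hr, hB⟩ := Metric.mem_nhds_iff.1 (inter_mem (hW.mem_nhds hw₀) hc)
  obtain ⟨⟨t₀, x₀, u₀⟩, p₀, q₀⟩ := w₀
  set I := Metric.ball t₀ r with hI
  set J := Metric.ball x₀ r with hJ
  set K := Metric.ball u₀ r with hK
  set N := Metric.ball p₀ r with hN
  set M := Metric.ball q₀ r with hM
  set B : Set Jet := (I ×ˢ J ×ˢ K) ×ˢ (N ×ˢ M) with hBdef
  have hball : Metric.ball (((t₀, x₀, u₀), (p₀, q₀)) : Jet) r = B := by
    simp only [hBdef, hI, hJ, hK, hN, hM, ball_prod_same]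
  rw [hball] at hB
  have oB : IsOpen B := hball ▸ Metric.isOpen_ball
  have mI : t₀ ∈ I := Metric.mem_ball_self hr
  have mJ : x₀ ∈ J := Metric.mem_ball_self hr
  have mK : u₀ ∈ K := Metric.mem_ball_self hr
  have mN : p₀ ∈ N := Metric.mem_ball_self hr
  have mM : q₀ ∈ M := Metric.mem_ball_self hr
  have ord : ∀ s : ℝ, (Metric.ball s r).OrdConnected := fun s => by
    rw [Real.ball_eq_Ioo]; exact ordConnected_Ioo
  have sB : ∀ w ∈ B, ContDiffAt ℝ ∞ Φ w := fun w hw => hs w (hB hw).1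
  have cB : ContactCondition Φ B := fun w hw => hcc w (hB hw).1
  have pB := fun w hw => PreservesChar.fderiv_eq_zero E oB (fun w hw => hsub w (hB hw).1) sB
    (fun w hw => (hB hw).2) (w := w) hw
  have ctB : ∀ w ∈ B, ContactCondition Φ {w} := fun w hw _ hz => hz ▸ cB w hw
  -- the derivatives `T_t`, `X_x` and `U_u` do not vanish
  have nz : ∀ w ∈ B, fderiv ℝ (cT Φ) w ((1, 0, 0), (0, 0)) ≠ 0 ∧
      fderiv ℝ (cX Φ) w ((0, 1, 0), (0, 0)) ≠ 0 ∧ fderiv ℝ (cU Φ) w ((0, 0, 1), (0, 0)) ≠ 0 := by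
    intro w hw
    have hlw := hl w (hB hw).1
    have hcf := cB.conformal_charBasis oB sB hw 0
    obtain ⟨hT, hX⟩ := pB w hw
    refine ⟨fun h0 => hlw ?_, fun h0 => hlw ?_, fun h0 => hlw ?_⟩
    · rw [← hcf.h13, hT (charBasis w 0 0), hT (charBasis w 0 2), hX (charBasis w 0 0),
        hX (charBasis w 0 2)]
      simp [h0, charBasis]
    · rw [← hcf.h24, hT (charBasis w 0 1), hT (charBasis w 0 3), hX (charBasis w 0 1),
        hX (charBasis w 0 3)]
      simp [h0, charBasis]
    · rw [contactFactor, hT, hX, h0]; simp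
  -- the components of `Φ` over the base do not depend on the first-order derivatives
  set χ : Base → Base := fun z => (Φ (z, (p₀, q₀))).1 with hχ
  have convB : Convex ℝ B := ((ord t₀).convex.prod ((ord x₀).convex.prod (ord u₀).convex)).prod
    ((ord p₀).convex.prod (ord q₀).convex)
  have eχ : ∀ w ∈ B, (Φ w).1 = χ w.1 := by
    intro w hw
    have hw' : (w.1, (p₀, q₀)) ∈ B := ⟨hw.1, mN, mM⟩
    have hd : ∀ {F : Jet → ℝ}, (∀ y ∈ B, ContDiffAt ℝ ∞ F y) → ∀ y ∈ B, DifferentiableAt ℝ F y :=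
      fun hF y hy => (hF y hy).differentiableAt (by simp)
    refine Prod.ext ?_ (Prod.ext ?_ ?_)
    · refine eq_of_fderiv_apply_sub_eq_zero (F := cT Φ) convB (hd fun y hy => (sB y hy).cT) hw hw'
        fun y hy => ?_
      rw [(pB y hy).1]; simp
    · refine eq_of_fderiv_apply_sub_eq_zero (F := cX Φ) convB (hd fun y hy => (sB y hy).cX) hw hw'
        fun y hy => ?_
      rw [(pB y hy).2]; simp
    · refine eq_of_fderiv_apply_sub_eq_zero (F := cU Φ) convB (hd fun y hy => (sB y hy).cU) hw hw'
        fun y hy => ?_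
      have := (ctB y hy).pullback ((w.1, (p₀, q₀)) - w)
      rw [(pB y hy).1, (pB y hy).2] at this
      simpa [contactForm] using this
  have mB : ∀ z ∈ I ×ˢ J ×ˢ K, (z, (p₀, q₀)) ∈ B := fun z hz => ⟨hz, mN, mM⟩
  have sχ : ∀ z ∈ I ×ˢ J ×ˢ K, ContDiffAt ℝ ∞ χ z := fun z hz =>
    ContDiffAt.fst ((sB _ (mB z hz)).comp (f := fun z => (z, (p₀, q₀))) z (by fun_prop))
  have fχ : ∀ {F : Jet → ℝ} {G : Base → ℝ}, (∀ y ∈ B, ContDiffAt ℝ ∞ F y) →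
      (∀ z, G z = F (z, (p₀, q₀))) → ∀ z ∈ I ×ˢ J ×ˢ K, ∀ v : Base,
      fderiv ℝ G z v = fderiv ℝ F (z, (p₀, q₀)) (v, (0, 0)) := by
    intro F G hF hG z hz v
    have h1 := HasFDerivAt.comp (f := fun z : Base => (z, (p₀, q₀))) z
      ((hF _ (mB z hz)).differentiableAt (by simp)).hasFDerivAt
      ((hasFDerivAt_id z).prodMk (hasFDerivAt_const (p₀, q₀) z))
    have h2 : G = F ∘ fun z : Base => (z, (p₀, q₀)) := funext hG
    rw [h2, h1.fderiv]
    simp [show ((0, 0) : ℝ × ℝ) = 0 from rfl]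
  have fT := fχ (F := cT Φ) (G := fun z => (χ z).1) (fun y hy => (sB y hy).cT) fun _ => rfl
  have fX := fχ (F := cX Φ) (G := fun z => (χ z).2.1) (fun y hy => (sB y hy).cX) fun _ => rfl
  have fU := fχ (F := cU Φ) (G := fun z => (χ z).2.2) (fun y hy => (sB y hy).cU) fun _ => rfl
  have hz₀ : ((t₀, x₀, u₀) : Base) ∈ I ×ˢ J ×ˢ K := ⟨mI, mJ, mK⟩
  obtain ⟨T, sT, eT, dT⟩ := exists_eq_comp_t (ord t₀) (ord x₀) (ord u₀)
    (fun z hz => (sχ z hz).comp_T) (fun z hz => by rw [fT z hz, (pB _ (mB z hz)).1]; simp)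
    (fun z hz => by rw [fT z hz, (pB _ (mB z hz)).1]; simp) hz₀
  obtain ⟨X, sX, eX, dX⟩ := exists_eq_comp_x (ord t₀) (ord x₀) (ord u₀)
    (fun z hz => (sχ z hz).comp_X) (fun z hz => by rw [fX z hz, (pB _ (mB z hz)).2]; simp)
    (fun z hz => by rw [fX z hz, (pB _ (mB z hz)).2]; simp) hz₀
  have dT0 : ∀ t ∈ I, deriv T t ≠ 0 := fun t ht => by
    rw [dT t ht, fT _ ⟨ht, mJ, mK⟩]
    exact (nz _ (mB _ ⟨ht, mJ, mK⟩)).1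
  have dX0 : ∀ x ∈ J, deriv X x ≠ 0 := fun x hx => by
    rw [dX x hx, fX _ ⟨mI, hx, mK⟩]
    exact (nz _ (mB _ ⟨mI, hx, mK⟩)).2.1
  set υ : Base → ℝ := fun z => (χ z).2.2 with hυ
  have sυ : ∀ z ∈ I ×ˢ J ×ˢ K, ContDiffAt ℝ ∞ υ z := fun z hz => (sχ z hz).comp_U
  have oBase : IsOpen (I ×ˢ J ×ˢ K) :=
    Metric.isOpen_ball.prod (Metric.isOpen_ball.prod Metric.isOpen_ball)
  -- the contact condition determines `U^t` and `U^x`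
  have hΦ : ∀ w ∈ B, Φ w = pointJet T X υ w := by
    intro w hw
    have hT : cT Φ =ᶠ[𝓝 w] fun y => T y.1.1 := by
      filter_upwards [oB.mem_nhds hw] with y hy
      exact (congrArg Prod.fst (eχ y hy)).trans (eT _ hy.1)
    have hX : cX Φ =ᶠ[𝓝 w] fun y => X y.1.2.1 := by
      filter_upwards [oB.mem_nhds hw] with y hy
      exact (congrArg (fun z : Base => z.2.1) (eχ y hy)).trans (eX _ hy.1)
    have hU : cU Φ =ᶠ[𝓝 w] fun y => υ y.1 := by
      filter_upwards [oB.mem_nhds hw] with y hy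
      exact congrArg (fun z : Base => z.2.2) (eχ y hy)
    have dT := (sT _ hw.1.1).differentiableAt (by simp)
    have dX := (sX _ hw.1.2.1).differentiableAt (by simp)
    have e1 : ∀ v, fderiv ℝ (cT Φ) w v = v.1.1 * deriv T w.1.1 := fun v => by
      rw [hT.fderiv_eq]
      exact (fderiv_comp_fst (g := fun y : Base => T y.1) (dT.comp w.1 differentiableAt_fst)
        v).trans (fderiv_comp_t dT v.1)
    have e2 : ∀ v, fderiv ℝ (cX Φ) w v = v.1.2.1 * deriv X w.1.2.1 := fun v => by
      rw [hX.fderiv_eq]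
      exact (fderiv_comp_fst (g := fun y : Base => X y.2.1)
        (DifferentiableAt.comp (f := fun y : Base => y.2.1) w.1 dX (by fun_prop)) v).trans
        (fderiv_comp_x dX v.1)
    have e3 : ∀ v, fderiv ℝ (cU Φ) w v = fderiv ℝ υ w.1 v.1 := fun v => by
      rw [hU.fderiv_eq]
      exact fderiv_comp_fst ((sυ _ hw.1).differentiableAt (by simp)) v
    obtain ⟨c1, c2⟩ := cB w hw 0 0 0
    simp only [totalT, totalX, e1, e2, e3] at c1 c2
    rw [fderiv_base_apply] at c1 c2
    have n1 := dT0 _ hw.1.1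
    have n2 := dX0 _ hw.1.2.1
    refine Prod.ext (Prod.ext ?_ (Prod.ext ?_ ?_)) (Prod.ext ?_ ?_)
    · exact hT.self_of_nhds
    · exact hX.self_of_nhds
    · exact hU.self_of_nhds
    · show cUt Φ w = _ / _
      rw [eq_div_iff n1]
      linear_combination c1
    · show cUx Φ w = _ / _
      rw [eq_div_iff n2]
      linear_combination c2
  have hΦ' : ∀ w ∈ B, Φ =ᶠ[𝓝 w] pointJet T X υ := fun w hw => by
    filter_upwards [oB.mem_nhds hw] with y hy using hΦ y hy
  -- on the equation, the value of `ũ_t̃x̃` does not depend on the first-order derivatives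
  have hmix : ∀ w ∈ B, mixedTotal υ w (E.f w.1) =
      f' (T w.1.1, X w.1.2.1, υ w.1) * (deriv T w.1.1 * deriv X w.1.2.1) := by
    intro w hw
    have h1 : MapsEquation Φ {w} E.f f' := fun _ hz => hz ▸ hm w (hB hw).1
    rw [mapsEquation_congr (hΦ' w hw), mapsEquation_pointJet (sT _ hw.1.1) (sX _ hw.1.2.1)
      (sυ _ hw.1) (dT0 _ hw.1.1) (dX0 _ hw.1.2.1)] at h1
    exact (h1 _).1 rfl
  have hform : ∀ z ∈ I ×ˢ J ×ˢ K, FormDeriv χ z := by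
    intro z hz
    have nzz := nz _ (mB z hz)
    refine ⟨?_, ?_, ?_, ?_, ?_, ?_, ?_, ?_⟩
    · rw [fT z hz, (pB _ (mB z hz)).1]; simp
    · rw [fT z hz, (pB _ (mB z hz)).1]; simp
    · rw [fT z hz]; exact nzz.1
    · rw [fX z hz, (pB _ (mB z hz)).2]; simp
    · rw [fX z hz, (pB _ (mB z hz)).2]; simp
    · rw [fX z hz]; exact nzz.2.1
    · rw [fU z hz]; exact nzz.2.2
    · have hmem : ∀ s : ℝ, s + r / 2 ∈ Metric.ball s r := fun s => by
        rw [Metric.mem_ball, Real.dist_eq, add_sub_cancel_left, abs_of_pos (half_pos hr)]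
        exact half_lt_self hr
      have m1 := hmix (z, (p₀, q₀)) ⟨hz, mN, mM⟩
      have m2 := hmix (z, (p₀ + r / 2, q₀)) ⟨hz, hmem p₀, mM⟩
      have m3 := hmix (z, (p₀, q₀ + r / 2)) ⟨hz, mN, hmem q₀⟩
      have m4 := hmix (z, (p₀ + r / 2, q₀ + r / 2)) ⟨hz, hmem p₀, hmem q₀⟩
      simp only [mixedTotal] at m1 m2 m3 m4
      have hr2 : r / 2 ≠ 0 := (half_pos hr).ne'
      have k3 : fderiv ℝ (fun y => fderiv ℝ υ y (0, 0, 1)) z (0, 0, 1) = 0 := by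
        refine (mul_eq_zero.1 ?_).resolve_left hr2
        refine (mul_eq_zero.1 ?_).resolve_left hr2
        linear_combination m4 - m3 - m2 + m1
      rw [k3] at m1 m2 m3
      have k2 : fderiv ℝ (fun y => fderiv ℝ υ y (0, 0, 1)) z (0, 1, 0) = 0 := by
        refine (mul_eq_zero.1 ?_).resolve_left hr2
        linear_combination m2 - m1
      have k1 : fderiv ℝ (fun y => fderiv ℝ υ y (0, 0, 1)) z (1, 0, 0) = 0 := by
        refine (mul_eq_zero.1 ?_).resolve_left hr2
        linear_combination m3 - m1
      intro v
      rw [fderiv_base_apply, k1, k2, k3]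
      ring
  obtain ⟨T', X', U₀, C, hp, hEq⟩ := exists_parameters Metric.isOpen_ball Metric.isOpen_ball
    (ord t₀) (ord x₀) (ord u₀) sχ hform hz₀
  refine ⟨χ, ⟨I, J, T', X', U₀, C, hp, mI, mJ, hEq.eventuallyEq_of_mem (oBase.mem_nhds hz₀)⟩, ?_⟩
  filter_upwards [oB.mem_nhds (mB _ hz₀)] with w hw
  rw [hΦ w hw]
  refine (prolong_eq_pointJet ?_ ((sT _ hw.1.1).differentiableAt (by simp))
    ((sX _ hw.1.2.1).differentiableAt (by simp)) (dT0 _ hw.1.1) (dX0 _ hw.1.2.1)).symm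
  filter_upwards [oBase.mem_nhds hw.1] with z hz
  exact Prod.ext (eT z hz) (Prod.ext (eX z hz) rfl)

theorem contactFactor_swap (Φ : Jet → Jet) (w : Jet) :
    contactFactor (swapJet ∘ Φ) w = contactFactor Φ w := by
  show fderiv ℝ (cU Φ) w _ - cUx Φ w * fderiv ℝ (cX Φ) w _ - cUt Φ w * fderiv ℝ (cT Φ) w _ = _
  unfold contactFactor
  ring

/-- A contact transformation between equations of the class is locally the first prolongation of a
transformation of the displayed form, up to the permutation of `t` and `x`. -/
theorem exists_baseForm (E : Equation) {W : Set Jet} (hW : IsOpen W)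
    (hsub : ∀ w ∈ W, w.1 ∈ E.dom) (hs : ∀ w ∈ W, ContDiffAt ℝ ∞ Φ w)
    (hcc : ContactCondition Φ W) (hl : ∀ w ∈ W, contactFactor Φ w ≠ 0)
    (hm : MapsEquation Φ W E.f f') (hw₀ : w₀ ∈ W) :
    ∃ φ : Base → Base, BaseForm φ w₀.1 ∧ Φ =ᶠ[𝓝 w₀] prolong φ := by
  have hf : ContinuousAt E.f w₀.1 :=
    (E.smooth.contDiffAt (E.isOpen_dom.mem_nhds (hsub w₀ hw₀))).continuousAt
  rcases preservesChar_eventually hW hs hcc hw₀ hl hm hf with hc | hc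
  · obtain ⟨φ, h1, h2⟩ := PreservesChar.exists_nearForm E hW hsub hs hcc hl hm hw₀ hc
    exact ⟨φ, Or.inl h1, h2⟩
  · obtain ⟨φ, h1, h2⟩ := PreservesChar.exists_nearForm E hW hsub
      (Φ := swapJet ∘ Φ) (f' := f' ∘ swapBase)
      (fun w hw => contDiff_swapJet.contDiffAt.comp w (hs w hw)) hcc.swap
      (fun w hw => by rw [contactFactor_swap]; exact hl w hw) (mapsEquation_swap.2 hm) hw₀ hc
    refine ⟨swapBase ∘ φ, Or.inr h1, ?_⟩
    rw [prolong_swapBase_comp]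
    exact h2.fun_comp swapJet

end

/-! ### The point equivalence groupoid -/

theorem IsDiffeo.contDiffAt {E : Type*} [NormedAddCommGroup E] [NormedSpace ℝ E]
    {Φ : OpenPartialHomeomorph E E} (h : IsDiffeo Φ) {w : E} (hw : w ∈ Φ.source) :
    ContDiffAt ℝ ∞ Φ w :=
  h.1.contDiffAt (Φ.open_source.mem_nhds hw)

theorem IsDiffeo.fderiv_surjective {E : Type*} [NormedAddCommGroup E] [NormedSpace ℝ E]
    {Φ : OpenPartialHomeomorph E E} (h : IsDiffeo Φ) {w : E} (hw : w ∈ Φ.source) (y : E) :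
    ∃ v, fderiv ℝ Φ w v = y := by
  have ht := Φ.map_source hw
  have h1 : HasFDerivAt Φ.symm (fderiv ℝ Φ.symm (Φ w)) (Φ w) :=
    ((h.2.contDiffAt (Φ.open_target.mem_nhds ht)).differentiableAt (by simp)).hasFDerivAt
  have h2 : HasFDerivAt Φ (fderiv ℝ Φ w) (Φ.symm (Φ w)) := by
    rw [Φ.left_inv hw]
    exact ((h.contDiffAt hw).differentiableAt (by simp)).hasFDerivAt
  have h3 := (h2.comp (Φ w) h1).unique
    ((hasFDerivAt_id (Φ w)).congr_of_eventuallyEq (Φ.eventually_right_inverse ht))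
  exact ⟨fderiv ℝ Φ.symm (Φ w) y, DFunLike.congr_fun h3 y⟩

theorem contactFactor_ne_zero {Φ : Jet → Jet} {w v : Jet} (h : ContactCondition Φ {w})
    (hT : fderiv ℝ (cT Φ) w v = 0) (hX : fderiv ℝ (cX Φ) w v = 0)
    (hU : fderiv ℝ (cU Φ) w v = 1) : contactFactor Φ w ≠ 0 := by
  intro h0
  have := h.pullback v
  rw [hT, hX, hU, h0] at this
  norm_num at this

theorem fderiv_components {φ : Base → Base} {z : Base} (h : DifferentiableAt ℝ φ z) (v : Base) :
    fderiv ℝ φ z v = (fderiv ℝ (fun y => (φ y).1) z v, fderiv ℝ (fun y => (φ y).2.1) z v,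
      fderiv ℝ (fun y => (φ y).2.2) z v) := by
  have h1 := h.hasFDerivAt.fst
  have h2 := h.hasFDerivAt.snd.fst
  have h3 := h.hasFDerivAt.snd.snd
  rw [h1.fderiv, h2.fderiv, h3.fderiv]
  rfl

/-- The determinant by which one divides in `prolong`. -/
noncomputable def prolongDet (φ : Base → Base) (w : Jet) : ℝ :=
  baseTotalT (fun z => (φ z).1) w * baseTotalX (fun z => (φ z).2.1) w -
    baseTotalX (fun z => (φ z).1) w * baseTotalT (fun z => (φ z).2.1) w

section Prolong

variable {φ : Base → Base} {w : Jet}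

theorem contDiffAt_baseTotal {F : Base → ℝ} (h : ContDiffAt ℝ ∞ F w.1) :
    ContDiffAt ℝ ∞ (baseTotalT F) w ∧ ContDiffAt ℝ ∞ (baseTotalX F) w := by
  have h1 : ContDiffAt ℝ ∞ (fun y : Jet => fderiv ℝ F y.1) w :=
    ContDiffAt.comp (f := fun y : Jet => y.1) w (h.fderiv_right (m := ∞) (by norm_cast))
      contDiffAt_fst
  exact ⟨h1.clm_apply (by fun_prop), h1.clm_apply (by fun_prop)⟩

theorem contDiffAt_prolongDet (h : ContDiffAt ℝ ∞ φ w.1) : ContDiffAt ℝ ∞ (prolongDet φ) w :=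
  ((contDiffAt_baseTotal h.comp_T).1.mul (contDiffAt_baseTotal h.comp_X).2).sub
    ((contDiffAt_baseTotal h.comp_T).2.mul (contDiffAt_baseTotal h.comp_X).1)

theorem contDiffAt_prolong (h : ContDiffAt ℝ ∞ φ w.1) (h0 : prolongDet φ w ≠ 0) :
    ContDiffAt ℝ ∞ (prolong φ) w := by
  obtain ⟨T1, T2⟩ := contDiffAt_baseTotal h.comp_T
  obtain ⟨X1, X2⟩ := contDiffAt_baseTotal h.comp_X
  obtain ⟨U1, U2⟩ := contDiffAt_baseTotal h.comp_U
  exact (ContDiffAt.comp (f := fun y : Jet => y.1) w h contDiffAt_fst).prodMk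
    ((((U1.mul X2).sub (U2.mul X1)).div (contDiffAt_prolongDet h) h0).prodMk
      (((T1.mul U2).sub (T2.mul U1)).div (contDiffAt_prolongDet h) h0))

theorem cramer {a b c d : ℝ} (h : a * d - b * c ≠ 0) (u v : ℝ) :
    (u * d - v * c) / (a * d - b * c) * a + (a * v - b * u) / (a * d - b * c) * c = u ∧
      (u * d - v * c) / (a * d - b * c) * b + (a * v - b * u) / (a * d - b * c) * d = v := by
  constructor <;> rw [div_mul_eq_mul_div, div_mul_eq_mul_div, ← add_div, div_eq_iff h] <;> ring

theorem contactCondition_prolong (h : DifferentiableAt ℝ φ w.1) (h0 : prolongDet φ w ≠ 0) :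
    ContactCondition (prolong φ) {w} := by
  rintro w rfl a b c
  have e1 : ∀ v, fderiv ℝ (cT (prolong φ)) w v = fderiv ℝ (fun z => (φ z).1) w.1 v.1 := fun v =>
    fderiv_comp_fst h.fst v
  have e2 : ∀ v, fderiv ℝ (cX (prolong φ)) w v = fderiv ℝ (fun z => (φ z).2.1) w.1 v.1 := fun v =>
    fderiv_comp_fst h.snd.fst v
  have e3 : ∀ v, fderiv ℝ (cU (prolong φ)) w v = fderiv ℝ (fun z => (φ z).2.2) w.1 v.1 := fun v =>
    fderiv_comp_fst h.snd.snd v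
  unfold prolongDet at h0
  simp only [totalT, totalX, e1, e2, e3, cUt, cUx, prolong]
  exact ⟨(cramer h0 _ _).1, (cramer h0 _ _).2⟩

theorem contactFactor_prolong_ne_zero (h : DifferentiableAt ℝ φ w.1) (h0 : prolongDet φ w ≠ 0)
    (hsurj : ∀ y, ∃ v, fderiv ℝ φ w.1 v = y) : contactFactor (prolong φ) w ≠ 0 := by
  obtain ⟨v, hv⟩ := hsurj (0, 0, 1)
  rw [fderiv_components h, Prod.mk.injEq, Prod.mk.injEq] at hv
  exact contactFactor_ne_zero (v := (v, 0)) (contactCondition_prolong h h0)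
    ((fderiv_comp_fst h.fst _).trans hv.1) ((fderiv_comp_fst h.snd.fst _).trans hv.2.1)
    ((fderiv_comp_fst h.snd.snd _).trans hv.2.2)

/-- The first prolongation of a point transformation is defined at some jet over each point. -/
theorem exists_prolongDet_ne_zero {z : Base} (h : DifferentiableAt ℝ φ z)
    (hsurj : ∀ y, ∃ v, fderiv ℝ φ z v = y) : ∃ w : Jet, w.1 = z ∧ prolongDet φ w ≠ 0 := by
  by_contra! H
  have h1 := H (z, (0, 0)) rfl
  have h2 := H (z, (1, 0)) rfl
  have h3 := H (z, (0, 1)) rfl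
  obtain ⟨v, hv⟩ := hsurj (1, 0, 0)
  obtain ⟨v', hv'⟩ := hsurj (0, 1, 0)
  rw [fderiv_components h, Prod.mk.injEq, Prod.mk.injEq] at hv hv'
  obtain ⟨a1, a2, -⟩ := hv
  obtain ⟨b1, b2, -⟩ := hv'
  unfold prolongDet baseTotalT baseTotalX at h1 h2 h3
  rw [fderiv_base_apply] at a1 a2 b1 b2
  have k1 : ∀ L : Base →L[ℝ] ℝ, L (1, 0, 1) = L (1, 0, 0) + L (0, 0, 1) := fun L => by
    rw [← map_add]; simp
  have k2 : ∀ L : Base →L[ℝ] ℝ, L (0, 1, 1) = L (0, 1, 0) + L (0, 0, 1) := fun L => by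
    rw [← map_add]; simp
  simp only [k1, k2] at h1 h2 h3
  generalize fderiv ℝ (fun y => (φ y).1) z = A at *
  generalize fderiv ℝ (fun y => (φ y).2.1) z = B at *
  have m1 : A (1, 0, 0) * B (0, 1, 0) - A (0, 1, 0) * B (1, 0, 0) = 0 := by linear_combination h1
  have m2 : A (0, 0, 1) * B (0, 1, 0) - A (0, 1, 0) * B (0, 0, 1) = 0 := by
    linear_combination h2 - h1
  have m3 : A (1, 0, 0) * B (0, 0, 1) - A (0, 0, 1) * B (1, 0, 0) = 0 := by
    linear_combination h3 - h1
  have : (1 : ℝ) = 0 := by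
    calc (1 : ℝ) = 1 * 1 - 0 * 0 := by ring
      _ = (v.1 * A (1, 0, 0) + v.2.1 * A (0, 1, 0) + v.2.2 * A (0, 0, 1)) *
          (v'.1 * B (1, 0, 0) + v'.2.1 * B (0, 1, 0) + v'.2.2 * B (0, 0, 1)) -
          (v.1 * B (1, 0, 0) + v.2.1 * B (0, 1, 0) + v.2.2 * B (0, 0, 1)) *
          (v'.1 * A (1, 0, 0) + v'.2.1 * A (0, 1, 0) + v'.2.2 * A (0, 0, 1)) := by
        rw [a1, a2, b1, b2]
      _ = 0 := by
        linear_combination (v.1 * v'.2.1 - v.2.1 * v'.1) * m1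
          - (v.2.1 * v'.2.2 - v.2.2 * v'.2.1) * m2 + (v.1 * v'.2.2 - v.2.2 * v'.1) * m3
  norm_num at this

end Prolong

theorem mapsEquation_iff_forall {Φ : Jet → Jet} {W : Set Jet} {f f' : Base → ℝ} :
    MapsEquation Φ W f f' ↔ ∀ w ∈ W, MapsEquation Φ {w} f f' := by
  simp only [MapsEquation, mem_singleton_iff, forall_eq]

/-- A point transformation maps an equation of the class to an equation of the class if and only if
it is locally of the displayed form, up to the permutation of `t` and `x`, and the right-hand sides
are related by its extension. -/
theorem mem_pointGroupoid_iff {E E' : Equation} {φ : OpenPartialHomeomorph Base Base} :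
    (E, φ, E') ∈ pointGroupoid ↔ φ.source = E.dom ∧ φ.target = E'.dom ∧
      ∀ z ∈ E.dom, BaseForm φ z ∧ liftMap φ (z, E.f z) = (φ z, E'.f (φ z)) := by
  constructor
  · rintro ⟨hd, hsrc, htgt, hm⟩
    refine ⟨hsrc, htgt, fun z hz => ?_⟩
    have hs : ∀ z ∈ E.dom, ContDiffAt ℝ ∞ φ z := fun z hz => hd.contDiffAt (hsrc ▸ hz)
    have hsurj : ∀ z ∈ E.dom, ∀ y, ∃ v, fderiv ℝ φ z v = y := fun z hz =>
      hd.fderiv_surjective (hsrc ▸ hz)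
    have hdiff : ∀ z ∈ E.dom, DifferentiableAt ℝ φ z := fun z hz =>
      (hs z hz).differentiableAt (by simp)
    obtain ⟨w, rfl, hw⟩ := exists_prolongDet_ne_zero (hdiff z hz) (hsurj z hz)
    set W : Set Jet := {w | w.1 ∈ E.dom ∧ prolongDet φ w ≠ 0} with hW
    have oW : IsOpen W := isOpen_iff_mem_nhds.2 fun w hw =>
      inter_mem (continuous_fst.continuousAt.preimage_mem_nhds (E.isOpen_dom.mem_nhds hw.1))
        ((contDiffAt_prolongDet (hs _ hw.1)).continuousAt.eventually_ne hw.2)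
    obtain ⟨χ, h1, h2⟩ := exists_baseForm E oW (fun w hw => hw.1)
      (fun w hw => contDiffAt_prolong (hs _ hw.1) hw.2)
      (fun w hw => contactCondition_prolong (hdiff _ hw.1) hw.2 w rfl)
      (fun w hw => contactFactor_prolong_ne_zero (hdiff _ hw.1) hw.2 (hsurj _ hw.1))
      (fun w hw => hm w hw.1) (w₀ := w) ⟨hz, hw⟩
    have e : (φ : Base → Base) =ᶠ[𝓝 w.1] χ := by
      have hc : Tendsto (fun z : Base => ((z, w.2) : Jet)) (𝓝 w.1) (𝓝 w) :=
        (Continuous.prodMk_left w.2).tendsto w.1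
      filter_upwards [hc.eventually h2] with y hy
      exact congrArg Prod.fst hy
    have hb : BaseForm φ w.1 := h1.congr e
    exact ⟨hb, hb.mapsEquation_prolong.1 (mapsEquation_iff_forall.1 hm w hz)⟩
  · rintro ⟨hsrc, htgt, h⟩
    exact ⟨BaseForm.isDiffeo fun z hz => (h z (hsrc ▸ hz)).1, hsrc, htgt,
      mapsEquation_iff_forall.2 fun w hw => (h w.1 hw).1.mapsEquation_prolong.2 (h w.1 hw).2⟩

/-! ### The equivalence pseudogroup -/

/-- The extension of the inverse is the inverse of the extension. -/
theorem liftMap_symm_liftMap {φ : OpenPartialHomeomorph Base Base} {z : Base} (hz : z ∈ φ.source)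
    (h : BaseForm φ z) (y : ℝ) : liftMap φ.symm (liftMap φ (z, y)) = (z, y) := by
  rw [← (h.comp (h.symm hz)).2, liftMap_congr (φ := φ.symm ∘ φ) (ψ := id) (φ.eventually_left_inverse hz),
    liftMap_id]

theorem NearForm.secondU_eq {φ : Base → Base} {z : Base} (h : NearForm φ z) {f f' : Base → ℝ}
    (hf : ∀ᶠ y in 𝓝 z, liftMap φ (y, f y) = (φ y, f' (φ y))) (h0 : secondU f' (φ z) = 0) :
    secondU f z = 0 := by
  obtain ⟨I, J, T, X, U₀, C, hp, ht, hx, e⟩ := h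
  have hC := hp.const_ne
  have d1 := hp.deriv_T _ ht
  have d2 := hp.deriv_X _ hx
  set m := deriv T z.1 * deriv X z.2.1 with hmdef
  have hm : m ≠ 0 := mul_ne_zero d1 d2
  set b := mixed U₀ z.1 z.2.1 with hb
  set c := U₀ (z.1, z.2.1) with hc
  have hcont : Tendsto (fun s : ℝ => (z.1, z.2.1, s)) (𝓝 z.2.2) (𝓝 z) :=
    (by fun_prop : Continuous fun s : ℝ => (z.1, z.2.1, s)).tendsto z.2.2
  have hev : (fun s => f (z.1, z.2.1, s)) =ᶠ[𝓝 z.2.2]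
      fun s => (m / C) * f' (T z.1, X z.2.1, C * s + c) - b / C := by
    filter_upwards [hcont.eventually hf, hcont.eventually e.eventuallyEq_nhds] with s h1 h2
    have h3 := congrArg Prod.snd h1
    rw [liftMap_congr h2, hp.liftMap_formBase (z := (z.1, z.2.1, s)) ht hx,
      h2.self_of_nhds] at h3
    have h4 : (C * f (z.1, z.2.1, s) + b) / m = f' (T z.1, X z.2.1, C * s + c) := h3
    rw [← h4]
    field_simp
    ring
  have hg : ∀ (g : ℝ → ℝ) (s : ℝ), deriv (fun s => g (C * s + c)) s = C * deriv g (C * s + c) := by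
    intro g s
    have := deriv_comp_mul_left C (fun r => g (r + c)) s
    rw [smul_eq_mul, deriv_comp_add_const] at this
    exact this
  rw [e.self_of_nhds] at h0
  unfold secondU at h0 ⊢
  rw [iteratedDeriv_succ, iteratedDeriv_one] at h0 ⊢
  rw [hev.deriv.deriv_eq]
  have hd : (deriv fun s => (m / C) * f' (T z.1, X z.2.1, C * s + c) - b / C) =
      fun s => (m / C) * (C * deriv (fun r => f' (T z.1, X z.2.1, r)) (C * s + c)) := by
    funext s
    rw [deriv_sub_const, deriv_const_mul_field, hg fun r => f' (T z.1, X z.2.1, r)]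
  rw [hd, deriv_const_mul_field, deriv_const_mul_field,
    hg (deriv fun r => f' (T z.1, X z.2.1, r))]
  simp only [formBase] at h0
  rw [h0]
  simp

theorem BaseForm.secondU_eq {φ : Base → Base} {z : Base} (h : BaseForm φ z) {f f' : Base → ℝ}
    (hf : ∀ᶠ y in 𝓝 z, liftMap φ (y, f y) = (φ y, f' (φ y))) (h0 : secondU f' (φ z) = 0) :
    secondU f z = 0 := by
  rcases h with h | h
  · exact h.secondU_eq hf h0
  · refine h.secondU_eq (f' := f' ∘ swapBase) ?_ h0
    filter_upwards [hf] with y hy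
    rw [liftMap_swapBase_comp, hy]
    rfl

/-- The image of an equation of the class under a transformation that is locally of the displayed
form, up to the permutation of `t` and `x`. -/
noncomputable def imageEquation (E : Equation) (φ : OpenPartialHomeomorph Base Base)
    (hsrc : φ.source = E.dom) (h : ∀ z ∈ φ.source, BaseForm φ z) : Equation where
  dom := φ.target
  isOpen_dom := φ.open_target
  f z := (liftMap φ (φ.symm z, E.f (φ.symm z))).2
  smooth z hz := by
    have hm := φ.map_target hz
    have s1 : ContDiffAt ℝ ∞ φ.symm z := (BaseForm.isDiffeo h).2.contDiffAt
      (φ.open_target.mem_nhds hz)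
    have s2 : ContDiffAt ℝ ∞ E.f (φ.symm z) :=
      E.smooth.contDiffAt (E.isOpen_dom.mem_nhds (hsrc ▸ hm))
    have s3 := (h _ hm).contDiffAt_liftMap (E.f (φ.symm z))
    have s4 : ContDiffAt ℝ ∞ (fun z => liftMap φ (φ.symm z, E.f (φ.symm z))) z :=
      ContDiffAt.comp (g := liftMap φ) (f := fun z => (φ.symm z, E.f (φ.symm z))) z s3
        (s1.prodMk (s2.comp z s1))
    exact s4.snd.contDiffWithinAt
  nonaffine V hV oV := by
    rintro ⟨y, hy⟩
    obtain ⟨z, ⟨hz1, hz2⟩, hz⟩ := E.nonaffine (φ.source ∩ φ ⁻¹' V)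
      (inter_subset_left.trans hsrc.subset) (φ.isOpen_inter_preimage oV)
      ⟨φ.symm y, φ.map_target (hV hy), by
        rw [mem_preimage, φ.right_inv (hV hy)]; exact hy⟩
    refine ⟨φ z, hz2, fun h0 => hz ((h z hz1).secondU_eq ?_ h0)⟩
    filter_upwards [φ.open_source.mem_nhds hz1] with y hy
    simp only [φ.left_inv hy]
    rfl

/-- A transformation of the space of `(t,x,u,f)` belongs to the equivalence pseudogroup if and only
if it is the extension of its projection, which is locally of the displayed form up to the
permutation of `t` and `x`. -/
theorem mem_equivalenceGroup_iff {𝒯 : OpenPartialHomeomorph BaseF BaseF} :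
    𝒯 ∈ equivalenceGroup ↔ ∃ φ : OpenPartialHomeomorph Base Base, ProjectsTo 𝒯 φ ∧
      ∀ z ∈ φ.source, BaseForm φ z ∧ ∀ y, 𝒯 (z, y) = liftMap φ (z, y) := by
  constructor
  · rintro ⟨-, φ, hproj, h⟩
    refine ⟨φ, hproj, fun z hz => ?_⟩
    -- test equations whose right-hand sides take any given value `y` at `z`
    have key : ∀ y, BaseForm φ z ∧ 𝒯 (z, y) = liftMap φ (z, y) := by
      intro y
      let E : Equation :=
        { dom := φ.source
          isOpen_dom := φ.open_source
          f := fun v => (v.2.2 - z.2.2) ^ 2 + y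
          smooth := by fun_prop
          nonaffine := by
            rintro V - - ⟨v, hv⟩
            refine ⟨v, hv, ?_⟩
            have h1 : (deriv fun s : ℝ => (s - z.2.2) ^ 2 + y) = fun s => 2 * (s - z.2.2) := by
              funext s
              simp
            have h2 : deriv (fun s : ℝ => 2 * (s - z.2.2)) v.2.2 = 2 := by simp
            simp only [secondU]
            rw [iteratedDeriv_succ, iteratedDeriv_one, h1, h2]
            norm_num }
      obtain ⟨E', hE', htr⟩ := h E subset_rfl
      have hz' := (mem_pointGroupoid_iff.1 hE').2.2 z hz
      have h1 := htr z hz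
      have hEz : E.f z = y := by simp [E]
      rw [← (show (φ.restr E.dom : Base → Base) = φ from rfl)] at h1 ⊢
      rw [hEz] at h1 hz'
      exact ⟨hz'.1, h1.trans hz'.2.symm⟩
    exact ⟨(key 0).1, fun y => (key y).2⟩
  · rintro ⟨φ, hproj, h⟩
    have hsrc : ∀ w ∈ 𝒯.source, w.1 ∈ φ.source := fun w hw => (hproj.source_eq ▸ hw).1
    have heq : ∀ w ∈ 𝒯.source, (𝒯 : BaseF → BaseF) =ᶠ[𝓝 w] liftMap φ := fun w hw => by
      filter_upwards [𝒯.open_source.mem_nhds hw] with v hv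
      exact (h v.1 (hsrc v hv)).2 v.2
    refine ⟨⟨fun w hw => ?_, fun w hw => ?_⟩, φ, hproj, fun E hE => ?_⟩
    · exact (((h w.1 (hsrc w hw)).1.contDiffAt_liftMap w.2).congr_of_eventuallyEq
        (heq w hw)).contDiffWithinAt
    · have hm := 𝒯.map_target hw
      set v := 𝒯.symm w with hv
      have hvz := hsrc v hm
      have hsm : ContDiffAt ℝ ∞ (liftMap φ.symm) (𝒯 v) := by
        rw [(heq v hm).self_of_nhds]
        exact ((h v.1 hvz).1.symm hvz).contDiffAt_liftMap _
      have := contDiffAt_symm_of_leftInverse hm hsm (by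
        filter_upwards [heq v hm, 𝒯.open_source.mem_nhds hm] with y hy hy'
        rw [hy]
        exact liftMap_symm_liftMap (hsrc y hy') (h y.1 (hsrc y hy')).1 y.2)
      rw [hv, 𝒯.right_inv hw] at this
      exact this.contDiffWithinAt
    · have hs : (φ.restr E.dom).source = E.dom := by
        rw [φ.restr_source, E.isOpen_dom.interior_eq]
        exact inter_eq_self_of_subset_right hE
      have hb : ∀ z ∈ (φ.restr E.dom).source, BaseForm (φ.restr E.dom) z := fun z hz =>
        (h z (hE (hs ▸ hz))).1
      have hl : ∀ z ∈ E.dom, liftMap (φ.restr E.dom) (z, E.f z) = ((φ.restr E.dom) z,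
          (imageEquation E (φ.restr E.dom) hs hb).f ((φ.restr E.dom) z)) := by
        intro z hz
        simp only [imageEquation, (φ.restr E.dom).left_inv (hs.symm ▸ hz)]
        rfl
      exact ⟨imageEquation E (φ.restr E.dom) hs hb,
        mem_pointGroupoid_iff.2 ⟨hs, rfl, fun z hz => ⟨hb z (hs.symm ▸ hz), hl z hz⟩⟩,
        fun z hz => ((h z (hE hz)).2 _).trans (hl z hz)⟩

theorem baseForm_of_mem_equivalenceGroup {𝒯 : OpenPartialHomeomorph BaseF BaseF}
    (h : 𝒯 ∈ equivalenceGroup) {φ : OpenPartialHomeomorph Base Base} (hφ : ProjectsTo 𝒯 φ)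
    {z : Base} (hz : z ∈ φ.source) : BaseForm φ z ∧ ∀ y, 𝒯 (z, y) = liftMap φ (z, y) := by
  obtain ⟨ψ, hψ, h⟩ := mem_equivalenceGroup_iff.1 h
  have hmem : ∀ y ∈ φ.source, (y, (0 : ℝ)) ∈ 𝒯.source := fun y hy => by
    rw [hφ.source_eq]; exact ⟨hy, trivial⟩
  have e : (φ : Base → Base) =ᶠ[𝓝 z] ψ := by
    filter_upwards [φ.open_source.mem_nhds hz] with y hy
    exact (hφ.fst_eq _ (hmem y hy)).symm.trans (hψ.fst_eq _ (hmem y hy))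
  have hz' : z ∈ ψ.source := (hψ.source_eq ▸ hmem z hz).1
  exact ⟨(h z hz').1.congr e, fun y => by rw [(h z hz').2, liftMap_congr e]⟩

theorem liftHomeo_mem (φ : OpenPartialHomeomorph Base Base) (h : ∀ z ∈ φ.source, BaseForm φ z) :
    liftHomeo φ h ∈ equivalenceGroup :=
  mem_equivalenceGroup_iff.2 ⟨φ, liftHomeo_projectsTo φ h, fun z hz => ⟨h z hz, fun _ => rfl⟩⟩

/-! ### Normalization -/

theorem pointGroupoid_eq : pointGroupoid = actionGroupoid equivalenceGroup := by
  ext ⟨E, φ, E'⟩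
  constructor
  · intro h
    obtain ⟨hs, ht, h⟩ := mem_pointGroupoid_iff.1 h
    have hb : ∀ z ∈ φ.source, BaseForm φ z := fun z hz => (h z (hs ▸ hz)).1
    exact ⟨hs, ht, liftHomeo φ hb, liftHomeo_mem φ hb, liftHomeo_projectsTo φ hb,
      fun z hz => (h z hz).2⟩
  · rintro ⟨hs, ht, 𝒯, h𝒯, hproj, htr⟩
    refine mem_pointGroupoid_iff.2 ⟨hs, ht, fun z hz => ?_⟩
    have hb := baseForm_of_mem_equivalenceGroup h𝒯 hproj (z := z) (hs.symm ▸ hz)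
    exact ⟨hb.1, (hb.2 _).symm.trans (htr z hz)⟩

theorem contactGroupoid_eq : contactGroupoid = prolongedActionGroupoid equivalenceGroup := by
  ext ⟨E, Φ, E'⟩
  constructor
  · rintro ⟨hd, hcc, hs, ht, hm⟩
    refine ⟨hs, ht, fun w hw => ?_⟩
    have hsub : ∀ w ∈ Φ.source, w.1 ∈ E.dom := fun w hw => hs ▸ mem_image_of_mem Prod.fst hw
    obtain ⟨φ, h1, h2⟩ := exists_baseForm E Φ.open_source hsub (fun w hw => hd.contDiffAt hw) hcc
      (fun w hw => by
        obtain ⟨v, hv⟩ := hd.fderiv_surjective hw ((0, 0, 1), (0, 0))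
        have hΦ := ((hd.contDiffAt hw).differentiableAt (by simp)).hasFDerivAt
        have k1 : HasFDerivAt (cT Φ) _ w := hΦ.fst.fst
        have k2 : HasFDerivAt (cX Φ) _ w := hΦ.fst.snd.fst
        have k3 : HasFDerivAt (cU Φ) _ w := hΦ.fst.snd.snd
        refine contactFactor_ne_zero (v := v) (fun _ hy => hy ▸ hcc w hw) ?_ ?_ ?_
        · rw [k1.fderiv]; exact congrArg (fun y : Jet => y.1.1) hv
        · rw [k2.fderiv]; exact congrArg (fun y : Jet => y.1.2.1) hv
        · rw [k3.fderiv]; exact congrArg (fun y : Jet => y.1.2.2) hv) hm hw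
    obtain ⟨χ, hχ1, hχ2, hχ3⟩ := h1.exists_homeo
    have e : Φ =ᶠ[𝓝 w] prolong χ := h2.trans (prolong_congr hχ3)
    have hcont : Tendsto (fun z : Base => ((z, w.2) : Jet)) (𝓝 w.1) (𝓝 w) :=
      (Continuous.prodMk_left w.2).tendsto w.1
    have hV : ∀ᶠ z in 𝓝 w.1, (z ∈ χ.source ∧ (z, w.2) ∈ Φ.source) ∧
        Φ =ᶠ[𝓝 (z, w.2)] prolong χ :=
      ((χ.open_source.eventually_mem hχ1).and
        (hcont.eventually (Φ.open_source.eventually_mem hw))).and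
        (hcont.eventually e.eventuallyEq_nhds)
    obtain ⟨V, hV1, oV, hV2⟩ := mem_nhds_iff.1 hV
    refine ⟨liftHomeo χ hχ2, liftHomeo_mem χ hχ2, χ, liftHomeo_projectsTo χ hχ2, V, oV, hV2,
      fun z hz => ⟨(hV1 hz).1.1, hsub _ (hV1 hz).1.2⟩, fun z hz => ?_, e⟩
    have h3 : MapsEquation (prolong χ) {((z, w.2) : Jet)} E.f E'.f :=
      (mapsEquation_congr (hV1 hz).2).1 fun _ hy => hy ▸ hm _ (hV1 hz).1.2
    exact (BaseForm.mapsEquation_prolong (w := (z, w.2)) (hχ2 z (hV1 hz).1.1)).1 h3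
  · rintro ⟨hs, ht, h⟩
    have hloc : ∀ w ∈ Φ.source, ∃ φ : Base → Base, BaseForm φ w.1 ∧ Φ =ᶠ[𝓝 w] prolong φ ∧
        liftMap φ (w.1, E.f w.1) = (φ w.1, E'.f (φ w.1)) := by
      intro w hw
      obtain ⟨𝒯, h𝒯, φ, hproj, V, oV, hwV, hV, htr, he⟩ := h w hw
      have hb := baseForm_of_mem_equivalenceGroup h𝒯 hproj (hV hwV).1
      exact ⟨φ, hb.1, he, (hb.2 _).symm.trans (htr _ hwV)⟩
    refine ⟨⟨fun w hw => ?_, fun w hw => ?_⟩, fun w hw => ?_, hs, ht,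
      mapsEquation_iff_forall.2 fun w hw => ?_⟩
    · obtain ⟨φ, hb, he, -⟩ := hloc w hw
      exact (hb.prolong_smooth.1.congr_of_eventuallyEq he).contDiffWithinAt
    · have hm := Φ.map_target hw
      obtain ⟨φ, hb, he, -⟩ := hloc _ hm
      obtain ⟨-, g, hg, hg'⟩ := hb.prolong_smooth
      rw [← he.self_of_nhds] at hg
      have := contDiffAt_symm_of_leftInverse hm hg (by
        filter_upwards [he, hg'] with y h1 h2
        rw [h1, h2])
      rw [Φ.right_inv hw] at this
      exact this.contDiffWithinAt
    · obtain ⟨φ, hb, he, -⟩ := hloc w hw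
      exact contactCondition_congr he hb.contactCondition_prolong w rfl
    · obtain ⟨φ, hb, he, hl⟩ := hloc w hw
      exact (mapsEquation_congr he).2 (hb.mapsEquation_prolong.2 hl)

/-! ### Generation -/

/-- A transformation that is given by the extension of a map of the base is fibred. -/
theorem exists_projectsTo {𝒯 : OpenPartialHomeomorph BaseF BaseF} {g : Base → Base} {S : Set Base}
    (oS : IsOpen S) (hs : 𝒯.source = S ×ˢ univ) (hg : ∀ z ∈ S, BaseForm g z)
    (h : ∀ w ∈ 𝒯.source, 𝒯 w = liftMap g w) :
    ∃ φ : OpenPartialHomeomorph Base Base, ProjectsTo 𝒯 φ ∧ φ.source = S ∧ ∀ z, φ z = g z := by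
  -- the fibre over `z` is mapped onto the fibre over `g z`
  have hfib : ∀ z ∈ S, ∀ y', ∃ y, (z, y) ∈ 𝒯.source ∧ 𝒯 (z, y) = (g z, y') := by
    intro z hz y'
    have h1 := (hg z hz).derivU_ne_zero
    have h2 := (hg z hz).factorTX_ne_zero
    have hm : ∀ y, (z, y) ∈ 𝒯.source := fun y => by rw [hs]; exact ⟨hz, trivial⟩
    refine ⟨(y' * factorTX g z - derivTX g z) / derivU g z, hm _, ?_⟩
    rw [h _ (hm _)]
    refine Prod.ext rfl ?_
    simp only [liftMap]
    field_simp
    ring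
  have hsymm : ∀ z ∈ S, ∀ y', (g z, y') ∈ 𝒯.target ∧ (𝒯.symm (g z, y')).1 = z := by
    intro z hz y'
    obtain ⟨y, hy, hy'⟩ := hfib z hz y'
    rw [← hy', 𝒯.left_inv hy]
    exact ⟨𝒯.map_source hy, rfl⟩
  have htgt : ∀ w ∈ 𝒯.target, ∃ z ∈ S, w.1 = g z := by
    intro w hw
    have hm := 𝒯.map_target hw
    refine ⟨(𝒯.symm w).1, (hs ▸ hm).1, ?_⟩
    have := congrArg Prod.fst (h _ hm)
    rwa [𝒯.right_inv hw] at this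
  let φ : OpenPartialHomeomorph Base Base :=
    { toFun := g
      invFun := fun z => (𝒯.symm (z, 0)).1
      source := S
      target := (fun z : Base => (z, (0 : ℝ))) ⁻¹' 𝒯.target
      map_source' := fun z hz => (hsymm z hz 0).1
      map_target' := fun z hz => by
        have := 𝒯.map_target hz
        rw [hs] at this
        exact this.1
      left_inv' := fun z hz => (hsymm z hz 0).2
      right_inv' := fun z hz => by
        obtain ⟨y, hy, rfl⟩ := htgt _ hz
        rw [(hsymm y hy 0).2]
      open_source := oS
      open_target := 𝒯.open_target.preimage (by fun_prop)
      continuousOn_toFun := fun z hz => (hg z hz).contDiffAt.continuousAt.continuousWithinAt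
      continuousOn_invFun := continuous_fst.comp_continuousOn
        (𝒯.continuousOn_symm.comp (by fun_prop) fun z hz => hz) }
  refine ⟨φ, ⟨hs, ?_, fun w hw => congrArg Prod.fst (h w hw)⟩, rfl, fun _ => rfl⟩
  ext ⟨z, y⟩
  constructor
  · intro hz
    obtain ⟨z', hz', he⟩ := htgt _ hz
    refine ⟨?_, trivial⟩
    show (z, (0 : ℝ)) ∈ 𝒯.target
    rw [show z = g z' from he]
    exact (hsymm z' hz' 0).1
  · rintro ⟨hz, -⟩
    obtain ⟨z', hz', he⟩ := htgt _ hz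
    rw [show z = g z' from he]
    exact (hsymm z' hz' y).1

theorem ProjectsTo.trans {𝒯 𝒮 : OpenPartialHomeomorph BaseF BaseF}
    {φ ψ : OpenPartialHomeomorph Base Base} (h : ProjectsTo 𝒯 φ) (h' : ProjectsTo 𝒮 ψ) :
    ProjectsTo (𝒯.trans 𝒮) (φ.trans ψ) where
  source_eq := by
    ext w
    simp only [OpenPartialHomeomorph.trans_source, mem_inter_iff, mem_preimage, mem_prod, mem_univ,
      and_true]
    rw [h'.source_eq, mem_prod]
    constructor
    · rintro ⟨h1, h2, -⟩
      rw [h.fst_eq w h1] at h2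
      exact ⟨(h.source_eq ▸ h1).1, h2⟩
    · rintro ⟨h1, h2⟩
      have h3 : w ∈ 𝒯.source := h.source_eq ▸ ⟨h1, trivial⟩
      rw [h.fst_eq w h3]
      exact ⟨h3, h2, trivial⟩
  target_eq := by
    ext w
    simp only [OpenPartialHomeomorph.trans_target, mem_inter_iff, mem_preimage, mem_prod, mem_univ,
      and_true]
    rw [h'.target_eq, mem_prod, h.target_eq, mem_prod]
    simp only [mem_univ, and_true]
    refine and_congr_right fun h1 => ?_
    have h2 : w ∈ 𝒮.target := h'.target_eq ▸ ⟨h1, trivial⟩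
    have h3 := h'.fst_eq _ (𝒮.map_target h2)
    rw [𝒮.right_inv h2] at h3
    have h4 : (𝒮.symm w).1 ∈ ψ.source := (h'.source_eq ▸ 𝒮.map_target h2).1
    rw [h3, ψ.left_inv h4]
  fst_eq w hw := by
    have h1 : w ∈ 𝒯.source := hw.1
    have h2 : 𝒯 w ∈ 𝒮.source := hw.2
    show (𝒮 (𝒯 w)).1 = ψ (φ w.1)
    rw [h'.fst_eq _ h2, h.fst_eq _ h1]

theorem ProjectsTo.symm {𝒯 : OpenPartialHomeomorph BaseF BaseF}
    {φ : OpenPartialHomeomorph Base Base} (h : ProjectsTo 𝒯 φ) : ProjectsTo 𝒯.symm φ.symm where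
  source_eq := h.target_eq
  target_eq := h.source_eq
  fst_eq w hw := by
    have hm := 𝒯.map_target hw
    have h1 := h.fst_eq _ hm
    rw [𝒯.right_inv hw] at h1
    rw [h1, φ.left_inv (h.source_eq ▸ hm : _ ∈ φ.source ×ˢ univ).1]

theorem isPseudogroup_equivalenceGroup : IsPseudogroup equivalenceGroup where
  fibred 𝒯 h := by
    obtain ⟨φ, hφ, -⟩ := mem_equivalenceGroup_iff.1 h
    exact ⟨φ, hφ⟩
  refl_mem := mem_equivalenceGroup_iff.2 ⟨OpenPartialHomeomorph.refl Base,
    ⟨by simp, by simp, fun _ _ => rfl⟩,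
    fun z _ => ⟨Or.inl (NearForm.id z), fun y => (liftMap_id (z, y)).symm⟩⟩
  trans_mem 𝒯 h𝒯 𝒮 h𝒮 := by
    obtain ⟨φ, hφ, h⟩ := mem_equivalenceGroup_iff.1 h𝒯
    obtain ⟨ψ, hψ, h'⟩ := mem_equivalenceGroup_iff.1 h𝒮
    refine mem_equivalenceGroup_iff.2 ⟨φ.trans ψ, hφ.trans hψ, fun z hz => ?_⟩
    have hz1 : z ∈ φ.source := hz.1
    have hz2 : φ z ∈ ψ.source := hz.2
    obtain ⟨h1, h2⟩ := (h z hz1).1.comp (h' _ hz2).1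
    refine ⟨h1, fun y => ?_⟩
    show 𝒮 (𝒯 (z, y)) = liftMap (ψ ∘ φ) (z, y)
    rw [h2, (h z hz1).2]
    exact (h' _ hz2).2 _
  symm_mem 𝒯 h𝒯 := by
    obtain ⟨φ, hφ, h⟩ := mem_equivalenceGroup_iff.1 h𝒯
    refine mem_equivalenceGroup_iff.2 ⟨φ.symm, hφ.symm, fun z hz => ?_⟩
    have hm : φ.symm z ∈ φ.source := φ.map_target hz
    have hb := (h _ hm).1.symm hm
    rw [φ.right_inv hz] at hb
    refine ⟨hb, fun y => ?_⟩
    have hw : (z, y) ∈ 𝒯.target := by rw [hφ.target_eq]; exact ⟨hz, trivial⟩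
    set v := 𝒯.symm (z, y) with hv
    have hvs : v ∈ 𝒯.source := 𝒯.map_target hw
    have hv1 : v.1 ∈ φ.source := (hφ.source_eq ▸ hvs : _ ∈ φ.source ×ˢ univ).1
    have e : liftMap φ v = (z, y) := by
      rw [← (h v.1 hv1).2 v.2, hv, 𝒯.right_inv hw]
    rw [← e]
    exact (liftMap_symm_liftMap hv1 (h v.1 hv1).1 v.2).symm
  local_mem 𝒯 φ hφ h := by
    refine mem_equivalenceGroup_iff.2 ⟨φ, hφ, fun z hz => ?_⟩
    obtain ⟨𝒮, h𝒮, V, oV, hzV, hV, he⟩ := h z hz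
    obtain ⟨ψ, hψ, h'⟩ := mem_equivalenceGroup_iff.1 h𝒮
    have hmem : ∀ y ∈ V, y ∈ ψ.source := fun y hy =>
      (hψ.source_eq ▸ (hV (mk_mem_prod hy (mem_univ 0))).2 : _ ∈ ψ.source ×ˢ univ).1
    have e : (φ : Base → Base) =ᶠ[𝓝 z] ψ := by
      filter_upwards [oV.mem_nhds hzV] with y hy
      have h1 := hV (mk_mem_prod hy (mem_univ 0))
      rw [← hφ.fst_eq _ h1.1, he (mk_mem_prod hy (mem_univ 0)), hψ.fst_eq _ h1.2]
    refine ⟨(h' z (hmem z hzV)).1.congr e, fun y => ?_⟩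
    rw [liftMap_congr e, ← (h' z (hmem z hzV)).2]
    exact he (mk_mem_prod hzV (mem_univ y))

theorem mem_equivalenceGroup_of_eq_liftMap {𝒯 : OpenPartialHomeomorph BaseF BaseF}
    {g : Base → Base} {S : Set Base} (oS : IsOpen S) (hs : 𝒯.source = S ×ˢ univ)
    (hg : ∀ z ∈ S, BaseForm g z) (h : ∀ w ∈ 𝒯.source, 𝒯 w = liftMap g w) :
    𝒯 ∈ equivalenceGroup := by
  obtain ⟨φ, hφ, hφs, hφg⟩ := exists_projectsTo oS hs hg h
  have e : (φ : Base → Base) = g := funext hφg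
  refine mem_equivalenceGroup_iff.2 ⟨φ, hφ, fun z hz => ?_⟩
  rw [hφs] at hz
  rw [e]
  exact ⟨hg z hz, fun y => h _ (hs ▸ mk_mem_prod hz (mem_univ y))⟩

theorem liftMap_swapBase (w : BaseF) : liftMap swapBase w = swapMap w := by
  rw [show swapBase = swapBase ∘ id from rfl, liftMap_swapBase_comp, liftMap_id]

theorem generators_subset : formTransformations ∪ swapTransformation ⊆ equivalenceGroup := by
  rintro 𝒯 (⟨I, J, T, X, U₀, C, hp, hs, he⟩ | ⟨hs, he⟩)
  · refine mem_equivalenceGroup_of_eq_liftMap (g := formBase T X U₀ C)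
      (S := {z | z.1 ∈ I ∧ z.2.1 ∈ J}) ?_ ?_ ?_ ?_
    · exact (hp.isOpen_left.preimage continuous_fst).inter
        (hp.isOpen_right.preimage (by fun_prop : Continuous fun y : Base => y.2.1))
    · rw [hs]; ext w; simp
    · exact fun z hz => Or.inl ⟨I, J, T, X, U₀, C, hp, hz.1, hz.2, .rfl⟩
    · intro w hw
      rw [he hw]
      rw [hs] at hw
      exact (hp.liftMap_formBase hw.1 hw.2 w.2).symm
  · exact mem_equivalenceGroup_of_eq_liftMap (g := swapBase) isOpen_univ (by simpa using hs)
      (fun z _ => Or.inr (NearForm.id z)) fun w _ => (he w).trans (liftMap_swapBase w).symm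

/-- The permutation of `t` and `x` as a transformation of the space of `(t,x,u,f)`. -/
def swapHomeo : BaseF ≃ₜ BaseF where
  toFun := swapMap
  invFun := swapMap
  left_inv := swapMap_swapMap
  right_inv := swapMap_swapMap
  continuous_toFun := by unfold swapMap; fun_prop
  continuous_invFun := by unfold swapMap; fun_prop

/-- A map of the displayed form coincides near each point with a map whose extension is one of the
generating transformations. -/
theorem NearForm.exists_generator {φ : Base → Base} {z : Base} (h : NearForm φ z) :
    ∃ 𝒮 ∈ formTransformations, ∃ V : Set Base, IsOpen V ∧ z ∈ V ∧ V ×ˢ univ ⊆ 𝒮.source ∧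
      EqOn (liftMap φ) 𝒮 (V ×ˢ univ) := by
  obtain ⟨I, J, T, X, U₀, C, hp, ht, hx, e⟩ := h
  obtain ⟨I', J', χ, hq, ht', hx', -, -, hχs, hχ⟩ := hp.exists_homeo ht hx
  have hb : ∀ y ∈ χ.source, BaseForm χ y := fun y hy => by
    rw [hχs] at hy
    exact Or.inl ⟨I', J', T, X, U₀, C, hq, hy.1, hy.2, .of_forall hχ⟩
  have hl : ∀ w : BaseF, w.1 ∈ χ.source → liftMap χ w = formMap T X U₀ C w := fun w hw => by
    rw [hχs] at hw
    rw [show (χ : Base → Base) = formBase T X U₀ C from funext hχ]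
    exact hq.liftMap_formBase hw.1 hw.2 w.2
  refine ⟨liftHomeo χ hb, ⟨I', J', T, X, U₀, C, hq, ?_, fun w hw => hl w hw.1⟩,
    χ.source ∩ {y | φ =ᶠ[𝓝 y] χ}, χ.open_source.inter isOpen_setOfPred_eventually_nhds,
    ⟨by rw [hχs]; exact ⟨ht', hx'⟩, ?_⟩, fun w hw => ⟨hw.1.1, trivial⟩,
    fun w hw => liftMap_congr hw.1.2 w.2⟩
  · show χ.source ×ˢ univ = _
    rw [hχs]; ext w; simp
  · show φ =ᶠ[𝓝 z] χ
    filter_upwards [e] with y hy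
    rw [hy, hχ]

theorem equivalenceGroup_eq :
    equivalenceGroup = generatedPseudogroup (formTransformations ∪ swapTransformation) := by
  refine Subset.antisymm (fun 𝒯 h𝒯 => ?_)
    (sInter_subset_of_mem ⟨isPseudogroup_equivalenceGroup, generators_subset⟩)
  rintro P ⟨hP, hS⟩
  obtain ⟨φ, hφ, h⟩ := mem_equivalenceGroup_iff.1 h𝒯
  refine hP.local_mem 𝒯 φ hφ fun z hz => ?_
  rcases (h z hz).1 with hn | hn
  · obtain ⟨𝒮, h𝒮, V, oV, hzV, hVs, hV⟩ := hn.exists_generator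
    refine ⟨𝒮, hS (Or.inl h𝒮), V ∩ φ.source, oV.inter φ.open_source, ⟨hzV, hz⟩,
      fun w hw => ⟨?_, hVs ⟨hw.1.1, trivial⟩⟩, fun w hw => ?_⟩
    · rw [hφ.source_eq]; exact ⟨hw.1.2, trivial⟩
    · rw [← hV ⟨hw.1.1, trivial⟩]
      exact (h w.1 hw.1.2).2 w.2
  · obtain ⟨𝒮, h𝒮, V, oV, hzV, hVs, hV⟩ := hn.exists_generator
    refine ⟨𝒮.trans swapHomeo.toOpenPartialHomeomorph,
      hP.trans_mem _ (hS (Or.inl h𝒮)) _ (hS (Or.inr ⟨rfl, fun _ => rfl⟩)), V ∩ φ.source,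
      oV.inter φ.open_source, ⟨hzV, hz⟩, fun w hw => ⟨?_, hVs ⟨hw.1.1, trivial⟩, trivial⟩,
      fun w hw => ?_⟩
    · rw [hφ.source_eq]; exact ⟨hw.1.2, trivial⟩
    · show 𝒯 w = swapMap (𝒮 w)
      rw [← hV ⟨hw.1.1, trivial⟩, liftMap_swapBase_comp, swapMap_swapMap]
      exact (h w.1 hw.1.2).2 w.2

/-! ### Transformations of boxes -/

theorem isOpen_nearForm (φ : Base → Base) : IsOpen {z | NearForm φ z} := by
  refine isOpen_iff_mem_nhds.2 fun z hz => ?_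
  obtain ⟨I, J, T, X, U₀, C, hp, ht, hx, e⟩ := hz
  filter_upwards [e.eventuallyEq_nhds, hp.mem_nhds ht hx] with y hy hy'
  exact ⟨I, J, T, X, U₀, C, hp, hy'.1, hy'.2, hy⟩

theorem NearForm.not_swap {φ : Base → Base} {z : Base} (h : NearForm φ z)
    (h' : NearForm (swapBase ∘ φ) z) : False :=
  h'.formDeriv.X_x h.formDeriv.T_x

/-- On a box, all local parameters of a transformation are of the same type and fit together. -/
theorem exists_parameters_box {𝒯 : OpenPartialHomeomorph BaseF BaseF} (h𝒯 : 𝒯 ∈ equivalenceGroup)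
    {I J K : Set ℝ} (oI : IsOpen I) (oJ : IsOpen J) (oK : IsOpen K) (cI : I.OrdConnected)
    (cJ : J.OrdConnected) (cK : K.OrdConnected)
    (hsub : (I ×ˢ J ×ˢ K) ×ˢ (univ : Set ℝ) ⊆ 𝒯.source) :
    ∃ (T X : ℝ → ℝ) (U₀ : ℝ × ℝ → ℝ) (C : ℝ), IsParameter I J T X U₀ C ∧
      (EqOn 𝒯 (formMap T X U₀ C) ((I ×ˢ J ×ˢ K) ×ˢ (univ : Set ℝ)) ∨
        EqOn 𝒯 (swapMap ∘ formMap T X U₀ C) ((I ×ˢ J ×ˢ K) ×ˢ (univ : Set ℝ))) := by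
  rcases (I ×ˢ J ×ˢ K).eq_empty_or_nonempty with hE | ⟨z₀, hz₀⟩
  · refine ⟨fun t => t, fun x => x, fun _ => 0, 1, ⟨oI, oJ, cI, cJ, by fun_prop, by fun_prop,
      by fun_prop, by simp, by simp, one_ne_zero⟩, Or.inl ?_⟩
    rw [hE, empty_prod]
    exact eqOn_empty _ _
  obtain ⟨φ, hφ, h⟩ := mem_equivalenceGroup_iff.1 h𝒯
  have hmem : ∀ z ∈ I ×ˢ J ×ˢ K, z ∈ φ.source := fun z hz =>
    (hφ.source_eq ▸ hsub (mk_mem_prod hz (mem_univ 0)) : _ ∈ φ.source ×ˢ univ).1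
  have oB : IsOpen (I ×ˢ J ×ˢ K) := oI.prod (oJ.prod oK)
  have key : ∀ ψ : Base → Base, (∀ z ∈ I ×ˢ J ×ˢ K, NearForm ψ z) →
      ∃ (T X : ℝ → ℝ) (U₀ : ℝ × ℝ → ℝ) (C : ℝ), IsParameter I J T X U₀ C ∧
        EqOn (liftMap ψ) (formMap T X U₀ C) ((I ×ˢ J ×ˢ K) ×ˢ (univ : Set ℝ)) := by
    intro ψ hψ
    obtain ⟨T, X, U₀, C, hp, he⟩ := exists_parameters oI oJ cI cJ cK
      (fun z hz => (hψ z hz).contDiffAt) (fun z hz => (hψ z hz).formDeriv) hz₀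
    refine ⟨T, X, U₀, C, hp, fun w hw => ?_⟩
    exact (liftMap_congr (he.eventuallyEq_of_mem (oB.mem_nhds hw.1)) w.2).trans
      (hp.liftMap_formBase hw.1.1 hw.1.2.1 w.2)
  have hconn : IsPreconnected (I ×ˢ J ×ˢ K) :=
    (cI.convex.prod (cJ.convex.prod cK.convex)).isPreconnected
  have heq : ∀ w ∈ (I ×ˢ J ×ˢ K) ×ˢ (univ : Set ℝ), 𝒯 w = liftMap φ w := fun w hw =>
    (h w.1 (hmem w.1 hw.1)).2 w.2
  rcases isPreconnected_iff_subset_of_disjoint.1 hconn _ _ (isOpen_nearForm φ)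
    (isOpen_nearForm (swapBase ∘ φ)) (fun z hz => (h z (hmem z hz)).1)
    (eq_empty_of_forall_notMem fun z hz => hz.2.1.not_swap hz.2.2) with hn | hn
  · obtain ⟨T, X, U₀, C, hp, he⟩ := key φ hn
    exact ⟨T, X, U₀, C, hp, Or.inl fun w hw => (heq w hw).trans (he hw)⟩
  · obtain ⟨T, X, U₀, C, hp, he⟩ := key (swapBase ∘ φ) hn
    refine ⟨T, X, U₀, C, hp, Or.inr fun w hw => ?_⟩
    rw [heq w hw, Function.comp_apply, ← he hw, liftMap_swapBase_comp, swapMap_swapMap]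

end KleinGordon

theorem lemma2 :
    KleinGordon.pointGroupoid =
        KleinGordon.actionGroupoid KleinGordon.equivalenceGroup ∧
    KleinGordon.contactGroupoid =
        KleinGordon.prolongedActionGroupoid KleinGordon.equivalenceGroup ∧
    KleinGordon.equivalenceGroup =
        KleinGordon.generatedPseudogroup
          (KleinGordon.formTransformations ∪ KleinGordon.swapTransformation) ∧
    (∀ 𝒯 ∈ KleinGordon.equivalenceGroup, ∀ I J K : Set ℝ,
      IsOpen I → IsOpen J → IsOpen K → I.OrdConnected → J.OrdConnected → K.OrdConnected →
      (I ×ˢ J ×ˢ K) ×ˢ (Set.univ : Set ℝ) ⊆ 𝒯.source →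
      ∃ (T X : ℝ → ℝ) (U₀ : ℝ × ℝ → ℝ) (C : ℝ), KleinGordon.IsParameter I J T X U₀ C ∧
        (Set.EqOn 𝒯 (KleinGordon.formMap T X U₀ C) ((I ×ˢ J ×ˢ K) ×ˢ (Set.univ : Set ℝ)) ∨
         Set.EqOn 𝒯 (KleinGordon.swapMap ∘ KleinGordon.formMap T X U₀ C)
          ((I ×ˢ J ×ˢ K) ×ˢ (Set.univ : Set ℝ)))) := by
  exact ⟨KleinGordon.pointGroupoid_eq, KleinGordon.contactGroupoid_eq,
    KleinGordon.equivalenceGroup_eq, fun 𝒯 h𝒯 I J K oI oJ oK cI cJ cK hsub =>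
      KleinGordon.exists_parameters_box h𝒯 oI oJ oK cI cJ cK hsub⟩
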